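/- Let $k$ be an algebraically closed field, $K$ an algebraic function field of dimension 2 over $k$ (a finitely generated field extension of transcendence degree 2) and $K^*$ a finite extension of $K$. A subring of $K$ or $K^*$ containing $k$ is called *algebraic* if it is essentially of finite type over $k$. A local ring $B$ of $K^*$ *lies over* a local ring $A$ of $K$ ($A$ *lies below* $B$) if $B$ is the localization of the integral closure of $A$ in $K^*$ at a maximal ideal. A local ring $B$ dominates a local ring $A$ if $A\subset B$ and $m_B\cap A=m_A$. A *quadratic transform* of a local domain $A$ is a ring $A[m_A/z]_P$ with $0\ne z\in m_A$ and $P$ a prime ideal of $A[m_A/z]$ with $P\cap A=m_A$; it is *along* a valuation if the valuation ring dominates it. $\hat A$ is the completion of $A$ at $m_A$, and $\Gamma_\nu$ is the value group of a valuation $\nu$. Let $\nu$ be a rank 1, rational rank 2 valuation of $K$ and $\nu^*$ an extension of $\nu$ to $K^*$. Let $R_0$ be an algebraic regular local ring with quotient field $K$ and maximal ideal $m_{R_0}=(u,v)$, and let $S$ be an algebraic regular local ring with quotient field $K^*$ and maximal ideal $m_S=(x,y)$, such that $S$ dominates $R_0$ and $$u=x^ay^b\delta_1,\qquad v=x^cy^d\delta_2$$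 for some natural numbers $a,b,c,d\ge 0$ and units $\delta_1,\delta_2\in S$, where the characteristic of $k$ does not divide $ad-bc$ (in characteristic 0: $ad-bc\neq0$). Suppose that the valuation ring of $\nu^*$ dominates $S$ and that $\nu(u),\nu(v)$ are rationally independent. Then $$\Gamma_\nu=\mathbf Z\nu(u)+\mathbf Z\nu(v),$$ $\nu^*$ is a rank 1, rational rank 2 valuation of $K^*$, $\nu^*(x),\nu^*(y)$ are rationally independent, and $$\Gamma_{\nu^*}=\mathbf Z\nu^*(x)+\mathbf Z\nu^*(y).$$ Moreover, let $S\to S_1$ be a finite (possibly empty) sequence of quadratic transforms along $\nu^*$. Then $S_1$ is a two-dimensional regular local ring with regular parameters $(\bar x_1,\bar y_1)$ such that $$x=\bar x_1^{\bar a}\bar y_1^{\bar b},\qquad y=\bar x_1^{\bar c}\bar y_1^{\bar d}$$ for natural numbers $\bar a,\bar b,\bar c,\bar d\ge0$ with $\bar a\bar d-\bar b\bar c=\pm1$, and there exists a unique algebraic normal local ring $R_1$ with quotient field $K$ which lies below $S_1$. There is a faithful action of the group $\Gamma_{\nu^*}/\Gamma_\nu$ on $\hat S_1$ by $k$-algebra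 automorphisms, each of which multiplies $\bar x_1$ and $\bar y_1$ by roots of unity in $k$, and an isomorphism of $k$-algebras $$e:\hat R_1\;\cong\;\hat S_1^{\,\Gamma_{\nu^*}/\Gamma_\nu}.$$ The isomorphism can be chosen so that, for some $k$-algebra automorphism $\theta$ of $\hat S_1$ that maps each of $\bar x_1,\bar y_1$ to a unit multiple of itself, $\theta\circ e$ restricts on $R_1$ to the inclusion $R_1\subset S_1\subset\hat S_1$. -/

import Mathlib

open IsLocalRing

noncomputable section

/-! ### Valuations -/

section Val

variable {F Γ₀ : Type*} [Field F] [LinearOrderedCommGroupWithZero Γ₀]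

/-- The value group `Γ_ν` of a (multiplicatively written) valuation `ν`. -/
abbrev valGroup (ν : Valuation F Γ₀) : Subgroup Γ₀ˣ :=
  MonoidWithZeroHom.valueGroup (MonoidWithZeroHom.ofClass ν)

/-- `ν` has rank 1: it is nontrivial and its value group embeds, as an ordered group, in the
(multiplicative) positive real numbers. -/
def HasRankOne (ν : Valuation F Γ₀) : Prop := Nonempty ν.RankOne

/-- `ν` has rational rank 2: the abelian group `Γ_ν` has rank 2. -/
def HasRationalRankTwo (ν : Valuation F Γ₀) : Prop :=
  Module.rank ℤ (Additive (valGroup ν)) = 2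

/-- `f, g ≠ 0` and `ν(f), ν(g)` are rationally independent (values are written
multiplicatively, so `m ν(f) + n ν(g) = 0` becomes `ν f ^ m * ν g ^ n = 1`). -/
def RatIndep (ν : Valuation F Γ₀) (f g : F) : Prop :=
  f ≠ 0 ∧ g ≠ 0 ∧ ∀ m n : ℤ, ν f ^ m * ν g ^ n = 1 → m = 0 ∧ n = 0

/-- `Γ_ν = ℤ ν(f) + ℤ ν(g)`. -/
def ValGroupGeneratedBy (ν : Valuation F Γ₀) (f g : F) : Prop :=
  (valGroup ν : Set Γ₀ˣ) = {γ : Γ₀ˣ | ∃ m n : ℤ, (γ : Γ₀) = ν f ^ m * ν g ^ n}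

/-- The quotient `Γ_μ / Γ_ν` of value groups (used when `μ` extends `ν`, so `Γ_ν ≤ Γ_μ`). -/
abbrev ValGroupQuotient {E : Type*} [Field E] (μ : Valuation E Γ₀) (ν : Valuation F Γ₀) : Type _ :=
  valGroup μ ⧸ (valGroup ν).subgroupOf (valGroup μ)

variable {k : Type*} [Field k] [Algebra k F]

/-- The valuation ring of `ν` dominates the local ring `S`: it contains `S`, and its maximal ideal
meets `S` in the nonunits of `S`. -/
def ValDominates (ν : Valuation F Γ₀) (S : Subalgebra k F) : Prop :=
  ∀ s : S, ν (s : F) ≤ 1 ∧ (ν (s : F) < 1 ↔ s ∈ nonunits S)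

end Val

/-! ### Local subrings of function fields -/

section Rings

variable {k K L : Type*} [Field k] [Field K] [Field L] [Algebra k K] [Algebra k L] [Algebra K L]

/-- `S ⊆ L` dominates `R ⊆ K`, where `L` is an extension of `K`:
`R ⊆ S` and `m_S ∩ R = m_R`. -/
def Dominates (R : Subalgebra k K) (S : Subalgebra k L) [IsLocalRing R] [IsLocalRing S] : Prop :=
  ∀ r : R, ∃ h : algebraMap K L (r : K) ∈ S,
    ((⟨algebraMap K L (r : K), h⟩ : S) ∈ maximalIdeal S ↔ r ∈ maximalIdeal R)

/-- Inside the field `L`, the ring `T` is the localization of (the image of) `A` at `P`. -/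
def IsLocalizedAt {A : Type*} [CommRing A] [Algebra A L] (P : Ideal A) (T : Subalgebra k L) :
    Prop :=
  ∀ t : L, t ∈ T ↔ ∃ a b : A, b ∉ P ∧ t = algebraMap A L a / algebraMap A L b

/-- `R ⊆ K` lies below `S ⊆ L` (and `S` lies over `R`): `S` is the localization of the integral
closure of `R` in `L` at a maximal ideal. -/
def LiesBelow (R : Subalgebra k K) (S : Subalgebra k L) : Prop :=
  ∃ M : Ideal (integralClosure R L), M.IsMaximal ∧ IsLocalizedAt M S

/-- `R` is an algebraic normal local ring with quotient field `K`: a normal local ring that is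
essentially of finite type over `k` and has quotient field `K`. -/
structure IsAlgebraicNormalLocalRing (R : Subalgebra k K) : Prop where
  isLocalRing : IsLocalRing R
  essFiniteType : Algebra.EssFiniteType k R
  isFractionRing : IsFractionRing R K
  isIntegrallyClosed : IsIntegrallyClosed R

/-- The ring `S[m_S / x]` inside `L`. -/
def blowupAlgebra (S : Subalgebra k L) [IsLocalRing S] (x : S) : Subalgebra k L :=
  Algebra.adjoin k ((S : Set L) ∪ {z | ∃ p ∈ maximalIdeal S, z = (p : L) / (x : L)})

theorem le_blowupAlgebra (S : Subalgebra k L) [IsLocalRing S] (x : S) :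
    S ≤ blowupAlgebra S x :=
  fun _ hs => Algebra.subset_adjoin (Or.inl hs)

/-- `S → T` is a quadratic transform: `T = S[m_S / x]_P` for some `0 ≠ x ∈ m_S` and some prime
ideal `P` of `S[m_S / x]` with `P ∩ S = m_S`. -/
def IsQuadraticTransform (S T : Subalgebra k L) : Prop :=
  ∃ (_ : IsLocalRing S) (x : S), x ∈ maximalIdeal S ∧ x ≠ 0 ∧
    ∃ P : Ideal (blowupAlgebra S x), P.IsPrime ∧
      P.comap (Subalgebra.inclusion (le_blowupAlgebra S x)) = maximalIdeal S ∧
      IsLocalizedAt P T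

/-- `S → S₁` is a (finite, possibly empty) sequence of quadratic transforms along `ν`. -/
def IsQuadraticSequenceAlong {Γ₀ : Type*} [LinearOrderedCommGroupWithZero Γ₀]
    (ν : Valuation L Γ₀) (S S₁ : Subalgebra k L) : Prop :=
  Relation.ReflTransGen (fun A B => IsQuadraticTransform A B ∧ ValDominates ν B) S S₁

/-- `(x, y)` is a regular system of parameters of the two-dimensional regular local ring `S`. -/
def AreRegularParameters (S : Subalgebra k L) [IsRegularLocalRing S] (x y : S) : Prop :=
  ringKrullDim S = 2 ∧ maximalIdeal S = Ideal.span {x, y}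

/-- The completion of a local ring at its maximal ideal. -/
abbrev Completion (S : Subalgebra k L) [IsLocalRing S] : Type _ :=
  AdicCompletion (maximalIdeal S) S

end Rings

/-- The `k`-algebra of invariants of a group acting on `A` by `k`-algebra automorphisms. -/
def invariants {k A G : Type*} [Field k] [CommRing A] [Algebra k A] [Group G]
    (ρ : G →* (A ≃ₐ[k] A)) : Subalgebra k A where
  carrier := {f | ∀ g, ρ g f = f}
  mul_mem' ha hb g := by rw [map_mul, ha g, hb g]
  add_mem' ha hb g := by rw [map_add, ha g, hb g]
  algebraMap_mem' c g := (ρ g).commutes c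

end

noncomputable section

/-! ### Values of sums of monomials in elements with independent values -/

section MonomialValues

variable {F Γ₀ : Type*} [Field F] [LinearOrderedCommGroupWithZero Γ₀]

/-! Everything rests on the notion of a monomial chart (`IsMonomialChart`): a local ring with
residue field `k`, dominated by an archimedean valuation, whose maximal ideal is generated by two
elements of rationally independent values. Distinct monomials in these parameters have distinct
values, so a polynomial has the value of its leading monomial. Polynomials are dense modulo powers
of the maximal ideal, and those powers have arbitrarily small values (valuations are multiplicative
here), so every nonzero element has the value of a monomial. This yields the value group
(`valGroupGeneratedBy`), dimension two, regularity and normality. Both `R₀` and `S` are charts: an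
element without residue in `k` would be transcendental, and with two elements of independent values
it would give transcendence degree three. A quadratic transform along the valuation replaces `(z₀,
z₁)` by `(z₀, z₁ / z₀)`, up to order, so it is again a chart and the change of parameters is
unimodular.

The completion of the chart `S₁` is `k[[X₀, X₁]]`. In it `u` and `v` are monomials times units, and
the exponent determinant `D` is prime to the characteristic, so units have `D`-th roots and can be
absorbed into the parameters: `u`, `v` become pure monomials. Let `Λ` be the set of natural vectors
in the lattice spanned by their exponents, and take `R₁ = S₁ ∩ K`. Elements of `R₀` are series in
`u`, `v`, hence supported in `Λ`, and so are the quotients of them that lie in `S₁`. Conversely each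
exponent in `Λ` is realized by a Laurent monomial in `u`, `v` that lies in `S₁`. Discarding the
exponents outside `Λ` is a `k[[Λ]]`-linear retraction, so ideals are contracted from `k[[X₀, X₁]]`
(`IsToricChart.mem_of_map_mem_map`). This identifies `R₁` with a localization of `R₀` with these
monomials adjoined; it is essentially of finite type and has completion `k[[Λ]]`.

A monomial has exponent in `Λ` exactly when its value lies in `Γ_ν`. The characters of `Γ_μ / Γ_ν`
therefore act diagonally with invariants `k[[Λ]]`, and a finite abelian group of exponent prime to
the characteristic is isomorphic to its character group. Powers of the parameters of `S₁` are
associated to elements of `R₁`, so Zariski's main theorem makes `R₁` lie below `S₁`. For uniqueness,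
a normal local ring below `S₁` is contained in `S₁ ∩ K`, and contraction of ideals with Zariski's
main theorem forces equality. The automorphism `θ` compares the given parameters with those adjusted
by roots of units. -/

theorem RatIndep.pow_mul_pow_injective {μ : Valuation F Γ₀} {x y : F} (h : RatIndep μ x y)
    {l l' : Fin 2 →₀ ℕ}
    (e : μ x ^ l 0 * μ y ^ l 1 = μ x ^ l' 0 * μ y ^ l' 1) : l = l' := by
  obtain ⟨hx, hy, h⟩ := h
  have hx' : μ x ≠ 0 := (Valuation.ne_zero_iff _).2 hx
  have hy' : μ y ≠ 0 := (Valuation.ne_zero_iff _).2 hy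
  have := h (l 0 - l' 0) (l 1 - l' 1) (by
    rw [zpow_sub₀ hx', zpow_sub₀ hy']
    simp only [zpow_natCast]
    rw [div_mul_div_comm, e, div_self]
    exact mul_ne_zero (pow_ne_zero _ hx') (pow_ne_zero _ hy'))
  ext i
  fin_cases i
  · simpa [sub_eq_zero] using this.1
  · simpa [sub_eq_zero] using this.2

/-- A nonempty sum whose terms are nonzero of pairwise distinct values has the largest value of its
terms. -/
theorem Valuation.exists_map_sum_eq_of_injOn (μ : Valuation F Γ₀) {ι : Type*} (s : Finset ι)
    (hs : s.Nonempty) (f : ι → F) (hf : ∀ i ∈ s, f i ≠ 0) (hinj : Set.InjOn (fun i => μ (f i)) s) :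
    ∃ i ∈ s, μ (∑ i ∈ s, f i) = μ (f i) ∧ ∀ j ∈ s, μ (f j) ≤ μ (f i) := by
  classical
  obtain ⟨i, hi, hmax⟩ := s.exists_max_image (fun i => μ (f i)) hs
  refine ⟨i, hi, ?_, hmax⟩
  rw [← Finset.add_sum_erase _ _ hi, Valuation.map_add_eq_of_lt_left]
  refine Valuation.map_sum_lt _ ((Valuation.ne_zero_iff _).2 (hf i hi)) fun j hj => ?_
  rw [Finset.mem_erase] at hj
  exact lt_of_le_of_ne (hmax j hj.2) fun e => hj.1 (hinj hj.2 hi e)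

/-- A nonempty sum of distinct monomials in `x, y`, with coefficients of value one, has the
largest value of its terms. -/
theorem RatIndep.exists_map_sum_eq {μ : Valuation F Γ₀} {x y : F} (h : RatIndep μ x y)
    (s : Finset (Fin 2 →₀ ℕ)) (hs : s.Nonempty) (c : (Fin 2 →₀ ℕ) → F)
    (hc : ∀ l ∈ s, μ (c l) = 1) :
    ∃ l ∈ s, μ (∑ l ∈ s, c l * (x ^ l 0 * y ^ l 1)) = μ x ^ l 0 * μ y ^ l 1 ∧
      ∀ l' ∈ s, μ x ^ l' 0 * μ y ^ l' 1 ≤ μ x ^ l 0 * μ y ^ l 1 := by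
  have hval : ∀ l ∈ s, μ (c l * (x ^ l 0 * y ^ l 1)) = μ x ^ l 0 * μ y ^ l 1 := by
    intro l hl
    simp [hc l hl]
  obtain ⟨l, hl, h1, h2⟩ := μ.exists_map_sum_eq_of_injOn s hs
    (fun l => c l * (x ^ l 0 * y ^ l 1))
    (fun l hl => by
      rw [← Valuation.ne_zero_iff μ, hval l hl]
      exact mul_ne_zero (pow_ne_zero _ ((Valuation.ne_zero_iff _).2 h.1))
        (pow_ne_zero _ ((Valuation.ne_zero_iff _).2 h.2.1)))
    (fun l hl l' hl' e => h.pow_mul_pow_injective (by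
      simpa only [hval l hl, hval l' hl'] using e))
  refine ⟨l, hl, h1.trans (hval l hl), fun l' hl' => ?_⟩
  simpa only [hval l hl, hval l' hl'] using h2 l' hl'

end MonomialValues

/-! ### The residue field of a dominated local ring -/

section Residue

variable {k F Γ₀ : Type*} [Field k] [Field F] [Algebra k F] [LinearOrderedCommGroupWithZero Γ₀]

theorem ValDominates.map_lt_one {μ : Valuation F Γ₀} {T : Subalgebra k F} [IsLocalRing T]
    (h : ValDominates μ T) {t : T} (ht : t ∈ maximalIdeal T) : μ (t : F) < 1 :=
  (h t).2.2 ((mem_maximalIdeal t).1 ht)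

theorem ValDominates.mem_maximalIdeal {μ : Valuation F Γ₀} {T : Subalgebra k F} [IsLocalRing T]
    (h : ValDominates μ T) {t : T} (ht : μ (t : F) < 1) : t ∈ maximalIdeal T :=
  (IsLocalRing.mem_maximalIdeal t).2 ((h t).2.1 ht)

theorem ValDominates.map_eq_one {μ : Valuation F Γ₀} {T : Subalgebra k F} [IsLocalRing T]
    (h : ValDominates μ T) {t : T} (ht : t ∉ maximalIdeal T) : μ (t : F) = 1 :=
  le_antisymm (h t).1 (not_lt.1 fun hlt => ht (h.mem_maximalIdeal hlt))

theorem ValDominates.map_algebraMap {μ : Valuation F Γ₀} {T : Subalgebra k F} [IsLocalRing T]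
    (h : ValDominates μ T) {c : k} (hc : c ≠ 0) : μ (algebraMap k F c) = 1 :=
  h.map_eq_one (t := algebraMap k T c)
    (by rw [IsLocalRing.mem_maximalIdeal, mem_nonunits_iff, not_not]
        exact (IsUnit.mk0 c hc).map _)

/-- If a local ring dominated by a valuation of a two-dimensional function field has two elements
of independent values, its residue field is the ground field. -/
theorem exists_sub_algebraMap_mem_maximalIdeal [IsAlgClosed k] (hdim : Algebra.trdeg k F ≤ 2)
    {μ : Valuation F Γ₀} {T : Subalgebra k F} [IsLocalRing T] (h : ValDominates μ T)
    {x y : F} (hxy : RatIndep μ x y) (t : T) :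
    ∃ c : k, t - algebraMap k T c ∈ maximalIdeal T := by
  classical
  by_contra! hcon
  -- Over an algebraically closed field `p(t)` is a constant times a product of factors `t - r`,
  -- each a unit of `T` because no `r` is a residue of `t`.
  have hpoly : ∀ p : Polynomial k, p ≠ 0 → μ (Polynomial.aeval (t : F) p) = 1 := by
    intro p hp
    rw [(IsAlgClosed.splits p).eq_prod_roots, map_mul, map_mul, Polynomial.aeval_C,
      h.map_algebraMap (Polynomial.leadingCoeff_ne_zero.2 hp), one_mul, map_multiset_prod,
      map_multiset_prod]
    refine Multiset.prod_eq_one fun a ha => ?_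
    simp only [Multiset.mem_map] at ha
    obtain ⟨_, ⟨_, ⟨r, -, rfl⟩, rfl⟩, rfl⟩ := ha
    simpa using h.map_eq_one (hcon r)
  have htr : AlgebraicIndependent k (fun _ : Unit => (t : F)) := by
    rw [algebraicIndependent_unique_type_iff]
    rw [transcendental_iff]
    intro p hp
    by_contra h0
    have := hpoly p h0
    simp [hp] at this
  have hmap : ∀ a : Algebra.adjoin k (Set.range fun _ : Unit => (t : F)), a ≠ 0 →
      μ (a : F) = 1 := by
    rintro ⟨a, ha⟩ h0
    rw [Set.range_const, Algebra.adjoin_singleton_eq_range_aeval] at ha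
    obtain ⟨p, rfl⟩ := ha
    refine hpoly p ?_
    rintro rfl
    exact h0 (by ext; simp)
  -- Nonzero coefficients in `k[t]` have value one, so the terms of a polynomial in `x`, `y` have
  -- distinct values and cannot cancel. Thus `t, x, y` are three independent elements.
  have hxy' : AlgebraicIndependent (Algebra.adjoin k (Set.range fun _ : Unit => (t : F)))
      (![x, y] : Fin 2 → F) := by
    rw [algebraicIndependent_iff]
    intro p hp
    by_contra h0
    have hne : p.support.Nonempty := MvPolynomial.support_nonempty.2 h0
    obtain ⟨l, -, hl, -⟩ := hxy.exists_map_sum_eq p.support hne (fun l => (p.coeff l).1)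
      (fun l hl => hmap _ (MvPolynomial.mem_support_iff.1 hl))
    rw [MvPolynomial.aeval_def, MvPolynomial.eval₂_eq'] at hp
    simp only [Fin.prod_univ_two, Matrix.cons_val_zero, Matrix.cons_val_one,
      Subalgebra.algebraMap_def, Algebra.algebraMap_self, RingHom.id_apply] at hp
    rw [hp, map_zero] at hl
    exact mul_ne_zero (pow_ne_zero _ ((Valuation.ne_zero_iff _).2 hxy.1))
      (pow_ne_zero _ ((Valuation.ne_zero_iff _).2 hxy.2.1)) hl.symm
  have := (AlgebraicIndependent.sumElim htr hxy').lift_cardinalMk_le_trdeg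
  simp only [Cardinal.mk_fintype, Fintype.card_sum, Fintype.card_fin, Fintype.card_unit,
    Cardinal.lift_natCast, Cardinal.lift_uzero] at this
  have h3 := this.trans hdim
  norm_num at h3

end Residue

/-! ### Rank one as an archimedean property, and its passage to algebraic extensions -/

section Archimedean

variable {F Γ₀ : Type*} [Field F] [LinearOrderedCommGroupWithZero Γ₀]

/-- The powers of an element of value less than one have arbitrarily small values. -/
def IsArchimedeanVal (μ : Valuation F Γ₀) : Prop :=
  ∀ a b : F, a ≠ 0 → μ b < 1 → ∃ n : ℕ, μ b ^ n < μ a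

open MonoidWithZeroHom in
-- The embedding of the values in the reals reduces this to powers of a real number below one. The
-- archimedean form is the convenient one because it passes to algebraic extensions, after which
-- rank one is recovered from it.
theorem HasRankOne.isArchimedeanVal {μ : Valuation F Γ₀} (h : HasRankOne μ) :
    IsArchimedeanVal μ := by
  obtain ⟨h⟩ := h
  intro a b ha hb
  have hlt : ∀ c d : F, μ c < μ d ↔ h.hom' (ValueGroup₀.restrict₀ (.ofClass μ) c) <
      h.hom' (ValueGroup₀.restrict₀ (.ofClass μ) d) := by
    intro c d
    rw [h.strictMono'.lt_iff_lt, ← (ValueGroup₀.embedding_strictMono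
      (f := MonoidWithZeroHom.ofClass μ)).lt_iff_lt,
      ValueGroup₀.embedding_restrict₀, ValueGroup₀.embedding_restrict₀]
    rfl
  have h1 := (hlt b 1).1 (by simpa using hb)
  have h2 := (hlt 0 a).1 (by simpa [zero_lt_iff] using ha)
  simp only [map_one, map_zero] at h1 h2
  obtain ⟨n, hn⟩ := exists_pow_lt_of_lt_one h2 h1
  refine ⟨n, ?_⟩
  rw [← map_pow, hlt, map_pow, map_pow]
  exact hn

open MonoidWithZeroHom in
theorem IsArchimedeanVal.hasRankOne {μ : Valuation F Γ₀} (h : IsArchimedeanVal μ)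
    {x : F} (hx : x ≠ 0) (hx1 : μ x ≠ 1) : HasRankOne μ := by
  have : μ.IsNontrivial := ⟨⟨x, (Valuation.ne_zero_iff _).2 hx, hx1⟩⟩
  refine Valuation.nonempty_rankOne_iff_mulArchimedean.2 ⟨fun a b hb => ?_⟩
  obtain ⟨a, rfl⟩ := ValueGroup₀.restrict₀_surjective _ a
  obtain ⟨b, rfl⟩ := ValueGroup₀.restrict₀_surjective _ b
  have hle : ∀ c d : F, ValueGroup₀.restrict₀ (.ofClass μ) c ≤
      ValueGroup₀.restrict₀ (.ofClass μ) d ↔ μ c ≤ μ d := by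
    intro c d
    rw [← ValueGroup₀.embedding_strictMono.le_iff_le,
      ValueGroup₀.embedding_restrict₀, ValueGroup₀.embedding_restrict₀]
    rfl
  rcases eq_or_ne a 0 with rfl | ha
  · exact ⟨0, by simp⟩
  have hb' : 1 < μ b := by
    rw [← map_one (ValueGroup₀.restrict₀ (.ofClass μ)), ← not_le, hle] at hb
    simpa using hb
  have hb0 : b ≠ 0 := by rintro rfl; simp at hb'
  obtain ⟨n, hn⟩ := h a⁻¹ b⁻¹ (inv_ne_zero ha) (by
    rw [map_inv₀]; exact inv_lt_one_of_one_lt₀ hb')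
  refine ⟨n, ?_⟩
  rw [← map_pow, hle, map_pow]
  rw [map_inv₀, map_inv₀, inv_pow] at hn
  exact ((inv_lt_inv₀ (pow_pos (zero_lt_iff.2 ((Valuation.ne_zero_iff _).2 hb0)) _)
    (zero_lt_iff.2 ((Valuation.ne_zero_iff _).2 ha))).1 hn).le

/-- In a vanishing polynomial relation two terms must tie in value, since otherwise the sum would
have the value of its largest term. Dividing the two tied terms gives a power of `a` with the value
of an element of `K`. -/
theorem Valuation.exists_pow_eq_of_isAlgebraic {K L : Type*} [Field K] [Field L] [Algebra K L]
    (μ : Valuation L Γ₀) {a : L} (ha : a ≠ 0) (hal : IsAlgebraic K a) :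
    ∃ n : ℕ, 0 < n ∧ ∃ c : K, c ≠ 0 ∧ μ a ^ n = μ (algebraMap K L c) := by
  obtain ⟨p, hp, hpa⟩ := hal
  have ha' : μ a ≠ 0 := (Valuation.ne_zero_iff _).2 ha
  have hc : ∀ i ∈ p.support, algebraMap K L (p.coeff i) ≠ 0 := fun i hi =>
    (map_ne_zero _).2 (Polynomial.mem_support_iff.1 hi)
  have hinj : ¬ Set.InjOn (fun i => μ (algebraMap K L (p.coeff i) * a ^ i)) p.support := by
    intro hinj
    obtain ⟨i, hi, h1, -⟩ := μ.exists_map_sum_eq_of_injOn p.support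
      (Polynomial.support_nonempty.2 hp) _
      (fun i hi => mul_ne_zero (hc i hi) (pow_ne_zero _ ha)) hinj
    rw [Polynomial.aeval_def, Polynomial.eval₂_eq_sum, Polynomial.sum_def] at hpa
    rw [hpa, map_zero] at h1
    exact (Valuation.ne_zero_iff μ).2 (mul_ne_zero (hc i hi) (pow_ne_zero _ ha)) h1.symm
  simp only [Set.InjOn, not_forall] at hinj
  obtain ⟨i, hi, j, hj, he, hij⟩ := hinj
  wlog hlt : i < j generalizing i j
  · exact this j hj i hi he.symm (Ne.symm hij) (lt_of_le_of_ne (not_lt.1 hlt) (Ne.symm hij))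
  refine ⟨j - i, by omega, p.coeff i / p.coeff j, div_ne_zero
    (Polynomial.mem_support_iff.1 hi) (Polynomial.mem_support_iff.1 hj), ?_⟩
  rw [map_div₀, map_div₀, eq_div_iff ((Valuation.ne_zero_iff μ).2 (hc j hj))]
  simp only [map_mul, map_pow] at he
  have : μ a ^ j = μ a ^ (j - i) * μ a ^ i := by rw [← pow_add]; congr 1; omega
  rw [this, ← mul_assoc] at he
  rw [mul_comm]
  exact (mul_right_cancel₀ (pow_ne_zero _ ha') he).symm

theorem IsArchimedeanVal.of_isAlgebraic {K L : Type*} [Field K] [Field L] [Algebra K L]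
    [Algebra.IsAlgebraic K L] {ν : Valuation K Γ₀} (h : IsArchimedeanVal ν)
    (μ : Valuation L Γ₀) (hext : μ.comap (algebraMap K L) = ν) : IsArchimedeanVal μ := by
  subst hext
  intro a b ha hb
  rcases eq_or_ne b 0 with rfl | hb0
  · exact ⟨1, by simpa [zero_lt_iff] using ha⟩
  obtain ⟨n, hn, c, hc, hac⟩ := μ.exists_pow_eq_of_isAlgebraic ha
    (Algebra.IsAlgebraic.isAlgebraic (R := K) a)
  obtain ⟨m, hm, d, hd, hbd⟩ := μ.exists_pow_eq_of_isAlgebraic hb0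
    (Algebra.IsAlgebraic.isAlgebraic (R := K) b)
  obtain ⟨N, hN⟩ := h c d hc (by
    rw [Valuation.comap_apply, ← hbd]; exact pow_lt_one₀ zero_le hb hm.ne')
  rw [Valuation.comap_apply, Valuation.comap_apply, ← hac, ← hbd, ← pow_mul] at hN
  -- It suffices to compare `n`-th powers: `μ b ^ (m * N * n) ≤ μ b ^ (m * N) < μ a ^ n`, the first
  -- inequality because `μ b < 1` and `n ≥ 1`.
  refine ⟨m * N, lt_of_pow_lt_pow_left₀ n zero_le (lt_of_le_of_lt ?_ hN)⟩
  exact pow_le_of_le_one zero_le (pow_le_one₀ zero_le hb.le) hn.ne'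

end Archimedean

/-! ### Density of the algebra spanned by generators of the maximal ideal -/

section LocalGenerators

variable {k T : Type*} [Field k] [CommRing T] [IsLocalRing T] [Algebra k T]

/-- In a local ring with residue field `k`, the algebra spanned by generators of the maximal ideal
is dense. -/
theorem IsLocalRing.exists_mem_adjoin_sub_mem_pow {Y : Set T}
    (hY : maximalIdeal T = Ideal.span Y)
    (hres : ∀ t : T, ∃ c : k, t - algebraMap k T c ∈ maximalIdeal T) (n : ℕ) :
    ∀ t : T, ∃ w ∈ Algebra.adjoin k Y, t - w ∈ maximalIdeal T ^ n := by
  induction n with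
  | zero => exact fun t => ⟨0, zero_mem _, by simp⟩
  | succ n ih =>
    have key : ∀ s ∈ Ideal.span Y, ∃ w ∈ Algebra.adjoin k Y, s - w ∈ maximalIdeal T ^ (n + 1) := by
      intro s hs
      induction hs using Submodule.span_induction with
      | mem y hy => exact ⟨y, Algebra.subset_adjoin hy, by simp⟩
      | zero => exact ⟨0, zero_mem _, by simp⟩
      | add s s' _ _ h h' =>
        obtain ⟨w, hw, h⟩ := h
        obtain ⟨w', hw', h'⟩ := h'
        refine ⟨w + w', add_mem hw hw', ?_⟩
        rw [add_sub_add_comm]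
        exact add_mem h h'
      | smul r s hs h =>
        obtain ⟨w, hw, h⟩ := h
        obtain ⟨v, hv, h'⟩ := ih r
        refine ⟨v * w, mul_mem hv hw, ?_⟩
        have hwm : w ∈ maximalIdeal T := by
          have h1 : s - w ∈ maximalIdeal T := Ideal.pow_le_self (Nat.succ_ne_zero n) h
          have h2 : s ∈ maximalIdeal T := by rw [hY]; exact hs
          simpa using sub_mem h2 h1
        have : r • s - v * w = r * (s - w) + (r - v) * w := by rw [smul_eq_mul]; ring
        rw [this]
        exact add_mem (Ideal.mul_mem_left _ _ h) (by rw [pow_succ]; exact Ideal.mul_mem_mul h' hwm)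
    intro t
    obtain ⟨c, hc⟩ := hres t
    rw [hY] at hc
    obtain ⟨w, hw, h⟩ := key _ hc
    refine ⟨w + algebraMap k T c, add_mem hw (Subalgebra.algebraMap_mem _ _), ?_⟩
    rwa [sub_add_eq_sub_sub_swap]

end LocalGenerators

/-! ### Monomial charts: values, graded structure, regularity -/

section Chart

variable {k F Γ₀ : Type*} [Field k] [Field F] [Algebra k F] [LinearOrderedCommGroupWithZero Γ₀]

/-- The valuation `μ` dominates the local ring `T`, the residue field of `T` is `k`, and the maximal
ideal of `T` is generated by two elements of rationally independent values. -/
structure IsMonomialChart (μ : Valuation F Γ₀) (T : Subalgebra k F) [IsLocalRing T]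
    (z : Fin 2 → T) : Prop where
  arch : IsArchimedeanVal μ
  dom : ValDominates μ T
  res : ∀ t : T, ∃ c : k, t - algebraMap k T c ∈ maximalIdeal T
  span : maximalIdeal T = Ideal.span (Set.range z)
  ind : RatIndep μ (z 0 : F) (z 1 : F)

namespace IsMonomialChart

variable {μ : Valuation F Γ₀} {T : Subalgebra k F} [IsLocalRing T] {z : Fin 2 → T}

theorem mem_maximalIdeal (h : IsMonomialChart μ T z) (i : Fin 2) : z i ∈ maximalIdeal T := by
  rw [h.span]; exact Ideal.subset_span ⟨i, rfl⟩

theorem monomial_ne_zero (h : IsMonomialChart μ T z) (l : Fin 2 →₀ ℕ) :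
    μ (z 0 : F) ^ l 0 * μ (z 1 : F) ^ l 1 ≠ 0 :=
  mul_ne_zero (pow_ne_zero _ ((Valuation.ne_zero_iff _).2 h.ind.1))
    (pow_ne_zero _ ((Valuation.ne_zero_iff _).2 h.ind.2.1))

theorem exists_map_aeval (h : IsMonomialChart μ T z) {q : MvPolynomial (Fin 2) k} (hq : q ≠ 0) :
    ∃ l ∈ q.support, μ (MvPolynomial.aeval z q : T) = μ (z 0 : F) ^ l 0 * μ (z 1 : F) ^ l 1 ∧
      ∀ l' ∈ q.support,
        μ (z 0 : F) ^ l' 0 * μ (z 1 : F) ^ l' 1 ≤ μ (z 0 : F) ^ l 0 * μ (z 1 : F) ^ l 1 := by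
  obtain ⟨l, hl, h1, h2⟩ := h.ind.exists_map_sum_eq q.support (MvPolynomial.support_nonempty.2 hq)
    (fun l => algebraMap k F (q.coeff l))
    (fun l hl => h.dom.map_algebraMap (MvPolynomial.mem_support_iff.1 hl))
  refine ⟨l, hl, ?_, h2⟩
  rw [← h1, MvPolynomial.aeval_def, MvPolynomial.eval₂_eq']
  simp only [Fin.prod_univ_two, AddSubmonoidClass.coe_finsetSum, MulMemClass.coe_mul,
    SubmonoidClass.coe_pow]
  rfl

theorem le_map_aeval (h : IsMonomialChart μ T z) {q : MvPolynomial (Fin 2) k}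
    {l : Fin 2 →₀ ℕ} (hl : l ∈ q.support) :
    μ (z 0 : F) ^ l 0 * μ (z 1 : F) ^ l 1 ≤ μ (MvPolynomial.aeval z q : T) := by
  obtain ⟨l', hl', h1, h2⟩ := h.exists_map_aeval (q := q) (by rintro rfl; simp at hl)
  rw [h1]
  exact h2 l hl

theorem exists_aeval_sub_mem_pow (h : IsMonomialChart μ T z) (n : ℕ) (t : T) :
    ∃ q : MvPolynomial (Fin 2) k, t - MvPolynomial.aeval z q ∈ maximalIdeal T ^ n := by
  obtain ⟨w, hw, hn⟩ := IsLocalRing.exists_mem_adjoin_sub_mem_pow h.span h.res n t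
  rw [Algebra.adjoin_range_eq_range_aeval] at hw
  obtain ⟨q, rfl⟩ := hw
  exact ⟨q, hn⟩

/-- If `z i` is the parameter of larger value, elements of the `n`-th power of the maximal ideal
have value at most `μ (z i) ^ n`, which becomes arbitrarily small. -/
theorem exists_forall_mem_pow_lt (h : IsMonomialChart μ T z) {a : F} (ha : a ≠ 0) :
    ∃ n, ∀ t ∈ maximalIdeal T ^ n, μ (t : F) < μ a := by
  obtain ⟨i, hi⟩ : ∃ i, ∀ j, μ (z j : F) ≤ μ (z i : F) := Finite.exists_max _
  have h1 : ∀ t ∈ maximalIdeal T, μ (t : F) ≤ μ (z i : F) := by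
    intro t ht
    rw [h.span, Ideal.mem_span_range_iff_exists_fun] at ht
    obtain ⟨c, rfl⟩ := ht
    rw [AddSubmonoidClass.coe_finsetSum]
    refine Valuation.map_sum_le _ fun j _ => ?_
    rw [MulMemClass.coe_mul, map_mul]
    exact mul_le_of_le_one_of_le (h.dom (c j)).1 (hi j)
  have hn : ∀ n, ∀ t ∈ maximalIdeal T ^ n, μ (t : F) ≤ μ (z i : F) ^ n := by
    intro n
    induction n with
    | zero => intro t _; simpa using (h.dom t).1
    | succ n ih =>
      intro t ht
      rw [pow_succ] at ht
      refine Submodule.mul_induction_on ht (fun a ha b hb => ?_) fun a b ha hb => ?_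
      · rw [pow_succ, MulMemClass.coe_mul, map_mul]
        exact mul_le_mul' (ih a ha) (h1 b hb)
      · exact (Valuation.map_add _ _ _).trans (max_le ha hb)
  obtain ⟨n, hlt⟩ := h.arch a (z i) ha (h.dom.map_lt_one (h.mem_maximalIdeal i))
  exact ⟨n, fun t ht => (hn n t ht).trans_lt hlt⟩

/-- A polynomial in the parameters approximates `t` with an error smaller than `t`, so both have the
same value, and that of the polynomial is the value of its leading monomial. -/
theorem exists_map_eq (h : IsMonomialChart μ T z) {t : T} (ht : t ≠ 0) :
    ∃ l : Fin 2 →₀ ℕ, μ (t : F) = μ (z 0 : F) ^ l 0 * μ (z 1 : F) ^ l 1 := by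
  obtain ⟨n, hn⟩ := h.exists_forall_mem_pow_lt (a := (t : F)) (by simpa using ht)
  obtain ⟨q, hq⟩ := h.exists_aeval_sub_mem_pow n t
  have hlt := hn _ hq
  have heq : μ (t : F) = μ (MvPolynomial.aeval z q : T) := by
    rw [AddSubgroupClass.coe_sub, Valuation.map_sub_swap] at hlt
    have := Valuation.map_add_eq_of_lt_left μ hlt
    rw [add_sub_cancel] at this
    exact this.symm
  have hq0 : q ≠ 0 := by
    rintro rfl
    simp at heq
    exact ht heq
  obtain ⟨l, -, hl, -⟩ := h.exists_map_aeval hq0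
  exact ⟨l, heq.trans hl⟩

theorem valGroupGeneratedBy [IsFractionRing T F] (h : IsMonomialChart μ T z) :
    ValGroupGeneratedBy μ (z 0 : F) (z 1 : F) := by
  have hx : μ (z 0 : F) ≠ 0 := (Valuation.ne_zero_iff _).2 h.ind.1
  have hy : μ (z 1 : F) ≠ 0 := (Valuation.ne_zero_iff _).2 h.ind.2.1
  ext γ
  have hγ : γ ∈ (valGroup μ : Set Γ₀ˣ) ↔ ∃ f : F, μ f = γ := by
    have := MonoidWithZeroHom.valueGroup_eq_range (MonoidWithZeroHom.ofClass μ)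
    have h2 : (γ : Γ₀) ∈ Units.val '' (valGroup μ : Set Γ₀ˣ) ↔ γ ∈ (valGroup μ : Set Γ₀ˣ) :=
      Units.val_injective.mem_set_image
    rw [← h2, this]
    simp
  rw [hγ, Set.mem_ofPred_eq]
  constructor
  · rintro ⟨f, hf⟩
    obtain ⟨s, t, ht, rfl⟩ := IsFractionRing.div_surjective (A := T) f
    have hs : s ≠ 0 := by rintro rfl; simp at hf; exact γ.ne_zero hf.symm
    obtain ⟨l, hl⟩ := h.exists_map_eq hs
    obtain ⟨l', hl'⟩ := h.exists_map_eq (nonZeroDivisors.ne_zero ht)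
    refine ⟨l 0 - l' 0, l 1 - l' 1, ?_⟩
    rw [← hf, map_div₀, Subalgebra.algebraMap_def, Subalgebra.algebraMap_def,
      Algebra.algebraMap_self, RingHom.id_apply, RingHom.id_apply, hl, hl',
      zpow_sub₀ hx, zpow_sub₀ hy]
    simp only [zpow_natCast]
    rw [div_mul_div_comm]
  · rintro ⟨m, n, e⟩
    exact ⟨(z 0 : F) ^ m * (z 1 : F) ^ n, by simp [e]⟩

/-- The approximating polynomial can be chosen of order at least `n` while the precision `N` stays
arbitrary. This separation of the two exponents is what the next lemma exploits. -/
theorem exists_aeval_sub_mem_pow_of_mem_pow (h : IsMonomialChart μ T z) (N n : ℕ) {t : T}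
    (ht : t ∈ maximalIdeal T ^ n) :
    ∃ q ∈ MvPolynomial.idealOfVars (Fin 2) k ^ n,
      t - MvPolynomial.aeval z q ∈ maximalIdeal T ^ N := by
  have hmap : maximalIdeal T ^ n =
      (MvPolynomial.idealOfVars (Fin 2) k ^ n).map (MvPolynomial.aeval z) := by
    rw [Ideal.map_pow, h.span, MvPolynomial.idealOfVars, Ideal.map_span, ← Set.range_comp]
    congr 3
    ext i : 1
    simp
  rw [hmap] at ht
  induction ht using Submodule.span_induction with
  | mem t ht =>
    obtain ⟨q, hq, rfl⟩ := ht
    exact ⟨q, hq, by simp⟩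
  | zero => exact ⟨0, zero_mem _, by simp⟩
  | add s t _ _ hs ht =>
    obtain ⟨q, hq, hs⟩ := hs
    obtain ⟨r, hr, ht⟩ := ht
    refine ⟨q + r, add_mem hq hr, ?_⟩
    rw [map_add, add_sub_add_comm]
    exact add_mem hs ht
  | smul r t _ ht =>
    obtain ⟨q, hq, ht⟩ := ht
    obtain ⟨p, hp⟩ := h.exists_aeval_sub_mem_pow N r
    refine ⟨p * q, Ideal.mul_mem_left _ _ hq, ?_⟩
    have : r • t - MvPolynomial.aeval z (p * q) = (r - MvPolynomial.aeval z p) * t +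
        MvPolynomial.aeval z p * (t - MvPolynomial.aeval z q) := by
      rw [smul_eq_mul, map_mul]; ring
    rw [this]
    exact add_mem (Ideal.mul_mem_right _ _ hp) (Ideal.mul_mem_left _ _ ht)

/-- There are no unexpected relations between the parameters: the associated graded ring is a
polynomial ring. The valuation sees each monomial of `q` separately, so a monomial of low degree
cannot be cancelled by something in a high power of the maximal ideal. -/
theorem aeval_mem_pow_iff (h : IsMonomialChart μ T z) {n : ℕ} {q : MvPolynomial (Fin 2) k} :
    MvPolynomial.aeval z q ∈ maximalIdeal T ^ n ↔ q ∈ MvPolynomial.idealOfVars (Fin 2) k ^ n := by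
  constructor
  · intro hq
    rw [MvPolynomial.mem_pow_idealOfVars_iff]
    intro l hl
    by_contra! hlt
    -- The precision `N` makes the error smaller than the offending monomial `l`, which survives in
    -- `q - p` and bounds its value from below.
    obtain ⟨N, hN⟩ := h.exists_forall_mem_pow_lt (a := (z 0 : F) ^ l 0 * (z 1 : F) ^ l 1)
      (by rw [← Valuation.ne_zero_iff μ]; simpa using h.monomial_ne_zero l)
    obtain ⟨p, hp, hpN⟩ := h.exists_aeval_sub_mem_pow_of_mem_pow N n hq
    have hlp : l ∉ p.support := fun hlp =>
      absurd ((MvPolynomial.mem_pow_idealOfVars_iff _ _).1 hp l hlp) (by omega)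
    have hl' : l ∈ (q - p).support := by
      rw [MvPolynomial.mem_support_iff, MvPolynomial.coeff_sub,
        MvPolynomial.notMem_support_iff.1 hlp, sub_zero]
      exact MvPolynomial.mem_support_iff.1 hl
    have h1 := h.le_map_aeval hl'
    rw [map_sub] at h1
    have h2 := hN _ hpN
    rw [map_mul, map_pow, map_pow] at h2
    exact absurd h1 (not_le.2 h2)
  · intro hq
    have hle : MvPolynomial.idealOfVars (Fin 2) k ≤
        (maximalIdeal T).comap (MvPolynomial.aeval z) := by
      rw [MvPolynomial.idealOfVars, Ideal.span_le]
      rintro _ ⟨i, rfl⟩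
      simpa using h.mem_maximalIdeal i
    exact Ideal.le_comap_pow _ n (Ideal.pow_right_mono hle n hq)

theorem pow_notMem_span (h : IsMonomialChart μ T z) (n : ℕ) : z 1 ^ n ∉ Ideal.span {z 0} := by
  classical
  intro hn
  obtain ⟨t, ht⟩ := Ideal.mem_span_singleton.1 hn
  -- Precision `n + 1` is enough: `X₁ ^ n - X₀ q` contains the monomial `X₁ ^ n`, of degree only
  -- `n`, whatever `q` is.
  obtain ⟨q, hq⟩ := h.exists_aeval_sub_mem_pow (n + 1) t
  have h1 : MvPolynomial.aeval z
      (MvPolynomial.X 1 ^ n - MvPolynomial.X 0 * q : MvPolynomial (Fin 2) k) ∈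
      maximalIdeal T ^ (n + 1) := by
    simp only [map_sub, map_pow, map_mul, MvPolynomial.aeval_X, ht]
    rw [← mul_sub]
    exact Ideal.mul_mem_left _ _ hq
  rw [h.aeval_mem_pow_iff, MvPolynomial.mem_pow_idealOfVars_iff] at h1
  have := h1 (Finsupp.single 1 n) (by
    rw [MvPolynomial.mem_support_iff, MvPolynomial.coeff_sub, MvPolynomial.coeff_X_pow,
      MvPolynomial.coeff_X_mul']
    simp)
  simp at this

theorem ringKrullDim_eq [IsNoetherianRing T] (h : IsMonomialChart μ T z) : ringKrullDim T = 2 := by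
  refine le_antisymm ((ringKrullDim_le_spanFinrank_maximalIdeal T).trans ?_) ?_
  · rw [h.span]
    have h1 := Submodule.spanFinrank_span_le_ncard_of_finite (R := T) (Set.finite_range z)
    have h2 : (Set.range z).ncard ≤ 2 := by
      rw [← Set.image_univ]
      refine (Set.ncard_image_le).trans ?_
      simp
    exact_mod_cast h1.trans h2
  -- Since no power of `z 1` is a multiple of `z 0`, some prime contains `z 0` but not `z 1`. It
  -- lies strictly between zero and the maximal ideal.
  · have hrad : z 1 ∉ (Ideal.span {z 0}).radical := fun ⟨n, hn⟩ => h.pow_notMem_span n hn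
    rw [Ideal.radical_eq_sInf, Submodule.mem_sInf] at hrad
    push Not at hrad
    obtain ⟨p, ⟨hp, hpp⟩, hzp⟩ := hrad
    let P : PrimeSpectrum T := ⟨p, hpp⟩
    let c : LTSeries (PrimeSpectrum T) :=
      { length := 2
        toFun := ![⊥, P, closedPoint T]
        step := by
          intro i
          fin_cases i
          · change (⊥ : PrimeSpectrum T) < P
            refine bot_lt_iff_ne_bot.2 fun e' => h.ind.1 ?_
            have h0 : z 0 ∈ P.asIdeal := hp (Ideal.subset_span rfl)
            rw [e', PrimeSpectrum.asIdeal_bot, Ideal.mem_bot] at h0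
            simp [h0]
          · change P < closedPoint T
            refine lt_of_le_of_ne (le_maximalIdeal hpp.ne_top) fun e' => hzp ?_
            have : z 1 ∈ P.asIdeal := by rw [e']; exact h.mem_maximalIdeal 1
            exact this }
    exact Order.LTSeries.length_le_krullDim c

theorem isRegularLocalRing [IsNoetherianRing T] (h : IsMonomialChart μ T z) :
    IsRegularLocalRing T := by
  refine IsRegularLocalRing.of_spanFinrank_maximalIdeal_le T ?_
  rw [h.ringKrullDim_eq, h.span]
  have h1 := Submodule.spanFinrank_span_le_ncard_of_finite (R := T) (Set.finite_range z)
  have h2 : (Set.range z).ncard ≤ 2 := by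
    rw [← Set.image_univ]
    refine (Set.ncard_image_le).trans ?_
    simp
  exact_mod_cast h1.trans h2

end IsMonomialChart

end Chart

/-! ### Finite length of quotients by powers of the maximal ideal -/

section FiniteQuotient

theorem IsLocalRing.finite_quotient_maximalIdeal_pow {k T : Type*} [Field k] [CommRing T]
    [IsLocalRing T] [Algebra k T] [IsNoetherianRing T]
    (hres : ∀ t : T, ∃ c : k, t - algebraMap k T c ∈ maximalIdeal T) (n : ℕ) :
    Module.Finite k (T ⧸ maximalIdeal T ^ n) := by
  suffices H : ∃ W : Submodule k T, W.FG ∧ ∀ t : T, ∃ w ∈ W, t - w ∈ maximalIdeal T ^ n by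
    obtain ⟨W, hW, H⟩ := H
    have : Module.Finite k W := Module.Finite.iff_fg.2 hW
    refine Module.Finite.of_surjective
      ((Ideal.Quotient.mkₐ k (maximalIdeal T ^ n)).toLinearMap ∘ₗ W.subtype) fun q => ?_
    obtain ⟨t, rfl⟩ := Ideal.Quotient.mk_surjective q
    obtain ⟨w, hw, h⟩ := H t
    exact ⟨⟨w, hw⟩, ((Ideal.Quotient.eq).2 h).symm⟩
  obtain ⟨r, g, hg⟩ := Submodule.fg_iff_exists_fin_generating_family.1
    ((isNoetherianRing_iff_ideal_fg T).1 inferInstance (maximalIdeal T))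
  induction n with
  | zero => exact ⟨⊥, Submodule.fg_bot, fun t => ⟨0, zero_mem _, by simp⟩⟩
  | succ n ih =>
    obtain ⟨W, hW, H⟩ := ih
    -- With `W` spanning modulo the `n`-th power, the space `k + ∑ gᵢ W` spans modulo the next one.
    refine ⟨Submodule.span k {1} ⊔ ⨆ i, W.map (LinearMap.mulLeft k (g i)),
      (Submodule.fg_span_singleton _).sup (Submodule.fg_iSup _ fun i => hW.map _), fun t => ?_⟩
    obtain ⟨c, hc⟩ := hres t
    rw [← hg, Submodule.mem_span_range_iff_exists_fun] at hc
    obtain ⟨s, hs⟩ := hc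
    choose w hw hsw using fun i => H (s i)
    refine ⟨c • 1 + ∑ i, g i * w i, add_mem
      (Submodule.mem_sup_left (Submodule.smul_mem _ _ (Submodule.subset_span rfl)))
      (Submodule.mem_sup_right (sum_mem fun i _ =>
        Submodule.mem_iSup_of_mem i ⟨w i, hw i, rfl⟩)), ?_⟩
    have : t - (c • 1 + ∑ i, g i * w i) = ∑ i, (s i - w i) * g i := by
      rw [sub_add_eq_sub_sub, ← Algebra.algebraMap_eq_smul_one, ← hs, ← Finset.sum_sub_distrib]
      exact Finset.sum_congr rfl fun i _ => by rw [smul_eq_mul]; ring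
    rw [this, pow_succ]
    refine sum_mem fun i _ => Ideal.mul_mem_mul (hsw i) ?_
    rw [← hg]
    exact Submodule.subset_span ⟨i, rfl⟩

end FiniteQuotient

/-! ### Uniqueness of completions inducing the same filtration -/

section FilteredCompletion

variable {k R Q Q' : Type*} [CommRing k] [CommRing R] [CommRing Q] [CommRing Q'] [Algebra k R]
  [Algebra k Q] [Algebra k Q']

/-- `Q` is complete and separated for the decreasing filtration `Φ`, and the image of `φ` is
dense. -/
structure IsFilteredCompletion (φ : R →ₐ[k] Q) (Φ : ℕ → Ideal Q) : Prop where
  anti : Antitone Φ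
  dense : ∀ q n, ∃ r, q - φ r ∈ Φ n
  sep : ∀ q, (∀ n, q ∈ Φ n) → q = 0
  complete : ∀ s : ℕ → R, (∀ n, φ (s (n + 1)) - φ (s n) ∈ Φ n) → ∃ q, ∀ n, q - φ (s n) ∈ Φ n

/-- A sequence in `R` converging to `q` is Cauchy for the common filtration on `R`, so it converges
in `Q'` too. The relation "approximated by the same elements of `R`" characterizes the limit, which
makes the comparison map a homomorphism without further choices. -/
theorem IsFilteredCompletion.exists_unique_limit {φ : R →ₐ[k] Q} {Φ : ℕ → Ideal Q}
    {φ' : R →ₐ[k] Q'} {Φ' : ℕ → Ideal Q'} (h : IsFilteredCompletion φ Φ)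
    (h' : IsFilteredCompletion φ' Φ') (hΦ : ∀ n r, φ r ∈ Φ n ↔ φ' r ∈ Φ' n) (q : Q) :
    ∃! q' : Q', ∀ n, ∃ r, q - φ r ∈ Φ n ∧ q' - φ' r ∈ Φ' n := by
  have huniq : ∀ q₁ q₂ : Q', (∀ n, ∃ r, q - φ r ∈ Φ n ∧ q₁ - φ' r ∈ Φ' n) →
      (∀ n, ∃ r, q - φ r ∈ Φ n ∧ q₂ - φ' r ∈ Φ' n) → q₁ = q₂ := by
    intro q₁ q₂ h₁ h₂
    rw [← sub_eq_zero]
    refine h'.sep _ fun n => ?_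
    obtain ⟨r₁, ha, hb⟩ := h₁ n
    obtain ⟨r₂, hc, hd⟩ := h₂ n
    have h3 : φ' r₁ - φ' r₂ ∈ Φ' n := by
      rw [← map_sub, ← hΦ, map_sub]
      have := sub_mem hc ha
      rwa [sub_sub_sub_cancel_left] at this
    have := add_mem (sub_mem hb hd) h3
    have e : q₁ - φ' r₁ - (q₂ - φ' r₂) + (φ' r₁ - φ' r₂) = q₁ - q₂ := by ring
    rwa [e] at this
  choose s hs using h.dense q
  obtain ⟨q', hq'⟩ := h'.complete s fun n => by
    rw [← map_sub, ← hΦ, map_sub]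
    have := sub_mem (hs n) (h.anti n.le_succ (hs (n + 1)))
    rwa [sub_sub_sub_cancel_left] at this
  exact ⟨q', fun n => ⟨s n, hs n, hq' n⟩, fun q₂ h₂ => huniq _ _ h₂ fun n => ⟨s n, hs n, hq' n⟩⟩

/-- Two completions of `R` that induce the same filtration on `R` are isomorphic. -/
theorem IsFilteredCompletion.exists_algEquiv {φ : R →ₐ[k] Q} {Φ : ℕ → Ideal Q}
    {φ' : R →ₐ[k] Q'} {Φ' : ℕ → Ideal Q'} (h : IsFilteredCompletion φ Φ)
    (h' : IsFilteredCompletion φ' Φ') (hΦ : ∀ n r, φ r ∈ Φ n ↔ φ' r ∈ Φ' n) :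
    ∃ e : Q ≃ₐ[k] Q', (∀ r, e (φ r) = φ' r) ∧ ∀ q n, e q ∈ Φ' n ↔ q ∈ Φ n := by
  choose f hf hf' using fun q => (h.exists_unique_limit h' hΦ q)
  choose g hg hg' using fun q => (h'.exists_unique_limit h (fun n r => (hΦ n r).symm) q)
  have hfg : ∀ q', f (g q') = q' := fun q' =>
    (hf' (g q') q' fun n => (hg q' n).imp fun r hr => hr.symm).symm
  have hgf : ∀ q, g (f q) = q := fun q =>
    (hg' (f q) q fun n => (hf q n).imp fun r hr => hr.symm).symm
  have hφ : ∀ r, f (φ r) = φ' r := fun r =>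
    (hf' (φ r) (φ' r) fun n => ⟨r, by simp, by simp⟩).symm
  refine ⟨AlgEquiv.ofAlgHom
    { toFun := f
      map_one' := by rw [← map_one φ, hφ, map_one]
      map_zero' := by rw [← map_zero φ, hφ, map_zero]
      map_mul' := fun a b => (hf' (a * b) (f a * f b) fun n => by
        obtain ⟨r, h1, h2⟩ := hf a n
        obtain ⟨s, h3, h4⟩ := hf b n
        refine ⟨r * s, ?_, ?_⟩
        · have e : a * b - φ (r * s) = a * (b - φ s) + (a - φ r) * φ s := by rw [map_mul]; ring
          rw [e]
          exact add_mem (Ideal.mul_mem_left _ _ h3) (Ideal.mul_mem_right _ _ h1)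
        · have e : f a * f b - φ' (r * s) = f a * (f b - φ' s) + (f a - φ' r) * φ' s := by
            rw [map_mul]; ring
          rw [e]
          exact add_mem (Ideal.mul_mem_left _ _ h4) (Ideal.mul_mem_right _ _ h2)).symm
      map_add' := fun a b => (hf' (a + b) (f a + f b) fun n => by
        obtain ⟨r, h1, h2⟩ := hf a n
        obtain ⟨s, h3, h4⟩ := hf b n
        refine ⟨r + s, ?_, ?_⟩
        · rw [map_add, add_sub_add_comm]
          exact add_mem h1 h3
        · rw [map_add, add_sub_add_comm]
          exact add_mem h2 h4).symm
      commutes' := fun c => by rw [← φ.commutes, hφ, φ'.commutes] }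
    { toFun := g
      map_one' := by rw [← map_one φ', ← hφ, hgf, map_one]
      map_zero' := by rw [← map_zero φ', ← hφ, hgf, map_zero]
      map_mul' := fun a b => (hg' (a * b) (g a * g b) fun n => by
        obtain ⟨r, h1, h2⟩ := hg a n
        obtain ⟨s, h3, h4⟩ := hg b n
        refine ⟨r * s, ?_, ?_⟩
        · have e : a * b - φ' (r * s) = a * (b - φ' s) + (a - φ' r) * φ' s := by
            rw [map_mul]; ring
          rw [e]
          exact add_mem (Ideal.mul_mem_left _ _ h3) (Ideal.mul_mem_right _ _ h1)
        · have e : g a * g b - φ (r * s) = g a * (g b - φ s) + (g a - φ r) * φ s := by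
            rw [map_mul]; ring
          rw [e]
          exact add_mem (Ideal.mul_mem_left _ _ h4) (Ideal.mul_mem_right _ _ h2)).symm
      map_add' := fun a b => (hg' (a + b) (g a + g b) fun n => by
        obtain ⟨r, h1, h2⟩ := hg a n
        obtain ⟨s, h3, h4⟩ := hg b n
        refine ⟨r + s, ?_, ?_⟩
        · rw [map_add, add_sub_add_comm]
          exact add_mem h1 h3
        · rw [map_add, add_sub_add_comm]
          exact add_mem h2 h4).symm
      commutes' := fun c => by rw [← φ'.commutes, ← hφ, hgf, φ.commutes] }
    (AlgHom.ext hfg) (AlgHom.ext hgf), hφ, fun q n => ?_⟩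
  change f q ∈ Φ' n ↔ q ∈ Φ n
  obtain ⟨r, h1, h2⟩ := hf q n
  rw [← Ideal.add_mem_iff_left _ (neg_mem h2), ← Ideal.add_mem_iff_left (Φ n) (neg_mem h1)]
  simp [hΦ]

end FilteredCompletion

/-! ### The adic completion as a filtered completion -/

section AdicCompletion

variable {k R : Type*} [CommRing k] [CommRing R] [Algebra k R] (I : Ideal R)

/-- The kernel of the projection of the completion to `R ⧸ I ^ n`. -/
def AdicCompletion.filtration (n : ℕ) : Ideal (AdicCompletion I R) :=
  RingHom.ker (AdicCompletion.evalₐ I n)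

theorem AdicCompletion.mem_filtration {n : ℕ} {q : AdicCompletion I R} :
    q ∈ filtration I n ↔ evalₐ I n q = 0 := Iff.rfl

theorem AdicCompletion.algebraMap_mem_filtration {n : ℕ} {r : R} :
    algebraMap R (AdicCompletion I R) r ∈ filtration I n ↔ r ∈ I ^ n := by
  rw [mem_filtration, AlgHom.commutes]
  exact Ideal.Quotient.eq_zero_iff_mem

theorem AdicCompletion.antitone_filtration : Antitone (filtration I) := by
  intro m n hmn q hq
  obtain ⟨s, rfl⟩ := AdicCompletion.mk_surjective I R q
  rw [mem_filtration, evalₐ_mk, Ideal.Quotient.eq_zero_iff_mem] at hq ⊢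
  have h := (AdicCompletion.Ideal.mk_eq_mk I hmn s)
  rw [Ideal.Quotient.eq] at h
  have := sub_mem (Ideal.pow_le_pow_right hmn hq) h
  simpa using this

theorem AdicCompletion.exists_sub_algebraMap_mem (q : AdicCompletion I R) (n : ℕ) :
    ∃ r, q - algebraMap R (AdicCompletion I R) r ∈ filtration I n := by
  obtain ⟨r, hr⟩ := Ideal.Quotient.mk_surjective (evalₐ I n q)
  refine ⟨r, ?_⟩
  rw [mem_filtration, map_sub, AlgHom.commutes, ← hr]
  exact sub_self _

/-- The adic completion is complete for any dense subalgebra. -/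
theorem AdicCompletion.isFilteredCompletion {A : Type*} [CommRing A] [Algebra k A]
    (φ : A →ₐ[k] AdicCompletion I R) (hφ : ∀ q n, ∃ a, q - φ a ∈ filtration I n) :
    IsFilteredCompletion φ (filtration I) where
  anti := antitone_filtration I
  dense := hφ
  sep q hq := ext_evalₐ fun n => by rw [_root_.map_zero]; exact hq n
  complete s hs := by
    -- The sequence comes from `A`, not from `R`; it is replaced by elements of `R` that agree with
    -- it to the same order, and these form an adic Cauchy sequence.
    choose r hr using fun n => exists_sub_algebraMap_mem I (φ (s n)) n
    refine ⟨AdicCompletion.mk I R (AdicCauchySequence.mk I R r fun n => ?_), fun n => ?_⟩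
    · rw [SModEq.sub_mem, smul_eq_mul, Ideal.mul_top, ← algebraMap_mem_filtration, map_sub]
      have := add_mem (sub_mem (antitone_filtration I n.le_succ (hr (n + 1))) (hr n))
        (neg_mem (hs n))
      have e : φ (s (n + 1)) - algebraMap R (AdicCompletion I R) (r (n + 1)) -
          (φ (s n) - algebraMap R (AdicCompletion I R) (r n)) + -(φ (s (n + 1)) - φ (s n)) =
          algebraMap R (AdicCompletion I R) (r n) -
            algebraMap R (AdicCompletion I R) (r (n + 1)) := by ring
      rwa [e] at this
    · have h1 := hr n
      rw [mem_filtration, map_sub, AlgHom.commutes, sub_eq_zero] at h1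
      rw [mem_filtration, map_sub, evalₐ_mk, h1]
      exact sub_self _

theorem AdicCompletion.isFilteredCompletion_algebraMap :
    IsFilteredCompletion (IsScalarTower.toAlgHom k R (AdicCompletion I R)) (filtration I) :=
  isFilteredCompletion I _ fun q n => exists_sub_algebraMap_mem I q n

end AdicCompletion

/-! ### Completeness of power series with restricted exponents -/

section PowerSeries

variable {k R Q : Type*} [Field k] [CommRing R] [CommRing Q] [Algebra k R] [Algebra k Q]
  {σ : Type*}

/-- Power series with exponents in a given set are complete for a filtration by supports. -/
theorem isFilteredCompletion_of_support (φ : R →ₐ[k] Q) (ι : Q →ₐ[k] MvPowerSeries σ k)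
    (hι : Function.Injective ι) (Λ : Set (σ →₀ ℕ))
    (hΛ : ∀ f, f ∈ ι.range ↔ ∀ l, MvPowerSeries.coeff l f ≠ 0 → l ∈ Λ)
    (J : ℕ → Set (σ →₀ ℕ)) (hJ : Antitone J) (hfin : ∀ n, (Λ \ J n).Finite)
    (hinf : ∀ l ∈ Λ, ∃ n, l ∉ J n) (Φ : ℕ → Ideal Q)
    (hΦ : ∀ n q, q ∈ Φ n ↔ ∀ l, MvPowerSeries.coeff l (ι q) ≠ 0 → l ∈ J n)
    (hmon : ∀ l ∈ Λ, ∃ r, ι (φ r) = MvPowerSeries.monomial l 1) :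
    IsFilteredCompletion φ Φ where
  anti m n hmn q hq := by
    rw [hΦ] at hq ⊢
    exact fun l hl => hJ hmn (hq l hl)
  dense q n := by
    classical
    choose! w hw using hmon
    refine ⟨∑ l ∈ (hfin n).toFinset, MvPowerSeries.coeff l (ι q) • w l, ?_⟩
    rw [hΦ]
    intro l hl
    by_contra hlJ
    refine hl ?_
    simp only [map_sub, map_sum, map_smul]
    by_cases hlΛ : l ∈ Λ
    · rw [Finset.sum_eq_single l]
      · rw [hw l hlΛ, MvPowerSeries.coeff_monomial_same, smul_eq_mul, mul_one, sub_self]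
      · intro l' hl' hne
        rw [hw l' ((hfin n).mem_toFinset.1 hl').1, MvPowerSeries.coeff_monomial_ne hne.symm,
          smul_zero]
      · intro h
        exact absurd ((hfin n).mem_toFinset.2 ⟨hlΛ, hlJ⟩) h
    · rw [Finset.sum_eq_zero, sub_zero]
      · by_contra h0
        exact hlΛ ((hΛ _).1 ⟨q, rfl⟩ l h0)
      · intro l' hl'
        have hl'' := ((hfin n).mem_toFinset.1 hl').1
        rw [hw l' hl'', MvPowerSeries.coeff_monomial_ne (by rintro rfl; exact hlΛ hl''),
          smul_zero]
  sep q hq := by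
    refine hι ?_
    rw [map_zero]
    ext l
    rw [map_zero]
    by_contra h0
    obtain ⟨n, hn⟩ := hinf l ((hΛ _).1 ⟨q, rfl⟩ l h0)
    exact hn ((hΦ n q).1 (hq n) l h0)
  complete s hs := by
    classical
    choose! N hN using hinf
    have hstep : ∀ m n, m ≤ n → φ (s n) - φ (s m) ∈ Φ m := by
      intro m n hmn
      induction n, hmn using Nat.le_induction with
      | base => simp
      | succ n hmn ih =>
        have h1 : φ (s (n + 1)) - φ (s n) ∈ Φ m := by
          rw [hΦ]
          exact fun l hl => hJ hmn ((hΦ n _).1 (hs n) l hl)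
        simpa using add_mem h1 ih
    have hcoeff : ∀ l m n, l ∉ J m → l ∉ J n →
        MvPowerSeries.coeff l (ι (φ (s m))) = MvPowerSeries.coeff l (ι (φ (s n))) := by
      intro l m n hm hn
      wlog hmn : m ≤ n generalizing m n
      · exact (this n m hn hm (le_of_not_ge hmn)).symm
      by_contra hne
      refine hm ((hΦ m _).1 (hstep m n hmn) l ?_)
      rw [map_sub, map_sub]
      exact sub_ne_zero.2 (Ne.symm hne)
    -- The limit is built coefficientwise: the coefficient at `l` is the same for all indices `n`
    -- with `l ∉ J n`, and `N l` is one such index.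
    let f : MvPowerSeries σ k := fun l =>
      if l ∈ Λ then MvPowerSeries.coeff l (ι (φ (s (N l)))) else 0
    have hf : ∀ l, MvPowerSeries.coeff l f =
      if l ∈ Λ then MvPowerSeries.coeff l (ι (φ (s (N l)))) else 0 := fun l => rfl
    obtain ⟨q, hq⟩ := (hΛ f).2 fun l hl => by
      by_contra hlΛ
      rw [hf, if_neg hlΛ] at hl
      exact hl rfl
    refine ⟨q, fun n => ?_⟩
    rw [hΦ]
    intro l hl
    by_contra hlJ
    refine hl ?_
    change ι q = f at hq
    rw [map_sub, map_sub, hq, hf, sub_eq_zero]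
    split_ifs with hlΛ
    · exact hcoeff _ _ _ (hN l hlΛ) hlJ
    · by_contra h0
      exact hlΛ ((hΛ _).1 ⟨φ (s n), rfl⟩ l (Ne.symm h0))

end PowerSeries

/-! ### Surjective endomorphisms of Noetherian rings -/

section Endomorphism

/-- The kernels of the iterates stabilize. An element of the kernel is `f ^ n y` for some `y`, and
`y` in the kernel of `f ^ (n + 1)` is already in the kernel of `f ^ n`. -/
theorem RingHom.injective_of_surjective_of_isNoetherianRing {R : Type*} [CommRing R]
    [IsNoetherianRing R] (f : R →+* R) (hf : Function.Surjective f) : Function.Injective f := by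
  obtain ⟨n, hn⟩ := monotone_stabilizes_iff_noetherian.2 (inferInstanceAs (IsNoetherian R R))
    ⟨fun n => RingHom.ker (f ^ n), monotone_nat_of_le_succ fun n x hx => by
      rw [RingHom.mem_ker] at hx ⊢
      rw [pow_succ', RingHom.mul_def, RingHom.comp_apply, hx, map_zero]⟩
  have hpow : Function.Surjective (f ^ n) := by
    rw [RingHom.coe_pow]; exact hf.iterate n
  rw [injective_iff_map_eq_zero]
  intro x hx
  obtain ⟨y, rfl⟩ := hpow x
  have h1 : y ∈ RingHom.ker (f ^ (n + 1)) := by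
    rw [RingHom.mem_ker, pow_succ', RingHom.mul_def, RingHom.comp_apply, hx]
  have h2 := hn (n + 1) (Nat.le_succ n)
  have h3 : y ∈ RingHom.ker (f ^ n) := by
    have : RingHom.ker (f ^ n) = RingHom.ker (f ^ (n + 1)) := h2
    rw [this]; exact h1
  exact h3

/-- The map `g` factors through `A ⧸ ker f ≃ B`, giving a surjective, hence injective, endomorphism
of a Noetherian ring. -/
theorem RingHom.ker_eq_of_le_of_surjective {A B : Type*} [CommRing A] [CommRing B]
    [IsNoetherianRing A] (f g : A →+* B) (hf : Function.Surjective f) (hg : Function.Surjective g)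
    (hle : RingHom.ker f ≤ RingHom.ker g) : RingHom.ker f = RingHom.ker g := by
  refine le_antisymm hle fun a ha => ?_
  let e := RingHom.quotientKerEquivOfSurjective hf
  let g' : A ⧸ RingHom.ker f →+* B := Ideal.Quotient.lift _ g fun a ha => hle ha
  have hg' : Function.Surjective g' := Ideal.Quotient.lift_surjective_of_surjective _ _ hg
  have hinj := RingHom.injective_of_surjective_of_isNoetherianRing
    (e.symm.toRingHom.comp g') (e.symm.surjective.comp hg')
  rw [← Ideal.Quotient.eq_zero_iff_mem]
  refine hinj ?_
  rw [map_zero, RingHom.comp_apply]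
  have : g' (Ideal.Quotient.mk _ a) = 0 := ha
  rw [this, map_zero]

end Endomorphism

/-! ### Power series as the completion of polynomials -/

section PolynomialToPowerSeries

variable {k : Type*} [Field k]

/-- Power series of order at least `n`. -/
def MvPowerSeries.orderFiltration (σ k : Type*) [Field k] (n : ℕ) : Ideal (MvPowerSeries σ k) where
  carrier := {f | ∀ l, MvPowerSeries.coeff l f ≠ 0 → n ≤ Finsupp.degree l}
  zero_mem' l hl := by simp at hl
  add_mem' {f g} hf hg l hl := by
    by_contra hlt
    have h1 : MvPowerSeries.coeff l f = 0 := by by_contra h; exact hlt (hf l h)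
    have h2 : MvPowerSeries.coeff l g = 0 := by by_contra h; exact hlt (hg l h)
    rw [map_add, h1, h2, add_zero] at hl
    exact hl rfl
  smul_mem' f g hg l hl := by
    classical
    rw [smul_eq_mul, MvPowerSeries.coeff_mul] at hl
    obtain ⟨⟨i, j⟩, hij, hne⟩ := Finset.exists_ne_zero_of_sum_ne_zero hl
    rw [Finset.HasAntidiagonal.mem_antidiagonal] at hij
    have := hg j (right_ne_zero_of_mul hne)
    rw [← hij, map_add]
    exact this.trans (Nat.le_add_left _ _)

theorem MvPowerSeries.mem_orderFiltration {σ : Type*} {n : ℕ} {f : MvPowerSeries σ k} :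
    f ∈ orderFiltration σ k n ↔ ∀ l, coeff l f ≠ 0 → n ≤ Finsupp.degree l := Iff.rfl

theorem MvPolynomial.isFilteredCompletion_powerSeries (σ : Type*) [Finite σ] :
    IsFilteredCompletion (k := k)
      (MvPolynomial.coeToMvPowerSeries.algHom k : MvPolynomial σ k →ₐ[k] MvPowerSeries σ k)
      (MvPowerSeries.orderFiltration σ k) := by
  refine isFilteredCompletion_of_support _ (AlgHom.id k _) Function.injective_id Set.univ
    (fun f => ⟨fun _ _ _ => trivial, fun _ => ⟨f, rfl⟩⟩) (fun n => {l | n ≤ Finsupp.degree l})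
    (fun m n hmn l hl => hmn.trans hl) (fun n => ?_) (fun l _ => ⟨Finsupp.degree l + 1, by simp⟩) _
    (fun n q => Iff.rfl) fun l _ => ⟨MvPolynomial.monomial l 1, by simp⟩
  refine (Finsupp.finite_of_degree_lt n).subset fun l hl => ?_
  simpa using hl

end PolynomialToPowerSeries

/-! ### The completion of a monomial chart is a power series ring -/

section Chart

variable {k F Γ₀ : Type*} [Field k] [Field F] [Algebra k F] [LinearOrderedCommGroupWithZero Γ₀]

namespace IsMonomialChart

variable {μ : Valuation F Γ₀} {T : Subalgebra k F} [IsLocalRing T] {z : Fin 2 → T}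

theorem maximalIdeal_completion_pow_le [IsNoetherianRing T] (n : ℕ) :
    maximalIdeal (Completion T) ^ n ≤ AdicCompletion.filtration (maximalIdeal T) n := by
  rw [AdicCompletion.maximalIdeal_eq_map, ← Ideal.map_pow, Ideal.map_le_iff_le_comap]
  intro t ht
  exact (AdicCompletion.algebraMap_mem_filtration _).2 ht

theorem maximalIdeal_completion [IsNoetherianRing T] (h : IsMonomialChart μ T z)
    {z' : Fin 2 → Completion T}
    (hz' : ∀ i, Associated (z' i) (algebraMap T (Completion T) (z i))) :
    maximalIdeal (Completion T) = Ideal.span (Set.range z') := by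
  rw [AdicCompletion.maximalIdeal_eq_map,
    congrArg (Ideal.map (algebraMap T (Completion T))) h.span, Ideal.map_span, ← Set.range_comp]
  refine le_antisymm (Ideal.span_le.2 ?_) (Ideal.span_le.2 ?_)
  · rintro _ ⟨i, rfl⟩
    exact Ideal.mem_of_dvd _ (hz' i).dvd (Ideal.subset_span ⟨i, rfl⟩)
  · rintro _ ⟨i, rfl⟩
    exact Ideal.mem_of_dvd _ (hz' i).symm.dvd (Ideal.subset_span ⟨i, rfl⟩)

theorem exists_sub_algebraMap_mem_completion [IsNoetherianRing T] (h : IsMonomialChart μ T z)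
    (f : Completion T) :
    ∃ c : k, f - algebraMap k (Completion T) c ∈ maximalIdeal (Completion T) := by
  obtain ⟨t, ht⟩ := AdicCompletion.exists_sub_algebraMap_mem (maximalIdeal T) f 1
  obtain ⟨c, hc⟩ := h.res t
  refine ⟨c, ?_⟩
  have h1 : ∀ g : Completion T, g ∈ AdicCompletion.filtration (maximalIdeal T) 1 →
      g ∈ maximalIdeal (Completion T) := by
    intro g hg
    rw [IsLocalRing.mem_maximalIdeal, mem_nonunits_iff]
    intro hu
    have h2 := hu.map (AdicCompletion.evalₐ (maximalIdeal T) 1)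
    rw [AdicCompletion.mem_filtration] at hg
    rw [hg, isUnit_zero_iff, Ideal.Quotient.zero_eq_one_iff, pow_one] at h2
    exact (maximalIdeal.isMaximal T).ne_top h2
  have h3 : algebraMap T (Completion T) (t - algebraMap k T c) ∈ maximalIdeal (Completion T) := by
    rw [AdicCompletion.maximalIdeal_eq_map]
    exact Ideal.mem_map_of_mem _ hc
  have := add_mem (h1 _ ht) h3
  rw [map_sub, ← IsScalarTower.algebraMap_apply, sub_add_sub_cancel] at this
  exact this

theorem exists_sub_aeval_mem_filtration [IsNoetherianRing T] (h : IsMonomialChart μ T z)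
    {z' : Fin 2 → Completion T}
    (hz' : ∀ i, Associated (z' i) (algebraMap T (Completion T) (z i)))
    (f : Completion T) (n : ℕ) :
    ∃ q : MvPolynomial (Fin 2) k,
      f - MvPolynomial.aeval z' q ∈ AdicCompletion.filtration (maximalIdeal T) n := by
  obtain ⟨w, hw, hn⟩ := IsLocalRing.exists_mem_adjoin_sub_mem_pow (h.maximalIdeal_completion hz')
    h.exists_sub_algebraMap_mem_completion n f
  rw [Algebra.adjoin_range_eq_range_aeval] at hw
  obtain ⟨q, rfl⟩ := hw
  exact ⟨q, maximalIdeal_completion_pow_le n hn⟩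

/-- For the original parameters this is the description of the graded ring. For unit multiples `z'`
in the completion, both evaluations map the polynomial ring onto the same `T ⧸ m ^ n`; one kernel is
visibly contained in the other, and then the two agree. No valuation on the completion is needed. -/
theorem aeval_mem_filtration_iff [IsNoetherianRing T] (h : IsMonomialChart μ T z)
    {z' : Fin 2 → Completion T}
    (hz' : ∀ i, Associated (z' i) (algebraMap T (Completion T) (z i))) {n : ℕ}
    {q : MvPolynomial (Fin 2) k} :
    MvPolynomial.aeval z' q ∈ AdicCompletion.filtration (maximalIdeal T) n ↔
      q ∈ MvPolynomial.idealOfVars (Fin 2) k ^ n := by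
  let w : Fin 2 → Completion T := fun i => algebraMap T (Completion T) (z i)
  let ev (z' : Fin 2 → Completion T) : MvPolynomial (Fin 2) k →+* T ⧸ maximalIdeal T ^ n :=
    (AdicCompletion.evalₐ (maximalIdeal T) n).toRingHom.comp (MvPolynomial.aeval z').toRingHom
  have hsurj : ∀ z' : Fin 2 → Completion T,
      (∀ i, Associated (z' i) (algebraMap T (Completion T) (z i))) →
      Function.Surjective (ev z') := by
    intro z' hz' a
    obtain ⟨f, rfl⟩ := AdicCompletion.surjective_evalₐ _ _ a
    obtain ⟨q, hq⟩ := h.exists_sub_aeval_mem_filtration hz' f n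
    rw [AdicCompletion.mem_filtration, map_sub, sub_eq_zero] at hq
    exact ⟨q, hq.symm⟩
  have hker : ∀ q, q ∈ RingHom.ker (ev w) ↔ q ∈ MvPolynomial.idealOfVars (Fin 2) k ^ n := by
    intro q
    rw [← h.aeval_mem_pow_iff, ← AdicCompletion.algebraMap_mem_filtration,
      ← MvPolynomial.aeval_algebraMap_apply]
    rfl
  have hle : RingHom.ker (ev w) ≤ RingHom.ker (ev z') := by
    intro q hq
    rw [hker] at hq
    have hle : MvPolynomial.idealOfVars (Fin 2) k ≤
        (maximalIdeal (Completion T)).comap (MvPolynomial.aeval z') := by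
      rw [MvPolynomial.idealOfVars, Ideal.span_le]
      rintro _ ⟨i, rfl⟩
      rw [SetLike.mem_coe, Ideal.mem_comap, MvPolynomial.aeval_X, h.maximalIdeal_completion hz']
      exact Ideal.subset_span ⟨i, rfl⟩
    exact maximalIdeal_completion_pow_le n
      (Ideal.le_comap_pow _ n (Ideal.pow_right_mono hle n hq))
  rw [← hker, RingHom.ker_eq_of_le_of_surjective _ _ (hsurj w fun i => Associated.refl _)
    (hsurj z' hz') hle]
  rfl

/-- The completion is a power series ring in any unit multiples of the parameters. -/
theorem exists_powerSeries_equiv [IsNoetherianRing T] (h : IsMonomialChart μ T z)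
    {z' : Fin 2 → Completion T}
    (hz' : ∀ i, Associated (z' i) (algebraMap T (Completion T) (z i))) :
    ∃ e : MvPowerSeries (Fin 2) k ≃ₐ[k] Completion T,
      (∀ i, e (MvPowerSeries.X i) = z' i) ∧
      ∀ f n, e f ∈ AdicCompletion.filtration (maximalIdeal T) n ↔
        f ∈ MvPowerSeries.orderFiltration (Fin 2) k n := by
  obtain ⟨e, h1, h2⟩ := (MvPolynomial.isFilteredCompletion_powerSeries (k := k)
    (Fin 2)).exists_algEquiv (AdicCompletion.isFilteredCompletion (maximalIdeal T)
      (MvPolynomial.aeval z') (h.exists_sub_aeval_mem_filtration hz')) fun n q => by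
        rw [h.aeval_mem_filtration_iff hz', MvPolynomial.mem_pow_idealOfVars_iff,
          MvPowerSeries.mem_orderFiltration]
        simp [MvPolynomial.mem_support_iff]
  refine ⟨e, fun i => ?_, h2⟩
  have := h1 (MvPolynomial.X i)
  simpa using this

end IsMonomialChart

end Chart

/-! ### Roots of units in the completion, and absorbing units into the parameters -/

section Roots

variable {k F Γ₀ : Type*} [Field k] [Field F] [Algebra k F] [LinearOrderedCommGroupWithZero Γ₀]

/-- In a complete local ring with algebraically closed residue field `k`, units have roots of all
degrees prime to the characteristic. -/
theorem IsAdicComplete.exists_pow_eq {k C : Type*} [Field k] [IsAlgClosed k] [CommRing C]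
    [IsLocalRing C] [Algebra k C] [IsAdicComplete (maximalIdeal C) C]
    (hres : ∀ f : C, ∃ c : k, f - algebraMap k C c ∈ maximalIdeal C) {n : ℕ} (hn : (n : k) ≠ 0)
    {f : C} (hf : IsUnit f) : ∃ g, g ^ n = f := by
  have hn0 : n ≠ 0 := by rintro rfl; simp at hn
  obtain ⟨c, hc⟩ := hres f
  have hc0 : c ≠ 0 := by
    rintro rfl
    rw [map_zero, sub_zero] at hc
    exact (IsLocalRing.mem_maximalIdeal f).1 hc hf
  obtain ⟨r, hr⟩ := IsAlgClosed.exists_pow_nat_eq c (Nat.pos_of_ne_zero hn0)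
  have hr0 : r ≠ 0 := by rintro rfl; rw [zero_pow hn0] at hr; exact hc0 hr.symm
  -- Hensel's lemma lifts a root `r` of the residue `c` of `f`; the derivative `n r ^ (n - 1)` is a
  -- unit because `n` is nonzero in `k`.
  obtain ⟨g, hg, -⟩ := HenselianRing.is_henselian (I := maximalIdeal C)
    (Polynomial.X ^ n - Polynomial.C f) (Polynomial.monic_X_pow_sub_C f hn0)
    (algebraMap k C r) (by
      rw [Polynomial.eval_sub, Polynomial.eval_pow, Polynomial.eval_X, Polynomial.eval_C,
        ← map_pow, hr]
      have := neg_mem hc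
      rwa [neg_sub] at this) (by
      have h1 : Polynomial.eval (algebraMap k C r)
          (Polynomial.derivative (Polynomial.X ^ n - Polynomial.C f)) =
          algebraMap k C (n * r ^ (n - 1)) := by simp [Polynomial.derivative_X_pow]
      rw [h1]
      exact ((IsUnit.mk0 _ (mul_ne_zero hn (pow_ne_zero _ hr0))).map _).map _)
  refine ⟨g, ?_⟩
  rw [Polynomial.IsRoot, Polynomial.eval_sub, Polynomial.eval_pow, Polynomial.eval_X,
    Polynomial.eval_C, sub_eq_zero] at hg
  exact hg

theorem exists_units_zpow_eq {k C : Type*} [Field k] [IsAlgClosed k] [CommRing C]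
    [IsLocalRing C] [Algebra k C] [IsAdicComplete (maximalIdeal C) C]
    (hres : ∀ f : C, ∃ c : k, f - algebraMap k C c ∈ maximalIdeal C) {n : ℤ} (hn : (n : k) ≠ 0)
    (f : Cˣ) : ∃ g : Cˣ, g ^ n = f := by
  have hn' : (n.natAbs : k) ≠ 0 := by
    rcases Int.natAbs_eq n with h | h <;> rw [h] at hn <;> simpa using hn
  obtain ⟨g, hg⟩ := IsAdicComplete.exists_pow_eq hres hn' f.isUnit
  have hgu : IsUnit g := isUnit_of_mul_isUnit_left (y := g ^ (n.natAbs - 1)) (by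
    rw [← pow_succ', Nat.sub_add_cancel, hg]
    · exact f.isUnit
    · exact Nat.one_le_iff_ne_zero.2 fun h => hn' (by rw [h, Nat.cast_zero]))
  obtain ⟨g, rfl⟩ := hgu
  have hg' : g ^ n.natAbs = f := Units.ext (by simpa using hg)
  rcases Int.natAbs_eq n with h | h
  · exact ⟨g, by rw [h, zpow_natCast, hg']⟩
  · exact ⟨g⁻¹, by rw [h, zpow_neg, inv_zpow, inv_inv, zpow_natCast, hg']⟩

/-- The units in a pair of equations `u = x ^ a * y ^ b * δ₁`, `v = x ^ c * y ^ d * δ₂` can be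
absorbed into `x` and `y` when the determinant of the exponents is invertible. -/
theorem exists_units_pow_mul_pow_eq {G : Type*} [CommGroup G] {a b c d : ℕ} {δ₁ δ₂ : G}
    (hroot : ∀ f : G, ∃ g : G, g ^ (a * d - b * c : ℤ) = f) :
    ∃ ε₁ ε₂ : G, ε₁ ^ a * ε₂ ^ b = δ₁ ∧ ε₁ ^ c * ε₂ ^ d = δ₂ := by
  obtain ⟨η₁, h₁⟩ := hroot δ₁
  obtain ⟨η₂, h₂⟩ := hroot δ₂
  -- Cramer's rule, written multiplicatively: the adjugate of the exponent matrix applied to roots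
  -- of degree equal to the determinant.
  refine ⟨η₁ ^ (d : ℤ) * η₂ ^ (-b : ℤ), η₁ ^ (-c : ℤ) * η₂ ^ (a : ℤ), ?_, ?_⟩
  · rw [← h₁, ← zpow_natCast, ← zpow_natCast, mul_zpow, mul_zpow]
    simp only [← zpow_mul]
    rw [mul_mul_mul_comm, ← zpow_add, ← zpow_add,
      show (-b : ℤ) * a + a * b = 0 by ring, zpow_zero, mul_one]
    congr 1
    ring
  · rw [← h₂, ← zpow_natCast, ← zpow_natCast, mul_zpow, mul_zpow]
    simp only [← zpow_mul]
    rw [mul_mul_mul_comm, ← zpow_add, ← zpow_add,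
      show (d : ℤ) * c + -c * d = 0 by ring, zpow_zero, one_mul]
    congr 1
    ring

theorem IsMonomialChart.exists_completion_parameters [IsAlgClosed k] {μ : Valuation F Γ₀}
    {T : Subalgebra k F} [IsLocalRing T] [IsNoetherianRing T] {z : Fin 2 → T}
    (h : IsMonomialChart μ T z) {a b c d : ℕ} (hD : ((a * d - b * c : ℤ) : k) ≠ 0) (δ₁ δ₂ : Tˣ) :
    ∃ z' : Fin 2 → Completion T,
      (∀ i, Associated (z' i) (algebraMap T (Completion T) (z i))) ∧
      algebraMap T (Completion T) (z 0 ^ a * z 1 ^ b * δ₁) = z' 0 ^ a * z' 1 ^ b ∧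
      algebraMap T (Completion T) (z 0 ^ c * z 1 ^ d * δ₂) = z' 0 ^ c * z' 1 ^ d := by
  obtain ⟨ε₁, ε₂, h₁, h₂⟩ := exists_units_pow_mul_pow_eq (a := a) (b := b) (c := c) (d := d)
    (δ₁ := Units.map (algebraMap T (Completion T)).toMonoidHom δ₁)
    (δ₂ := Units.map (algebraMap T (Completion T)).toMonoidHom δ₂)
    (exists_units_zpow_eq h.exists_sub_algebraMap_mem_completion hD)
  have h₁' := congrArg Units.val h₁
  have h₂' := congrArg Units.val h₂
  simp only [Units.val_mul, Units.val_pow_eq_pow_val, Units.coe_map] at h₁' h₂'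
  refine ⟨![algebraMap T (Completion T) (z 0) * ε₁, algebraMap T (Completion T) (z 1) * ε₂],
    fun i => ?_, ?_, ?_⟩
  · fin_cases i
    · exact (associated_mul_unit_left _ _ ε₁.isUnit)
    · exact (associated_mul_unit_left _ _ ε₂.isUnit)
  · simp only [map_mul, map_pow, Matrix.cons_val_zero, Matrix.cons_val_one]
    rw [mul_pow, mul_pow, mul_mul_mul_comm, h₁']
    rfl
  · simp only [map_mul, map_pow, Matrix.cons_val_zero, Matrix.cons_val_one]
    rw [mul_pow, mul_pow, mul_mul_mul_comm, h₂']
    rfl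

end Roots

/-! ### Zariski's main theorem in local form -/

section ZariskiMain

/-- Zariski's main theorem for a local ring essentially of finite type, with residue field `k`,
that is finite modulo the ideal generated by the elements below. -/
theorem IsLocalRing.exists_isIntegral_mul_eq {k A T : Type*} [Field k] [CommRing A] [CommRing T]
    [Algebra k A] [Algebra k T] [Algebra A T] [IsScalarTower k A T] [IsLocalRing T]
    [Algebra.EssFiniteType k T]
    (hres : ∀ t : T, ∃ c : k, t - algebraMap k T c ∈ maximalIdeal T) (N : ℕ)
    (hN : maximalIdeal T ^ N ≤
      ((maximalIdeal T).comap (algebraMap A T)).map (algebraMap A T)) (t : T) :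
    ∃ b c : T, IsIntegral A b ∧ IsIntegral A c ∧ c ∉ maximalIdeal T ∧ c * t = b := by
  have : Algebra.EssFiniteType A T := Algebra.EssFiniteType.of_comp k A T
  have : IsNoetherianRing T := Algebra.EssFiniteType.isNoetherianRing k T
  let C := Algebra.EssFiniteType.subalgebra A T
  let q : Ideal C := (maximalIdeal T).comap (algebraMap C T)
  have hq : q.IsPrime := Ideal.IsPrime.comap _
  have hM : q.primeCompl = Algebra.EssFiniteType.submonoid A T := by
    ext c
    change algebraMap C T c ∉ maximalIdeal T ↔ _
    rw [IsLocalRing.mem_maximalIdeal, mem_nonunits_iff, not_not]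
    rfl
  have hloc : IsLocalization.AtPrime T q := by
    rw [IsLocalization.AtPrime, hM]
    infer_instance
  let e : T ≃ₐ[C] Localization.AtPrime q := IsLocalization.algEquiv q.primeCompl T _
  have hfin : Module.Finite k (T ⧸ maximalIdeal T ^ N) := finite_quotient_maximalIdeal_pow hres N
  have hfinA : Module.Finite A (T ⧸ maximalIdeal T ^ N) := Module.Finite.of_restrictScalars_finite k _ _
  -- The fibre of `T` over the contraction of its maximal ideal is a quotient of `T ⧸ m ^ N`, which
  -- is finite over `k` and hence over `A`.
  have hwq : Algebra.WeaklyQuasiFiniteAt A q := by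
    rw [Algebra.weaklyQuasiFiniteAt_iff]
    let J := (q.under A).map (algebraMap A (Localization.AtPrime q))
    let g : T →ₐ[A] Localization.AtPrime q ⧸ J :=
      (Ideal.Quotient.mkₐ A J).comp (e.toAlgHom.restrictScalars A)
    have hg : Function.Surjective g := Ideal.Quotient.mk_surjective.comp e.surjective
    have hker : ∀ t ∈ maximalIdeal T ^ N, g t = 0 := by
      intro t ht
      have h1 := hN ht
      have h2 : ((maximalIdeal T).comap (algebraMap A T)).map (algebraMap A T) ≤
          RingHom.ker g.toRingHom := by
        rw [Ideal.map_le_iff_le_comap]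
        intro a ha
        rw [Ideal.mem_comap, RingHom.mem_ker]
        have h3 : g (algebraMap A T a) = algebraMap A _ a := g.commutes a
        refine h3.trans ?_
        rw [IsScalarTower.algebraMap_apply A (Localization.AtPrime q)]
        refine Ideal.Quotient.eq_zero_iff_mem.2 (Ideal.mem_map_of_mem _ ?_)
        exact ha
      exact h2 h1
    exact Algebra.QuasiFinite.of_surjective_algHom (Ideal.Quotient.liftₐ _ g hker)
      (Ideal.Quotient.lift_surjective_of_surjective _ hker hg)
  have hz := Algebra.ZariskisMainProperty.of_finiteType_of_weaklyQuasiFiniteAt (R := A) q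
  rw [Algebra.zariskisMainProperty_iff] at hz
  obtain ⟨r, hrq, hr, hint⟩ := hz
  obtain ⟨⟨x, s⟩, hxs⟩ := IsLocalization.surj q.primeCompl t
  obtain ⟨m₁, h₁⟩ := hint x
  obtain ⟨m₂, h₂⟩ := hint s
  have hmap : ∀ y : C, IsIntegral A y → IsIntegral A (algebraMap C T y) := fun y hy =>
    hy.map (IsScalarTower.toAlgHom A C T)
  -- Multiplying numerator and denominator by `r ^ (m₁ + m₂)` makes both integral, and keeps the
  -- denominator a unit of `T` since `r ∉ q`.
  refine ⟨algebraMap C T (r ^ m₂ * (r ^ m₁ * x)), algebraMap C T (r ^ m₁ * (r ^ m₂ * s)),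
    hmap _ ((hr.pow _).mul h₁), hmap _ ((hr.pow _).mul h₂), ?_, ?_⟩
  · change r ^ m₁ * (r ^ m₂ * s) ∉ q
    exact hq.mul_notMem (fun h => hrq (hq.mem_of_pow_mem _ h))
      (hq.mul_notMem (fun h => hrq (hq.mem_of_pow_mem _ h)) s.2)
  · simp only [map_mul]
    rw [← hxs]
    ring

end ZariskiMain

/-! ### Localization at the center of a valuation -/

section CenterLocalization

variable {k F Γ₀ : Type*} [Field k] [Field F] [Algebra k F] [LinearOrderedCommGroupWithZero Γ₀]

/-- The localization of `A` at the center of `μ`. -/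
def centerLocalization (μ : Valuation F Γ₀) (A : Subalgebra k F) : Subalgebra k F where
  carrier := {t | ∃ a ∈ A, ∃ b ∈ A, μ b = 1 ∧ t = a / b}
  mul_mem' := by
    rintro _ _ ⟨a, ha, b, hb, hμ, rfl⟩ ⟨a', ha', b', hb', hμ', rfl⟩
    exact ⟨a * a', mul_mem ha ha', b * b', mul_mem hb hb', by rw [map_mul, hμ, hμ', one_mul],
      by rw [div_mul_div_comm]⟩
  add_mem' := by
    rintro _ _ ⟨a, ha, b, hb, hμ, rfl⟩ ⟨a', ha', b', hb', hμ', rfl⟩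
    have h : b ≠ 0 := by rintro rfl; simp at hμ
    have h' : b' ≠ 0 := by rintro rfl; simp at hμ'
    exact ⟨a * b' + b * a', add_mem (mul_mem ha hb') (mul_mem hb ha'), b * b', mul_mem hb hb',
      by rw [map_mul, hμ, hμ', one_mul], by rw [div_add_div _ _ h h']⟩
  algebraMap_mem' c := ⟨algebraMap k F c, A.algebraMap_mem c, 1, one_mem A, by simp, by simp⟩

variable {μ : Valuation F Γ₀} {A B : Subalgebra k F}

theorem mem_centerLocalization {t : F} :
    t ∈ centerLocalization μ A ↔ ∃ a ∈ A, ∃ b ∈ A, μ b = 1 ∧ t = a / b := Iff.rfl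

theorem le_centerLocalization : A ≤ centerLocalization μ A :=
  fun a ha => ⟨a, ha, 1, one_mem A, by simp, by simp⟩

theorem div_mem_centerLocalization {a b : F} (ha : a ∈ centerLocalization μ A)
    (hb : b ∈ centerLocalization μ A) (hμ : μ b = 1) : a / b ∈ centerLocalization μ A := by
  obtain ⟨a, ha, c, hc, hμc, rfl⟩ := ha
  obtain ⟨b, hb, d, hd, hμd, rfl⟩ := hb
  rw [map_div₀, hμd, div_one] at hμ
  exact ⟨a * d, mul_mem ha hd, c * b, mul_mem hc hb, by rw [map_mul, hμc, hμ, one_mul],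
    div_div_div_eq ..⟩

theorem centerLocalization_le (h : A ≤ centerLocalization μ B) :
    centerLocalization μ A ≤ centerLocalization μ B := by
  rintro _ ⟨a, ha, b, hb, hμ, rfl⟩
  exact div_mem_centerLocalization (h ha) (h hb) hμ

theorem map_le_one_of_mem_centerLocalization (hA : ∀ a ∈ A, μ a ≤ 1) {t : F}
    (ht : t ∈ centerLocalization μ A) : μ t ≤ 1 := by
  obtain ⟨a, ha, b, hb, hμ, rfl⟩ := ht
  rw [map_div₀, hμ, div_one]
  exact hA a ha

theorem map_le_one_of_mem_adjoin {G : Set F} (hk : ∀ c : k, μ (algebraMap k F c) ≤ 1)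
    (hG : ∀ g ∈ G, μ g ≤ 1) {a : F} (ha : a ∈ Algebra.adjoin k G) : μ a ≤ 1 := by
  induction ha using Algebra.adjoin_induction with
  | mem x hx => exact hG x hx
  | algebraMap c => exact hk c
  | add x y _ _ hx hy => exact (Valuation.map_add _ _ _).trans (max_le hx hy)
  | mul x y _ _ hx hy => rw [map_mul]; exact mul_le_one' hx hy

theorem isUnit_iff_of_mem_centerLocalization (hA : ∀ a ∈ A, μ a ≤ 1)
    (t : centerLocalization μ A) : IsUnit t ↔ μ (t : F) = 1 := by
  constructor
  · intro h
    obtain ⟨s, hs⟩ := h.exists_right_inv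
    have hs' : (t : F) * s = 1 := by exact_mod_cast congrArg Subtype.val hs
    have h1 := congrArg μ hs'
    rw [map_mul, map_one] at h1
    refine le_antisymm (map_le_one_of_mem_centerLocalization hA t.2) ?_
    rw [← h1]
    exact mul_le_of_le_one_right' (map_le_one_of_mem_centerLocalization hA s.2)
  · intro h
    have ht : (t : F) ≠ 0 := by intro h0; rw [h0, map_zero] at h; exact zero_ne_one h
    refine IsUnit.of_mul_eq_one ⟨1 / (t : F), div_mem_centerLocalization (one_mem _) t.2 h⟩ ?_
    exact Subtype.ext (by simpa using mul_inv_cancel₀ ht)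

theorem isLocalRing_centerLocalization (hA : ∀ a ∈ A, μ a ≤ 1) :
    IsLocalRing (centerLocalization μ A) := by
  refine IsLocalRing.of_nonunits_add fun a b ha hb => ?_
  have h : ∀ t : centerLocalization μ A, t ∈ nonunits (centerLocalization μ A) ↔
      μ (t : F) < 1 := by
    intro t
    rw [mem_nonunits_iff, isUnit_iff_of_mem_centerLocalization hA]
    exact ⟨fun h => lt_of_le_of_ne (map_le_one_of_mem_centerLocalization hA t.2) h,
      fun h => h.ne⟩
  rw [h] at ha hb ⊢
  exact (Valuation.map_add _ _ _).trans_lt (max_lt ha hb)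

theorem valDominates_centerLocalization (hA : ∀ a ∈ A, μ a ≤ 1) :
    ValDominates μ (centerLocalization μ A) := by
  intro t
  have h1 := map_le_one_of_mem_centerLocalization hA t.2
  refine ⟨h1, ?_⟩
  rw [mem_nonunits_iff, isUnit_iff_of_mem_centerLocalization hA]
  exact ⟨fun h => h.ne, fun h => lt_of_le_of_ne h1 h⟩

/-- A local ring that is the localization of `A` at some prime and is dominated by `μ` is the
localization of `A` at the center of `μ`. -/
theorem IsLocalizedAt.eq_centerLocalization {P : Ideal A} {T : Subalgebra k F}
    (hT : IsLocalizedAt P T) (hP : P.IsPrime) (hdom : ValDominates μ T) :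
    T = centerLocalization μ A := by
  have hAT : ∀ a ∈ A, a ∈ T := fun a ha => (hT a).2 ⟨⟨a, ha⟩, 1, hP.one_notMem, by simp⟩
  -- Domination determines `P`: being outside `P` means being a unit of `T`, which means having
  -- value one.
  have hunit : ∀ b : A, b ∉ P ↔ μ (b : F) = 1 := by
    intro b
    have h1 := hdom ⟨b, hAT b b.2⟩
    have h2 : μ (b : F) = 1 ↔ IsUnit (⟨b, hAT b b.2⟩ : T) := by
      rw [← not_iff_not, ← mem_nonunits_iff, ← h1.2, ← ne_eq]
      exact ⟨fun h => lt_of_le_of_ne h1.1 h, fun h => h.ne⟩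
    rw [h2]
    constructor
    · intro hb
      have hb0 : (b : F) ≠ 0 := fun h0 => hb (by
        have : b = 0 := Subtype.ext h0
        rw [this]; exact P.zero_mem)
      refine IsUnit.of_mul_eq_one ⟨1 / (b : F), (hT _).2 ⟨1, b, hb, ?_⟩⟩
        (Subtype.ext (by simpa using mul_inv_cancel₀ hb0))
      simp
    · intro hu hb
      obtain ⟨s, hs⟩ := hu.exists_right_inv
      have hs' : (b : F) * s = 1 := congrArg Subtype.val hs
      obtain ⟨a, c, hc, e⟩ := (hT s).1 s.2
      simp only [Subalgebra.algebraMap_def, Algebra.algebraMap_self, RingHom.id_apply] at e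
      have hc0 : (c : F) ≠ 0 := fun h0 => hc (by
        have : c = 0 := Subtype.ext h0
        rw [this]; exact P.zero_mem)
      rw [e, ← mul_div_assoc, div_eq_one_iff_eq hc0] at hs'
      have : b * a = c := Subtype.ext hs'
      exact hc (this ▸ P.mul_mem_right _ hb)
  ext t
  rw [hT, mem_centerLocalization]
  constructor
  · rintro ⟨a, b, hb, rfl⟩
    exact ⟨a, a.2, b, b.2, (hunit b).1 hb, rfl⟩
  · rintro ⟨a, ha, b, hb, hμ, rfl⟩
    exact ⟨⟨a, ha⟩, ⟨b, hb⟩, (hunit _).2 hμ, rfl⟩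

/-- Elements that are constant modulo an ideal form a subalgebra, so only generators need checking.
-/
theorem exists_sub_algebraMap_mem_span_of_adjoin {G : Set F} (Y : Set (Algebra.adjoin k G))
    (hG : ∀ g : Algebra.adjoin k G, (g : F) ∈ G →
      ∃ c : k, g - algebraMap k _ c ∈ Ideal.span Y) (a : Algebra.adjoin k G) :
    ∃ c : k, a - algebraMap k _ c ∈ Ideal.span Y := by
  obtain ⟨a, ha⟩ := a
  induction ha using Algebra.adjoin_induction with
  | mem x hx => exact hG ⟨x, _⟩ hx
  | algebraMap c => exact ⟨c, by
      have : (⟨algebraMap k F c, Subalgebra.algebraMap_mem _ c⟩ : Algebra.adjoin k G) =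
        algebraMap k _ c := rfl
      rw [this, sub_self]; exact zero_mem _⟩
  | add x y hx hy h h' =>
    obtain ⟨c, h⟩ := h
    obtain ⟨c', h'⟩ := h'
    refine ⟨c + c', ?_⟩
    have := add_mem h h'
    rwa [← add_sub_add_comm, ← map_add] at this
  | mul x y hx hy h h' =>
    obtain ⟨c, h⟩ := h
    obtain ⟨c', h'⟩ := h'
    refine ⟨c * c', ?_⟩
    have : (⟨x * y, mul_mem hx hy⟩ : Algebra.adjoin k G) - algebraMap k _ (c * c') =
        (⟨x, hx⟩ - algebraMap k _ c) * ⟨y, hy⟩ +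
          algebraMap k _ c * (⟨y, hy⟩ - algebraMap k _ c') := by
      have e : (⟨x * y, mul_mem hx hy⟩ : Algebra.adjoin k G) = ⟨x, hx⟩ * ⟨y, hy⟩ := rfl
      rw [e, map_mul]
      ring
    rw [this]
    exact add_mem (Ideal.mul_mem_right _ _ h) (Ideal.mul_mem_left _ _ h')

/-- Since every element of `A` is a constant modulo the ideal generated by `Y`, and nonzero
constants have value one, that ideal is exactly the center of the valuation. Quotients then have the
quotient of the two constants as residue. -/
theorem maximalIdeal_centerLocalization [IsLocalRing (centerLocalization μ A)]
    (hA : ∀ a ∈ A, μ a ≤ 1) (hk : ∀ c : k, c ≠ 0 → μ (algebraMap k F c) = 1)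
    (Y : Set A) (hY : ∀ y ∈ Y, μ (y : F) < 1)
    (hspan : ∀ a : A, ∃ c : k, a - algebraMap k A c ∈ Ideal.span Y) :
    maximalIdeal (centerLocalization μ A) =
      Ideal.span (Subalgebra.inclusion le_centerLocalization '' Y) ∧
    ∀ t : centerLocalization μ A, ∃ c : k,
      t - algebraMap k _ c ∈ maximalIdeal (centerLocalization μ A) := by
  have hdom := valDominates_centerLocalization hA
  have hlt : ∀ a ∈ Ideal.span Y, μ (a : F) < 1 := by
    intro a ha
    induction ha using Submodule.span_induction with
    | mem y hy => exact hY y hy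
    | zero => simp
    | add a b _ _ ha hb => exact (Valuation.map_add _ _ _).trans_lt (max_lt ha hb)
    | smul r a _ ha =>
      rw [smul_eq_mul, MulMemClass.coe_mul, map_mul]
      exact (mul_le_of_le_one_left' (hA r r.2)).trans_lt ha
  have hmem : ∀ a : A, μ (a : F) < 1 → a ∈ Ideal.span Y := by
    intro a ha
    obtain ⟨c, hc⟩ := hspan a
    rcases eq_or_ne c 0 with rfl | hc0
    · simpa using hc
    · have h1 := hlt _ hc
      rw [AddSubgroupClass.coe_sub] at h1
      have h2 := Valuation.map_sub μ (a : F) ((a : F) - (algebraMap k A c : A))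
      rw [sub_sub_cancel] at h2
      have h3 : μ ((algebraMap k A c : A) : F) = 1 := hk c hc0
      rw [h3] at h2
      exact absurd h2 (not_le.2 (max_lt ha h1))
  refine ⟨le_antisymm ?_ ?_, ?_⟩
  · rintro ⟨t, a, ha, b, hb, hμ, rfl⟩ ht
    have h1 := hdom.map_lt_one ht
    change μ (a / b) < 1 at h1
    rw [map_div₀, hμ, div_one] at h1
    have h2 := Ideal.mem_map_of_mem (Subalgebra.inclusion (le_centerLocalization (μ := μ)))
      (hmem ⟨a, ha⟩ h1)
    rw [Ideal.map_span] at h2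
    have h3 := Ideal.mul_mem_left _
      (⟨1 / b, 1, one_mem A, b, hb, hμ, rfl⟩ : centerLocalization μ A) h2
    have e : (⟨1 / b, 1, one_mem A, b, hb, hμ, rfl⟩ : centerLocalization μ A) *
        Subalgebra.inclusion le_centerLocalization ⟨a, ha⟩ = ⟨a / b, a, ha, b, hb, hμ, rfl⟩ :=
      Subtype.ext (one_div_mul_eq_div b a)
    rwa [e] at h3
  · rw [Ideal.span_le]
    rintro _ ⟨y, hy, rfl⟩
    exact hdom.mem_maximalIdeal (hY y hy)
  · rintro ⟨t, a, ha, b, hb, hμ, rfl⟩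
    obtain ⟨c, hc⟩ := hspan ⟨a, ha⟩
    obtain ⟨d, hd⟩ := hspan ⟨b, hb⟩
    have hd0 : d ≠ 0 := by
      rintro rfl
      have := hlt _ hd
      simp [hμ] at this
    refine ⟨c / d, hdom.mem_maximalIdeal ?_⟩
    have hb0 : b ≠ 0 := by rintro rfl; simp at hμ
    have hd0' : algebraMap k F d ≠ 0 := (map_ne_zero _).2 hd0
    have e : a / b - algebraMap k F (c / d) = ((a - algebraMap k F c) * algebraMap k F d -
        algebraMap k F c * (b - algebraMap k F d)) / (b * algebraMap k F d) := by
      rw [map_div₀]; field_simp; ring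
    change μ (a / b - algebraMap k F (c / d)) < 1
    rw [e, map_div₀, map_mul μ b, hμ, hk d hd0, mul_one, div_one]
    have h1 : μ (a - algebraMap k F c) < 1 := hlt _ hc
    have h2 : μ (b - algebraMap k F d) < 1 := hlt _ hd
    have h3 : μ (algebraMap k F c) ≤ 1 := hA _ (A.algebraMap_mem c)
    refine (Valuation.map_sub _ _ _).trans_lt (max_lt ?_ ?_)
    · rw [map_mul, hk d hd0, mul_one]; exact h1
    · rw [map_mul]; exact (mul_le_of_le_one_left' h3).trans_lt h2

theorem ValDominates.exists_finset_le_centerLocalization {T : Subalgebra k F}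
    [Algebra.EssFiniteType k T] (h : ValDominates μ T) :
    ∃ σ : Finset F, (σ : Set F) ⊆ T ∧ T ≤ centerLocalization μ (Algebra.adjoin k (σ : Set F)) := by
  classical
  obtain ⟨σ, hσ⟩ := (Algebra.essFiniteType_iff (R := k) (S := T)).1 inferInstance
  have hmap : ∀ t ∈ Algebra.adjoin k (σ : Set T),
      (t : F) ∈ Algebra.adjoin k ((σ.image Subtype.val : Finset F) : Set F) := by
    intro t ht
    have : (t : F) ∈ (Algebra.adjoin k (σ : Set T)).map T.val := ⟨t, ht, rfl⟩
    rw [AlgHom.map_adjoin] at this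
    rw [Finset.coe_image]
    exact this
  refine ⟨σ.image Subtype.val, ?_, fun t ht => ?_⟩
  · rw [Finset.coe_image]
    rintro _ ⟨t, -, rfl⟩
    exact t.2
  · obtain ⟨s, hs, hu, hts⟩ := hσ ⟨t, ht⟩
    have hs1 : μ (s : F) = 1 := by
      by_contra hne
      exact (h s).2.1 (lt_of_le_of_ne (h s).1 hne) hu
    have hs0 : (s : F) ≠ 0 := by intro h0; rw [h0, map_zero] at hs1; exact zero_ne_one hs1
    exact ⟨_, hmap _ hts, s, hmap s hs, hs1, by simp [hs0]⟩

theorem essFiniteType_centerLocalization (σ : Finset F)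
    (hA : ∀ a ∈ Algebra.adjoin k (σ : Set F), μ a ≤ 1) :
    Algebra.EssFiniteType k (centerLocalization μ (Algebra.adjoin k (σ : Set F))) := by
  classical
  let T := centerLocalization μ (Algebra.adjoin k (σ : Set F))
  have hσT : ∀ s ∈ σ, s ∈ T := fun s hs => le_centerLocalization (Algebra.subset_adjoin hs)
  let τ : Finset T := σ.attach.image fun s => ⟨s.1, hσT s.1 s.2⟩
  have hτ : T.val '' (τ : Set T) = σ := by
    ext s
    simp only [Set.mem_image, SetLike.mem_coe, τ, Finset.mem_image, Finset.mem_attach, true_and]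
    constructor
    · rintro ⟨_, ⟨s, rfl⟩, rfl⟩
      exact s.2
    · intro hs
      exact ⟨⟨s, hσT s hs⟩, ⟨⟨s, hs⟩, rfl⟩, rfl⟩
  have hmap : ∀ t : T, (t : F) ∈ Algebra.adjoin k (σ : Set F) →
      t ∈ Algebra.adjoin k (τ : Set T) := by
    intro t ht
    rw [← hτ, ← AlgHom.map_adjoin] at ht
    obtain ⟨t', ht', e⟩ := ht
    have : t' = t := Subtype.ext e
    rwa [← this]
  refine (Algebra.essFiniteType_iff _ _).2 ⟨τ, ?_⟩
  rintro ⟨_, a, ha, b, hb, hμ, rfl⟩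
  have hb0 : b ≠ 0 := by rintro rfl; simp at hμ
  refine ⟨⟨b, le_centerLocalization hb⟩, hmap _ hb,
    (isUnit_iff_of_mem_centerLocalization hA _).2 hμ, hmap _ ?_⟩
  simpa [hb0] using ha

/-- `T` need not be finitely generated, but finitely many of its elements generate it up to
denominators of value one, and localizing at the center inverts those anyway. -/
theorem essFiniteType_centerLocalization_adjoin_union {T : Subalgebra k F}
    [Algebra.EssFiniteType k T] (h : ValDominates μ T) (G : Set F) (hG : G.Finite)
    (hA : ∀ a ∈ Algebra.adjoin k ((T : Set F) ∪ G), μ a ≤ 1) :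
    Algebra.EssFiniteType k (centerLocalization μ (Algebra.adjoin k ((T : Set F) ∪ G))) := by
  classical
  obtain ⟨σ, hσT, hσ⟩ := h.exists_finset_le_centerLocalization
  have hle : Algebra.adjoin k ((σ ∪ hG.toFinset : Finset F) : Set F) ≤
      Algebra.adjoin k ((T : Set F) ∪ G) := by
    refine Algebra.adjoin_mono ?_
    rw [Finset.coe_union, Set.Finite.coe_toFinset]
    exact Set.union_subset_union_left _ hσT
  have heq : centerLocalization μ (Algebra.adjoin k ((T : Set F) ∪ G)) =
      centerLocalization μ (Algebra.adjoin k ((σ ∪ hG.toFinset : Finset F) : Set F)) := by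
    refine le_antisymm (centerLocalization_le (Algebra.adjoin_le ?_))
      (centerLocalization_le (hle.trans le_centerLocalization))
    rintro t (ht | ht)
    · refine centerLocalization_le (le_trans (Algebra.adjoin_mono ?_) le_centerLocalization) (hσ ht)
      rw [Finset.coe_union]
      exact Set.subset_union_left
    · refine le_centerLocalization (Algebra.subset_adjoin ?_)
      rw [Finset.coe_union, Set.Finite.coe_toFinset]
      exact Or.inr ht
  rw [heq]
  exact essFiniteType_centerLocalization _ fun a ha => hA a (hle ha)

end CenterLocalization

/-! ### Quadratic transforms of monomial charts -/

section QuadraticTransform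

variable {k F Γ₀ : Type*} [Field k] [Field F] [Algebra k F] [LinearOrderedCommGroupWithZero Γ₀]

theorem ValDominates.map_algebraMap_le_one {μ : Valuation F Γ₀} {T : Subalgebra k F}
    (h : ValDominates μ T) (c : k) : μ (algebraMap k F c) ≤ 1 :=
  (h (algebraMap k T c)).1

namespace IsMonomialChart

variable {μ : Valuation F Γ₀} {T : Subalgebra k F} [IsLocalRing T] {z : Fin 2 → T}

theorem coe_ne_zero (h : IsMonomialChart μ T z) (i : Fin 2) : (z i : F) ≠ 0 := by
  fin_cases i
  · exact h.ind.1
  · exact h.ind.2.1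

theorem exists_eq_add_of_mem (h : IsMonomialChart μ T z) {t : T} (ht : t ∈ maximalIdeal T) :
    ∃ α β : T, t = α * z 0 + β * z 1 := by
  rw [h.span, Ideal.mem_span_range_iff_exists_fun] at ht
  obtain ⟨c, rfl⟩ := ht
  exact ⟨c 0, c 1, by rw [Fin.sum_univ_two]⟩

theorem swap (h : IsMonomialChart μ T z) : IsMonomialChart μ T ![z 1, z 0] where
  arch := h.arch
  dom := h.dom
  res := h.res
  span := by
    rw [h.span]
    congr 1
    ext t
    simp only [Set.mem_range, Fin.exists_fin_two, Matrix.cons_val_zero, Matrix.cons_val_one]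
    exact or_comm
  ind := ⟨h.ind.2.1, h.ind.1, fun m n e => (h.ind.2.2 n m (by rw [mul_comm]; exact e)).symm⟩

/-- The algebra generated by `T` and `z 1 / z 0`. -/
abbrev chartAlgebra (T : Subalgebra k F) (z : Fin 2 → T) : Subalgebra k F :=
  Algebra.adjoin k ((T : Set F) ∪ {(z 1 : F) / z 0})

theorem map_le_one_of_mem_chartAlgebra (h : IsMonomialChart μ T z)
    (hlt : μ (z 1 : F) < μ (z 0 : F)) : ∀ a ∈ chartAlgebra T z, μ a ≤ 1 := by
  intro a ha
  refine map_le_one_of_mem_adjoin h.dom.map_algebraMap_le_one ?_ ha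
  rintro g (hg | rfl)
  · exact (h.dom ⟨g, hg⟩).1
  · rw [map_div₀]
    exact div_le_one_of_le₀ hlt.le zero_le

/-- The strict inequality puts the center at the origin of this affine chart of the blowup: `z 1 / z
0` has value below one, and `z 1` becomes a multiple of `z 0`. Hence elements of `T` are constant
modulo `z 0`, so the residue field is still `k`. -/
theorem exists_blowup_chart (h : IsMonomialChart μ T z) (hlt : μ (z 1 : F) < μ (z 0 : F)) :
    ∃ (_ : IsLocalRing (centerLocalization μ (chartAlgebra T z)))
      (z' : Fin 2 → centerLocalization μ (chartAlgebra T z)),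
      IsMonomialChart μ (centerLocalization μ (chartAlgebra T z)) z' ∧
      (z' 0 : F) = z 0 ∧ (z' 1 : F) = z 1 / z 0 := by
  have hA := h.map_le_one_of_mem_chartAlgebra hlt
  have h0 : (z 0 : F) ∈ chartAlgebra T z := Algebra.subset_adjoin (Or.inl (z 0).2)
  have h1 : (z 1 : F) / z 0 ∈ chartAlgebra T z := Algebra.subset_adjoin (Or.inr rfl)
  have hT : ∀ t ∈ T, t ∈ chartAlgebra T z := fun t ht => Algebra.subset_adjoin (Or.inl ht)
  have hloc := isLocalRing_centerLocalization hA
  let w : Fin 2 → chartAlgebra T z := ![⟨z 0, h0⟩, ⟨z 1 / z 0, h1⟩]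
  obtain ⟨hmax, hres⟩ := maximalIdeal_centerLocalization hA
    (fun c hc => h.dom.map_algebraMap hc) (Set.range w) (by
      rintro _ ⟨i, rfl⟩
      fin_cases i
      · exact h.dom.map_lt_one (h.mem_maximalIdeal 0)
      · change μ ((z 1 : F) / z 0) < 1
        rw [map_div₀]
        exact (div_lt_one₀ (zero_lt_iff.2 ((Valuation.ne_zero_iff μ).2 h.ind.1))).2 hlt)
    (exists_sub_algebraMap_mem_span_of_adjoin _ (by
      rintro g (hg | hg)
      · obtain ⟨c, hc⟩ := h.res ⟨g, hg⟩
        obtain ⟨α, β, e⟩ := h.exists_eq_add_of_mem hc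
        refine ⟨c, ?_⟩
        have e' : g - algebraMap k _ c =
            (⟨α, hT α α.2⟩ + ⟨β, hT β β.2⟩ * w 1) * w 0 := by
          refine Subtype.ext ?_
          have e1 := congrArg Subtype.val e
          change (g : F) - algebraMap k F c = α * z 0 + β * z 1 at e1
          change (g : F) - algebraMap k F c = (α + β * (z 1 / z 0)) * z 0
          rw [e1, add_mul, mul_assoc, div_mul_cancel₀ _ h.ind.1]
        rw [e']
        exact Ideal.mul_mem_left _ _ (Ideal.subset_span ⟨0, rfl⟩)
      · refine ⟨0, ?_⟩
        rw [map_zero, sub_zero]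
        exact Ideal.subset_span ⟨1, Subtype.ext hg.symm⟩))
  refine ⟨hloc, fun i => Subalgebra.inclusion le_centerLocalization (w i),
    { arch := h.arch
      dom := valDominates_centerLocalization hA
      res := hres
      span := by rw [hmax, ← Set.range_comp]; rfl
      ind := ⟨h.ind.1, div_ne_zero h.ind.2.1 h.ind.1, fun m n e => ?_⟩ }, rfl, rfl⟩
  have hx : μ (z 0 : F) ≠ 0 := (Valuation.ne_zero_iff μ).2 h.ind.1
  change μ (z 0 : F) ^ m * μ ((z 1 : F) / z 0) ^ n = 1 at e
  have := h.ind.2.2 (m - n) n (by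
    rw [← e, map_div₀, div_zpow, zpow_sub₀ hx]
    field_simp)
  omega

/-- The choice of `w` and of the prime is immaterial: the valuation singles out one point of the
blowup, and near it `w / z 0` is a unit. -/
theorem eq_centerLocalization_chartAlgebra (h : IsMonomialChart μ T z)
    (hlt : μ (z 1 : F) < μ (z 0 : F)) {T' : Subalgebra k F} (hq : IsQuadraticTransform T T')
    (hdom : ValDominates μ T') : T' = centerLocalization μ (chartAlgebra T z) := by
  obtain ⟨_, w, hw, hw0, P, hP, -, hloc⟩ := hq
  have hT' := hloc.eq_centerLocalization hP hdom
  have hw0' : (w : F) ≠ 0 := fun e => hw0 (Subtype.ext e)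
  have hle : ∀ a ∈ blowupAlgebra T w, μ a ≤ 1 := fun a ha =>
    (hdom ⟨a, by rw [hT']; exact le_centerLocalization ha⟩).1
  have hdivw : ∀ t ∈ maximalIdeal T, (t : F) / w ∈ blowupAlgebra T w := fun t ht =>
    Algebra.subset_adjoin (Or.inr ⟨t, ht, rfl⟩)
  have hTw : T ≤ blowupAlgebra T w := le_blowupAlgebra T w
  have hTz : ∀ t ∈ T, t ∈ chartAlgebra T z := fun t ht => Algebra.subset_adjoin (Or.inl ht)
  have h1 : (z 1 : F) / z 0 ∈ chartAlgebra T z := Algebra.subset_adjoin (Or.inr rfl)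
  have hdivz : ∀ t ∈ maximalIdeal T, (t : F) / z 0 ∈ chartAlgebra T z := by
    intro t ht
    obtain ⟨α, β, rfl⟩ := h.exists_eq_add_of_mem ht
    have e : ((α * z 0 + β * z 1 : T) : F) / z 0 = α + β * (z 1 / z 0) := by
      have := h.ind.1
      push_cast
      field_simp
    rw [e]
    exact add_mem (hTz _ α.2) (mul_mem (hTz _ β.2) h1)
  have hμz : μ (z 0 : F) ≠ 0 := (Valuation.ne_zero_iff μ).2 h.ind.1
  have hμw : μ (w : F) ≠ 0 := (Valuation.ne_zero_iff μ).2 hw0'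
  -- Both `w / z 0` and `z 0 / w` lie in rings on which the valuation is at most one.
  have hval : μ (w : F) = μ (z 0 : F) := by
    refine le_antisymm ?_ ?_
    · have := h.map_le_one_of_mem_chartAlgebra hlt _ (hdivz w hw)
      rwa [map_div₀, div_le_one₀ (zero_lt_iff.2 hμz)] at this
    · have := hle _ (hdivw (z 0) (h.mem_maximalIdeal 0))
      rwa [map_div₀, div_le_one₀ (zero_lt_iff.2 hμw)] at this
  rw [hT']
  refine le_antisymm (centerLocalization_le (Algebra.adjoin_le ?_))
    (centerLocalization_le (Algebra.adjoin_le ?_))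
  · rintro t (ht | ⟨p, hp, rfl⟩)
    · exact le_centerLocalization (hTz t ht)
    · have := div_mem_centerLocalization (μ := μ) (le_centerLocalization (hdivz p hp))
        (le_centerLocalization (hdivz w hw)) (by rw [map_div₀, hval, div_self hμz])
      rwa [div_div_div_cancel_right₀ h.ind.1] at this
  · rintro t (ht | rfl)
    · exact le_centerLocalization (hTw ht)
    · have := div_mem_centerLocalization (μ := μ)
        (le_centerLocalization (hdivw (z 1) (h.mem_maximalIdeal 1)))
        (le_centerLocalization (hdivw (z 0) (h.mem_maximalIdeal 0)))
        (by rw [map_div₀, hval, div_self hμz])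
      rwa [div_div_div_cancel_right₀ hw0'] at this

theorem exists_chart_of_quadraticTransform [Algebra.EssFiniteType k T]
    (h : IsMonomialChart μ T z) {T' : Subalgebra k F} (hq : IsQuadraticTransform T T')
    (hdom : ValDominates μ T') :
    T ≤ T' ∧ Algebra.EssFiniteType k T' ∧ ∃ (_ : IsLocalRing T') (z' : Fin 2 → T'),
      IsMonomialChart μ T' z' ∧ ∃ a b c d : ℕ,
        (z 0 : F) = (z' 0 : F) ^ a * (z' 1 : F) ^ b ∧
        (z 1 : F) = (z' 0 : F) ^ c * (z' 1 : F) ^ d ∧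
        ((a * d - b * c : ℤ) = 1 ∨ (a * d - b * c : ℤ) = -1) := by
  wlog hlt : μ (z 1 : F) < μ (z 0 : F) generalizing z
  -- Independence excludes equal values, so one parameter is strictly smaller. Exchanging the two
  -- only changes the sign of the determinant.
  · have hne : μ (z 0 : F) ≠ μ (z 1 : F) := by
      intro e
      have := h.ind.2.2 1 (-1) (by
        rw [e, zpow_one, zpow_neg, zpow_one,
          mul_inv_cancel₀ ((Valuation.ne_zero_iff μ).2 h.ind.2.1)])
      exact absurd this.1 one_ne_zero
    obtain ⟨h1, h2, hl, z', h3, a, b, c, d, h4, h5, h6⟩ := this h.swap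
      (lt_of_le_of_ne (not_lt.1 hlt) hne)
    exact ⟨h1, h2, hl, z', h3, c, d, a, b, h5, h4, by
      rcases h6 with h6 | h6
      · right; linarith
      · left; linarith⟩
  have hT' := h.eq_centerLocalization_chartAlgebra hlt hq hdom
  subst hT'
  obtain ⟨hl, z', hz', e0, e1⟩ := h.exists_blowup_chart hlt
  have hess : Algebra.EssFiniteType k (centerLocalization μ (chartAlgebra T z)) :=
    essFiniteType_centerLocalization_adjoin_union h.dom _ (Set.finite_singleton _)
      (h.map_le_one_of_mem_chartAlgebra hlt)
  refine ⟨fun t ht => le_centerLocalization (Algebra.subset_adjoin (Or.inl ht)), hess, hl, z', hz',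
    1, 0, 1, 1, by simp [e0], ?_, by simp⟩
  rw [e0, e1, pow_one, pow_one, mul_div_cancel₀ _ h.ind.1]

theorem exists_chart_of_quadraticSequence [Algebra.EssFiniteType k T]
    (h : IsMonomialChart μ T z) {T' : Subalgebra k F} (hq : IsQuadraticSequenceAlong μ T T') :
    T ≤ T' ∧ Algebra.EssFiniteType k T' ∧ ∃ (_ : IsLocalRing T') (z' : Fin 2 → T'),
      IsMonomialChart μ T' z' ∧ ∃ a b c d : ℕ,
        (z 0 : F) = (z' 0 : F) ^ a * (z' 1 : F) ^ b ∧
        (z 1 : F) = (z' 0 : F) ^ c * (z' 1 : F) ^ d ∧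
        ((a * d - b * c : ℤ) = 1 ∨ (a * d - b * c : ℤ) = -1) := by
  induction hq with
  | refl => exact ⟨le_rfl, inferInstance, inferInstance, z, h, 1, 0, 0, 1, by simp⟩
  | tail _ hstep ih =>
    obtain ⟨hle, hess, hl, z', hz', a, b, c, d, h1, h2, h3⟩ := ih
    obtain ⟨hle', hess', hl', z'', hz'', a', b', c', d', h1', h2', h3'⟩ :=
      hz'.exists_chart_of_quadraticTransform hstep.1 hstep.2
    refine ⟨hle.trans hle', hess', hl', z'', hz'', a * a' + b * c', a * b' + b * d',
      c * a' + d * c', c * b' + d * d', ?_, ?_, ?_⟩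
    · rw [h1, h1', h2']; ring
    · rw [h2, h1', h2']; ring
    · have e : ((a * a' + b * c' : ℕ) * (c * b' + d * d' : ℕ) -
          (a * b' + b * d' : ℕ) * (c * a' + d * c' : ℕ) : ℤ) =
          (a * d - b * c) * (a' * d' - b' * c') := by push_cast; ring
      rw [e]
      rcases h3 with h3 | h3 <;> rcases h3' with h3' | h3' <;> rw [h3, h3'] <;> simp

end IsMonomialChart

end QuadraticTransform

/-! ### Krull's intersection theorem and normality of monomial charts -/

section Krull

/-- Krull's intersection theorem for an ideal of a Noetherian local ring. -/
theorem Ideal.mem_of_forall_exists_sub_mem_pow {R : Type*} [CommRing R] [IsLocalRing R]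
    [IsNoetherianRing R] (I : Ideal R) {f : R}
    (h : ∀ n, ∃ a ∈ I, f - a ∈ maximalIdeal R ^ n) : f ∈ I := by
  have hH : IsHausdorff (maximalIdeal R) (R ⧸ I) := inferInstance
  rw [← Ideal.Quotient.eq_zero_iff_mem]
  refine hH.haus _ fun n => ?_
  obtain ⟨a, ha, hn⟩ := h n
  rw [SModEq.zero]
  have e : Ideal.Quotient.mk I f = (f - a) • (1 : R ⧸ I) := by
    rw [Algebra.smul_def, mul_one, Ideal.Quotient.algebraMap_eq, map_sub,
      Ideal.Quotient.eq_zero_iff_mem.2 ha, sub_zero]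
  rw [e]
  exact Submodule.smul_mem_smul hn trivial

end Krull

section Normal

variable {k F Γ₀ : Type*} [Field k] [Field F] [Algebra k F] [LinearOrderedCommGroupWithZero Γ₀]

namespace IsMonomialChart

variable {μ : Valuation F Γ₀} {T : Subalgebra k F} [IsLocalRing T] {z : Fin 2 → T}

/-- Subtracting the leading term of a polynomial approximation: every other monomial of the
approximation has strictly smaller value, and the error was chosen smaller as well. -/
theorem exists_map_sub_lt (h : IsMonomialChart μ T z) {t : T} (ht : t ≠ 0) :
    ∃ (l : Fin 2 →₀ ℕ) (c : k), c ≠ 0 ∧ μ (t : F) = μ (z 0 : F) ^ l 0 * μ (z 1 : F) ^ l 1 ∧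
      μ ((t - algebraMap k T c * (z 0 ^ l 0 * z 1 ^ l 1) : T) : F) < μ (t : F) := by
  classical
  obtain ⟨n, hn⟩ := h.exists_forall_mem_pow_lt (a := (t : F)) (by simpa using ht)
  obtain ⟨q, hq⟩ := h.exists_aeval_sub_mem_pow n t
  have hlt := hn _ hq
  have heq : μ (t : F) = μ (MvPolynomial.aeval z q : T) := by
    have hlt' := hlt
    rw [AddSubgroupClass.coe_sub, Valuation.map_sub_swap] at hlt'
    have := Valuation.map_add_eq_of_lt_left μ hlt'
    rw [add_sub_cancel] at this
    exact this.symm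
  have hq0 : q ≠ 0 := by
    rintro rfl
    simp at heq
    exact ht heq
  obtain ⟨l, hl, h1, h2⟩ := h.exists_map_aeval hq0
  refine ⟨l, q.coeff l, MvPolynomial.mem_support_iff.1 hl, heq.trans h1, ?_⟩
  have hmon : MvPolynomial.aeval z (MvPolynomial.monomial l (q.coeff l)) =
      algebraMap k T (q.coeff l) * (z 0 ^ l 0 * z 1 ^ l 1) := by
    rw [MvPolynomial.aeval_monomial, Finsupp.prod_fintype _ _ (fun i => pow_zero _),
      Fin.prod_univ_two]
  have hsmall : μ ((MvPolynomial.aeval z (q - MvPolynomial.monomial l (q.coeff l)) : T) : F) <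
      μ (t : F) := by
    rw [heq]
    rcases eq_or_ne (q - MvPolynomial.monomial l (q.coeff l)) 0 with h0 | h0
    · rw [h0, map_zero, ZeroMemClass.coe_zero, map_zero, ← heq]
      simpa [zero_lt_iff] using ht
    · obtain ⟨l', hl', h3, -⟩ := h.exists_map_aeval h0
      have hne : l' ≠ l := by
        rintro rfl
        simp at hl'
      have hl'q : l' ∈ q.support := by
        rw [MvPolynomial.mem_support_iff, MvPolynomial.coeff_sub, MvPolynomial.coeff_monomial,
          if_neg hne.symm, sub_zero] at hl'
        exact MvPolynomial.mem_support_iff.2 hl'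
      rw [h3, h1]
      exact lt_of_le_of_ne (h2 l' hl'q) fun e => hne (h.ind.pow_mul_pow_injective e)
  have e : t - algebraMap k T (q.coeff l) * (z 0 ^ l 0 * z 1 ^ l 1) =
      (t - MvPolynomial.aeval z q) +
        MvPolynomial.aeval z (q - MvPolynomial.monomial l (q.coeff l)) := by
    rw [map_sub, hmon]; ring
  rw [e]
  exact (Valuation.map_add _ _ _).trans_lt (max_lt hlt hsmall)

/-- Only finitely many values occur outside a power of the maximal ideal. An element outside it is
at least as large as some monomial of degree below `N`, and all monomials of sufficiently high
degree are smaller than each of those. -/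
theorem exists_forall_lt_mem_pow (h : IsMonomialChart μ T z) (N : ℕ) :
    ∃ s : Finset (Fin 2 →₀ ℕ), ∀ t : T, t ∉ maximalIdeal T ^ N →
      ∃ l ∈ s, μ (t : F) = μ (z 0 : F) ^ l 0 * μ (z 1 : F) ^ l 1 := by
  classical
  let D : Finset (Fin 2 →₀ ℕ) := (Finsupp.finite_of_degree_lt N).toFinset
  have hD : ∀ l, l ∈ D ↔ Finsupp.degree l < N := fun l => by simp [D]
  have hmem : ∀ t : T, t ∉ maximalIdeal T ^ N →
      ∃ l ∈ D, μ (z 0 : F) ^ l 0 * μ (z 1 : F) ^ l 1 ≤ μ (t : F) := by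
    intro t ht
    have ht0 : (t : F) ≠ 0 := fun e => ht (by
      have : t = 0 := Subtype.ext e
      rw [this]; exact zero_mem _)
    obtain ⟨M, hM⟩ := h.exists_forall_mem_pow_lt ht0
    obtain ⟨q, hq⟩ := h.exists_aeval_sub_mem_pow (max M N) t
    have hlt := hM _ (Ideal.pow_le_pow_right (le_max_left _ _) hq)
    have heq : μ (t : F) = μ (MvPolynomial.aeval z q : T) := by
      rw [AddSubgroupClass.coe_sub, Valuation.map_sub_swap] at hlt
      have := Valuation.map_add_eq_of_lt_left μ hlt
      rw [add_sub_cancel] at this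
      exact this.symm
    have hqN : q ∉ MvPolynomial.idealOfVars (Fin 2) k ^ N := by
      rw [← h.aeval_mem_pow_iff]
      intro hqN
      have := add_mem (Ideal.pow_le_pow_right (le_max_right _ _) hq) hqN
      rw [sub_add_cancel] at this
      exact ht this
    rw [MvPolynomial.mem_pow_idealOfVars_iff] at hqN
    push Not at hqN
    obtain ⟨l, hl, hlN⟩ := hqN
    exact ⟨l, (hD l).2 hlN, heq ▸ h.le_map_aeval hl⟩
  have hex : ∃ n, ∀ l ∈ D, ∀ t ∈ maximalIdeal T ^ n,
      μ (t : F) < μ (z 0 : F) ^ l 0 * μ (z 1 : F) ^ l 1 := by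
    have : ∀ l : Fin 2 →₀ ℕ, ∃ n, ∀ t ∈ maximalIdeal T ^ n,
        μ (t : F) < μ (z 0 : F) ^ l 0 * μ (z 1 : F) ^ l 1 := by
      intro l
      obtain ⟨n, hn⟩ := h.exists_forall_mem_pow_lt (a := (z 0 : F) ^ l 0 * (z 1 : F) ^ l 1)
        (by rw [← Valuation.ne_zero_iff μ]; simpa using h.monomial_ne_zero l)
      exact ⟨n, by simpa using hn⟩
    choose n hn using this
    refine ⟨D.sup n, fun l hl t ht => hn l t (Ideal.pow_le_pow_right (Finset.le_sup hl) ht)⟩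
  obtain ⟨n, hn⟩ := hex
  refine ⟨(Finsupp.finite_of_degree_lt n).toFinset, fun t ht => ?_⟩
  obtain ⟨l, hl, hle⟩ := hmem t ht
  have ht0 : t ≠ 0 := by
    rintro rfl
    exact ht (zero_mem _)
  obtain ⟨l', hl'⟩ := h.exists_map_eq ht0
  refine ⟨l', ?_, hl'⟩
  rw [Set.Finite.mem_toFinset]
  change Finsupp.degree l' < n
  by_contra! hge
  have hz : z 0 ^ l' 0 * z 1 ^ l' 1 ∈ maximalIdeal T ^ n := by
    refine Ideal.pow_le_pow_right hge ?_
    rw [Finsupp.degree_eq_sum, Fin.sum_univ_two, pow_add]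
    exact Ideal.mul_mem_mul (Ideal.pow_mem_pow (h.mem_maximalIdeal 0) _)
      (Ideal.pow_mem_pow (h.mem_maximalIdeal 1) _)
  have := hn l hl _ hz
  rw [MulMemClass.coe_mul, SubmonoidClass.coe_pow, SubmonoidClass.coe_pow, map_mul, map_pow,
    map_pow, ← hl'] at this
  exact absurd hle (not_le.2 this)

/-- This is complete integral closedness, by division with remainder: as long as `f` does not divide
`g`, a leading term of the remainder can be divided by that of `f`, lowering its value. The process
must stop because only finitely many values are available. -/
theorem dvd_of_forall_dvd_mul_pow [IsNoetherianRing T] (h : IsMonomialChart μ T z) {g f c : T}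
    (hf : f ≠ 0) (hc : c ≠ 0) (hdvd : ∀ n, f ^ n ∣ c * g ^ n) : f ∣ g := by
  classical
  by_contra hfg
  have hstep : ∀ s : T, ∃ s' : T, μ ((g - f * s' : T) : F) < μ ((g - f * s : T) : F) := by
    intro s
    have he0 : g - f * s ≠ 0 := fun e => hfg ⟨s, sub_eq_zero.1 e⟩
    have hdvd' : ∀ n, f ^ n ∣ c * (g - f * s) ^ n := by
      intro n
      rw [sub_eq_add_neg, add_pow, Finset.mul_sum]
      refine Finset.dvd_sum fun i hi => ?_
      have hin : i + (n - i) = n := by rw [Finset.mem_range] at hi; omega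
      have h1 : f ^ i * f ^ (n - i) ∣ c * g ^ i * (-(f * s)) ^ (n - i) :=
        mul_dvd_mul (hdvd i) (pow_dvd_pow_of_dvd ((dvd_neg.2 (Dvd.intro s rfl))) _)
      rw [← pow_add, hin] at h1
      have e : c * (g ^ i * (-(f * s)) ^ (n - i) * (n.choose i : T)) =
          c * g ^ i * (-(f * s)) ^ (n - i) * (n.choose i : T) := by ring
      rw [e]
      exact h1.mul_right _
    obtain ⟨lg, cg, hcg, hg1, hg2⟩ := h.exists_map_sub_lt he0
    obtain ⟨lf, cf, hcf, hf1, hf2⟩ := h.exists_map_sub_lt hf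
    obtain ⟨lc, hlc⟩ := h.exists_map_eq hc
    -- Comparing exponents in `f ^ n ∣ c (g - f s) ^ n` gives `n lf ≤ lc + n lg` for all `n`. Taking
    -- `n = lc i + 1` rules out `lg i < lf i`.
    have hle : ∀ i, lf i ≤ lg i := by
      have hn : ∀ n : ℕ, ∀ i, n * lf i ≤ lc i + n * lg i := by
        intro n
        obtain ⟨t, ht⟩ := hdvd' n
        have ht0 : t ≠ 0 := by
          rintro rfl
          rw [mul_zero] at ht
          exact mul_ne_zero hc (pow_ne_zero n he0) ht
        obtain ⟨lt, hlt⟩ := h.exists_map_eq ht0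
        have e1 := congrArg (fun t : T => μ (t : F)) ht
        simp only [MulMemClass.coe_mul, SubmonoidClass.coe_pow, map_mul, map_pow] at e1
        rw [hg1, hf1, hlc, hlt] at e1
        have e2 : lc + n • lg = n • lf + lt := h.ind.pow_mul_pow_injective (by
          have key : ∀ p q r s : ℕ, μ (z 0 : F) ^ (p + n * q) * μ (z 1 : F) ^ (r + n * s) =
              μ (z 0 : F) ^ p * μ (z 1 : F) ^ r *
                (μ (z 0 : F) ^ q * μ (z 1 : F) ^ s) ^ n := by
            intro p q r s
            rw [pow_add, pow_add, mul_mul_mul_comm, mul_comm n, mul_comm n, pow_mul, pow_mul,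
              ← mul_pow]
          simp only [Finsupp.add_apply, Finsupp.smul_apply, smul_eq_mul]
          rw [key, e1, add_comm, add_comm (n * lf 1), key, mul_comm])
        intro i
        have := DFunLike.congr_fun e2 i
        simp only [Finsupp.add_apply, Finsupp.smul_apply, smul_eq_mul] at this
        omega
      intro i
      by_contra! hlt
      have := hn (lc i + 1) i
      nlinarith
    let m : T := z 0 ^ (lg 0 - lf 0) * z 1 ^ (lg 1 - lf 1)
    have hm : z 0 ^ lf 0 * z 1 ^ lf 1 * m = z 0 ^ lg 0 * z 1 ^ lg 1 := by
      simp only [m]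
      rw [mul_mul_mul_comm, ← pow_add, ← pow_add, Nat.add_sub_cancel' (hle 0),
        Nat.add_sub_cancel' (hle 1)]
    refine ⟨s + algebraMap k T (cg / cf) * m, ?_⟩
    have hcf' : algebraMap k T (cg / cf) * algebraMap k T cf = algebraMap k T cg := by
      rw [← map_mul, div_mul_cancel₀ _ hcf]
    have e : g - f * (s + algebraMap k T (cg / cf) * m) =
        (g - f * s - algebraMap k T cg * (z 0 ^ lg 0 * z 1 ^ lg 1)) -
          algebraMap k T (cg / cf) *
            ((f - algebraMap k T cf * (z 0 ^ lf 0 * z 1 ^ lf 1)) * m) := by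
      rw [← hm, ← hcf']; ring
    rw [e, AddSubgroupClass.coe_sub]
    refine (Valuation.map_sub _ _ _).trans_lt (max_lt hg2 ?_)
    rw [MulMemClass.coe_mul, map_mul, MulMemClass.coe_mul, map_mul]
    refine (mul_le_of_le_one_left' (h.dom _).1).trans_lt ?_
    have hm0 : 0 < μ (m : F) := by
      rw [zero_lt_iff, Valuation.ne_zero_iff]
      simp only [m, MulMemClass.coe_mul, SubmonoidClass.coe_pow]
      exact mul_ne_zero (pow_ne_zero _ h.ind.1) (pow_ne_zero _ h.ind.2.1)
    have h3 : μ (f : F) * μ (m : F) = μ ((g - f * s : T) : F) := by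
      have h4 := congrArg (fun t : T => μ (t : F)) hm
      simp only [MulMemClass.coe_mul, SubmonoidClass.coe_pow, map_mul, map_pow] at h4
      rw [hf1, hg1, ← h4, MulMemClass.coe_mul, map_mul]
    rw [← h3]
    exact mul_lt_mul_of_pos_right hf2 hm0
  -- By Krull's theorem all remainders `g - f s` stay outside some power of the maximal ideal.
  -- Finitely many values occur there, so a remainder of least value exists, contradicting `hstep`.
  refine hfg (Ideal.mem_span_singleton.1 (Ideal.mem_of_forall_exists_sub_mem_pow _ fun N => ?_))
  by_contra! hN
  obtain ⟨S, hS⟩ := h.exists_forall_lt_mem_pow N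
  have hS' : ∀ s : T, ∃ l ∈ S, μ ((g - f * s : T) : F) =
      μ (z 0 : F) ^ l 0 * μ (z 1 : F) ^ l 1 := fun s =>
    hS _ (hN _ (Ideal.mem_span_singleton.2 ⟨s, rfl⟩))
  let V : Set Γ₀ := Set.range fun s : T => μ ((g - f * s : T) : F)
  have hV : V.Finite := (S.finite_toSet.image
    (fun l => μ (z 0 : F) ^ l 0 * μ (z 1 : F) ^ l 1)).subset (by
      rintro _ ⟨s, rfl⟩
      obtain ⟨l, hl, e⟩ := hS' s
      exact ⟨l, hl, e.symm⟩)
  obtain ⟨_, ⟨s, rfl⟩, hmin⟩ := Set.exists_min_image V id hV ⟨_, ⟨0, rfl⟩⟩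
  obtain ⟨s', hs'⟩ := hstep s
  exact absurd (hmin _ ⟨s', rfl⟩) (not_le.2 hs')

/-- Integral elements are almost integral: one denominator `c` serves all powers of `g / d`, so `d`
divides `g` by the preceding lemma. -/
theorem mem_of_isIntegral [IsNoetherianRing T] [IsFractionRing T F] (h : IsMonomialChart μ T z)
    {f : F} (hf : IsIntegral T f) : f ∈ T := by
  obtain ⟨g, d, hd, rfl⟩ := IsFractionRing.div_surjective (A := T) f
  obtain ⟨c, hc, hcn⟩ := hf.isAlmostIntegral
  have hd0 : d ≠ 0 := nonZeroDivisors.ne_zero hd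
  have hd0' : (d : F) ≠ 0 := fun e => hd0 (Subtype.ext e)
  have hdvd : ∀ n, d ^ n ∣ c * g ^ n := by
    intro n
    obtain ⟨t, ht⟩ := hcn n
    refine ⟨t, Subtype.ext ?_⟩
    simp only [Subalgebra.algebraMap_def, Algebra.algebraMap_self, RingHom.id_apply,
      Algebra.smul_def, div_pow] at ht
    push_cast
    rw [ht]
    field_simp
  obtain ⟨t, rfl⟩ := h.dvd_of_forall_dvd_mul_pow hd0 (nonZeroDivisors.ne_zero hc) hdvd
  have : algebraMap T F (d * t) / algebraMap T F d = t := by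
    simp only [Subalgebra.algebraMap_def, Algebra.algebraMap_self, RingHom.id_apply,
      MulMemClass.coe_mul]
    rw [mul_div_cancel_left₀ _ hd0']
  rw [this]
  exact t.2

end IsMonomialChart

end Normal

/-! ### Submonoids of exponents cut out by a lattice -/

section FullSubmonoid

variable {σ : Type*}

/-- A submonoid of `ℕ^σ` that is the intersection of `ℕ^σ` with a subgroup of `ℤ^σ` containing
`N ℤ^σ`. -/
structure IsFullSubmonoid (Λ : AddSubmonoid (σ →₀ ℕ)) (N : ℕ) : Prop where
  pos : 0 < N
  mem_of_add_mem : ∀ {p q}, p ∈ Λ → p + q ∈ Λ → q ∈ Λ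
  single_mem : ∀ i, Finsupp.single i N ∈ Λ

/-- The exponents of the `n`-th power of the ideal generated by the monomials with exponent in
`Λ \ 0`. -/
def AddSubmonoid.powExponents (Λ : AddSubmonoid (σ →₀ ℕ)) : ℕ → Set (σ →₀ ℕ)
  | 0 => Λ
  | n + 1 => {l | ∃ p ∈ Λ, p ≠ 0 ∧ ∃ q ∈ Λ.powExponents n, l = p + q}

namespace AddSubmonoid

variable {Λ : AddSubmonoid (σ →₀ ℕ)}

theorem add_mem_powExponents_succ {n : ℕ} {p q : σ →₀ ℕ} (hp : p ∈ Λ) (hp0 : p ≠ 0)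
    (hq : q ∈ Λ.powExponents n) : p + q ∈ Λ.powExponents (n + 1) :=
  ⟨p, hp, hp0, q, hq, rfl⟩

theorem add_mem_powExponents {n : ℕ} {p q : σ →₀ ℕ} (hp : p ∈ Λ) (hq : q ∈ Λ.powExponents n) :
    p + q ∈ Λ.powExponents n := by
  induction n generalizing q with
  | zero => exact Λ.add_mem hp hq
  | succ n ih =>
    obtain ⟨p', hp', h0, q', hq', rfl⟩ := hq
    exact ⟨p', hp', h0, p + q', ih hq', add_left_comm _ _ _⟩

theorem powExponents_succ_subset (n : ℕ) : Λ.powExponents (n + 1) ⊆ Λ.powExponents n := by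
  rintro _ ⟨p, hp, h0, q, hq, rfl⟩
  exact add_mem_powExponents hp hq

theorem antitone_powExponents : Antitone Λ.powExponents :=
  antitone_nat_of_succ_le powExponents_succ_subset

theorem powExponents_subset (n : ℕ) : Λ.powExponents n ⊆ Λ :=
  antitone_powExponents (Nat.zero_le n)

theorem le_degree_of_mem_powExponents {n : ℕ} {l : σ →₀ ℕ} (hl : l ∈ Λ.powExponents n) :
    n ≤ Finsupp.degree l := by
  induction n generalizing l with
  | zero => exact Nat.zero_le _
  | succ n ih =>
    obtain ⟨p, hp, h0, q, hq, rfl⟩ := hl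
    have h1 := ih hq
    have h2 : Finsupp.degree p ≠ 0 := by rwa [Ne, Finsupp.degree_eq_zero_iff]
    rw [map_add]
    omega

theorem mem_powExponents_one {l : σ →₀ ℕ} : l ∈ Λ.powExponents 1 ↔ l ∈ Λ ∧ l ≠ 0 := by
  refine ⟨fun h => ⟨powExponents_subset 1 h, ?_⟩, fun h =>
    ⟨l, h.1, h.2, 0, Λ.zero_mem, (add_zero l).symm⟩⟩
  rintro rfl
  simpa using le_degree_of_mem_powExponents h

theorem add_mem_powExponents_of_one {n : ℕ} {p q : σ →₀ ℕ} (hp : p ∈ Λ.powExponents 1)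
    (hq : q ∈ Λ.powExponents n) : p + q ∈ Λ.powExponents (n + 1) :=
  add_mem_powExponents_succ (mem_powExponents_one.1 hp).1 (mem_powExponents_one.1 hp).2 hq

end AddSubmonoid

namespace IsFullSubmonoid

variable {Λ : AddSubmonoid (σ →₀ ℕ)} {N : ℕ}

theorem exists_eq_single_add (h : IsFullSubmonoid Λ N) {l : σ →₀ ℕ} (hl : l ∈ Λ) {i : σ}
    (hi : N ≤ l i) : ∃ q ∈ Λ, l = Finsupp.single i N + q := by
  have e : Finsupp.single i N + (l - Finsupp.single i N) = l :=
    add_tsub_cancel_of_le (by rwa [Finsupp.single_le_iff])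
  exact ⟨_, h.mem_of_add_mem (h.single_mem i) (by rwa [e]), e.symm⟩

/-- The vector `N eᵢ` can be split off `n` times, and the remainder stays in `Λ` by fullness. Hence
only vectors in a bounded box are missing from the `n`-th power. -/
theorem mem_powExponents (h : IsFullSubmonoid Λ N) {n : ℕ} {l : σ →₀ ℕ} (hl : l ∈ Λ) {i : σ}
    (hi : n * N ≤ l i) : l ∈ Λ.powExponents n := by
  induction n generalizing l with
  | zero => exact hl
  | succ n ih =>
    obtain ⟨q, hq, rfl⟩ := h.exists_eq_single_add hl (i := i) (by nlinarith)
    refine AddSubmonoid.add_mem_powExponents_succ (h.single_mem i) ?_ (ih hq ?_)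
    · simpa using h.pos.ne'
    · rw [Finsupp.add_apply, Finsupp.single_eq_same, add_mul, one_mul] at hi
      omega

theorem finite_setOf_le [Finite σ] (n : ℕ) : {l : σ →₀ ℕ | ∀ i, l i ≤ n}.Finite := by
  have : {f : σ → ℕ | ∀ i, f i ∈ Set.Iic n}.Finite := Set.Finite.pi' fun _ => Set.finite_Iic n
  exact (this.preimage (DFunLike.coe_injective (F := σ →₀ ℕ)).injOn).subset
    fun l hl i => hl i

theorem finite_diff_powExponents [Finite σ] (h : IsFullSubmonoid Λ N) (n : ℕ) :
    ((Λ : Set (σ →₀ ℕ)) \ Λ.powExponents n).Finite := by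
  refine (finite_setOf_le (n * N)).subset fun l hl i => ?_
  by_contra! hlt
  exact hl.2 (h.mem_powExponents hl.1 hlt.le)

theorem exists_notMem_powExponents (l : σ →₀ ℕ) : ∃ n, l ∉ Λ.powExponents n :=
  ⟨Finsupp.degree l + 1, fun h => by
    have := AddSubmonoid.le_degree_of_mem_powExponents h
    omega⟩

/-- The elements of `Λ` with entries at most `N` generate `Λ`. -/
theorem closure_eq [Finite σ] (h : IsFullSubmonoid Λ N) :
    AddSubmonoid.closure {l | l ∈ Λ ∧ ∀ i, l i ≤ N} = Λ := by
  refine le_antisymm (AddSubmonoid.closure_le.2 fun l hl => hl.1) fun l hl => ?_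
  have hstep : ∀ (n : ℕ) (l : σ →₀ ℕ), Finsupp.degree l ≤ n → l ∈ Λ →
      l ∈ AddSubmonoid.closure {l | l ∈ Λ ∧ ∀ i, l i ≤ N} := by
    intro n
    induction n with
    | zero =>
      intro l hl0 _
      rw [Nat.le_zero, Finsupp.degree_eq_zero_iff] at hl0
      rw [hl0]
      exact zero_mem _
    | succ n ih =>
      intro l hln hl
      by_cases hle : ∀ i, l i ≤ N
      · exact AddSubmonoid.subset_closure ⟨hl, hle⟩
      · push Not at hle
        obtain ⟨i, hi⟩ := hle
        obtain ⟨q, hq, rfl⟩ := h.exists_eq_single_add hl hi.le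
        have := h.pos
        rw [map_add, Finsupp.degree_single] at hln
        refine add_mem (AddSubmonoid.subset_closure ⟨h.single_mem i, fun j => ?_⟩)
          (ih q (by omega) hq)
        classical
        rw [Finsupp.single_apply]
        split_ifs <;> omega
  exact hstep _ l le_rfl hl

end IsFullSubmonoid

end FullSubmonoid

/-! ### Power series with exponents in a submonoid, and the projection onto them -/

section SupportedSeries

variable {σ k : Type*} [Field k]

namespace MvPowerSeries

theorem support_mul_subset {A B C : Set (σ →₀ ℕ)} (hABC : ∀ p ∈ A, ∀ q ∈ B, p + q ∈ C)
    {f g : MvPowerSeries σ k} (hf : ∀ l, coeff l f ≠ 0 → l ∈ A)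
    (hg : ∀ l, coeff l g ≠ 0 → l ∈ B) : ∀ l, coeff l (f * g) ≠ 0 → l ∈ C := by
  classical
  intro l hl
  rw [coeff_mul] at hl
  obtain ⟨⟨p, q⟩, hpq, h0⟩ := Finset.exists_ne_zero_of_sum_ne_zero hl
  rw [Finset.HasAntidiagonal.mem_antidiagonal] at hpq
  rw [← hpq]
  exact hABC _ (hf _ (left_ne_zero_of_mul h0)) _ (hg _ (right_ne_zero_of_mul h0))

variable (k) in
/-- The `k`-algebra of power series with exponents in `Λ`. -/
def supportedIn (Λ : AddSubmonoid (σ →₀ ℕ)) : Subalgebra k (MvPowerSeries σ k) where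
  carrier := {f | ∀ l, coeff l f ≠ 0 → l ∈ Λ}
  mul_mem' hf hg := support_mul_subset (fun _ hp _ hq => Λ.add_mem hp hq) hf hg
  add_mem' {f g} hf hg l hl := by
    by_contra h
    rw [map_add, not_not.1 (mt (hf l) h), not_not.1 (mt (hg l) h), add_zero] at hl
    exact hl rfl
  algebraMap_mem' c l hl := by
    classical
    rw [algebraMap_apply, coeff_C] at hl
    have : l = 0 := by by_contra h; simp [h] at hl
    exact this ▸ Λ.zero_mem

variable {Λ : AddSubmonoid (σ →₀ ℕ)}

theorem monomial_mem_supportedIn {l : σ →₀ ℕ} (hl : l ∈ Λ) (c : k) :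
    monomial l c ∈ supportedIn k Λ := by
  classical
  intro m hm
  rw [coeff_monomial] at hm
  split_ifs at hm with h
  · exact h ▸ hl
  · exact absurd rfl hm

open Classical in
/-- The projection of a power series to its part with exponents in `Λ`. -/
def supportProj (Λ : AddSubmonoid (σ →₀ ℕ)) (f : MvPowerSeries σ k) : MvPowerSeries σ k :=
  fun l => if l ∈ Λ then coeff l f else 0

open Classical in
theorem coeff_supportProj (f : MvPowerSeries σ k) (l : σ →₀ ℕ) :
    coeff l (supportProj Λ f) = if l ∈ Λ then coeff l f else 0 := rfl

theorem supportProj_mem (f : MvPowerSeries σ k) : supportProj Λ f ∈ supportedIn k Λ := by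
  classical
  intro l hl
  rw [coeff_supportProj] at hl
  by_contra h
  exact hl (if_neg h)

theorem supportProj_eq_self {f : MvPowerSeries σ k} (hf : f ∈ supportedIn k Λ) :
    supportProj Λ f = f := by
  classical
  ext l
  rw [coeff_supportProj]
  split_ifs with h
  · rfl
  · exact (not_not.1 (mt (hf l) h)).symm

theorem supportProj_add (f g : MvPowerSeries σ k) :
    supportProj Λ (f + g) = supportProj Λ f + supportProj Λ g := by
  classical
  ext l
  simp only [coeff_supportProj, map_add]
  split_ifs <;> simp

/-- For `q ∈ Λ` one has `p + q ∈ Λ` exactly when `p ∈ Λ`. The projection is thus linear over the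
supported series: it plays the part of a Reynolds operator, with no averaging over a group. -/
theorem supportProj_mul {N : ℕ} (h : IsFullSubmonoid Λ N) (f : MvPowerSeries σ k)
    {g : MvPowerSeries σ k} (hg : g ∈ supportedIn k Λ) :
    supportProj Λ (f * g) = supportProj Λ f * g := by
  classical
  ext l
  have e : ∀ (p : Prop) [Decidable p] (s : Finset ((σ →₀ ℕ) × (σ →₀ ℕ)))
      (F : (σ →₀ ℕ) × (σ →₀ ℕ) → k),
      (if p then ∑ i ∈ s, F i else 0) = ∑ i ∈ s, if p then F i else 0 := by
    intro p _ s F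
    split_ifs <;> simp
  rw [coeff_supportProj, coeff_mul, coeff_mul, e]
  refine Finset.sum_congr rfl fun p hp => ?_
  rw [Finset.HasAntidiagonal.mem_antidiagonal] at hp
  rw [coeff_supportProj]
  by_cases h0 : coeff p.2 g = 0
  · simp [h0]
  · have h2 := hg _ h0
    have : l ∈ Λ ↔ p.1 ∈ Λ := by
      rw [← hp]
      exact ⟨fun hl => h.mem_of_add_mem h2 (by rwa [add_comm]), fun h1 => Λ.add_mem h1 h2⟩
    simp only [this]
    split_ifs <;> simp

end MvPowerSeries

end SupportedSeries

/-! ### Toric charts: completion and contraction of ideals -/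

section ToricChart

open MvPowerSeries

variable {σ k R : Type*} [Field k] [CommRing R] [IsLocalRing R] [Algebra k R]

/-- `R` is a local ring with residue field `k`, embedded in the ring of power series with exponents
in `Λ`, containing the monomials with exponents in `Λ`, and with maximal ideal generated by those
different from `1`. -/
structure IsToricChart (ψ : R →ₐ[k] MvPowerSeries σ k) (Λ : AddSubmonoid (σ →₀ ℕ)) (N : ℕ)
    (w : Λ → R) : Prop where
  full : IsFullSubmonoid Λ N
  injective : Function.Injective ψ
  map_mem : ∀ r, ψ r ∈ supportedIn k Λ
  map_w : ∀ l : Λ, ψ (w l) = monomial (l : σ →₀ ℕ) 1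
  span : maximalIdeal R = Ideal.span (w '' {l | l ≠ 0})
  res : ∀ r : R, ∃ c : k, r - algebraMap k R c ∈ maximalIdeal R

namespace IsToricChart

variable {ψ : R →ₐ[k] MvPowerSeries σ k} {Λ : AddSubmonoid (σ →₀ ℕ)} {N : ℕ} {w : Λ → R}

theorem w_add (h : IsToricChart ψ Λ N w) (p q : Λ) : w (p + q) = w p * w q :=
  h.injective (by rw [map_mul, h.map_w, h.map_w, h.map_w, monomial_mul_monomial, one_mul]; rfl)

theorem w_zero (h : IsToricChart ψ Λ N w) : w 0 = 1 :=
  h.injective (by rw [h.map_w, map_one ψ]; rfl)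

theorem w_mem_maximalIdeal (h : IsToricChart ψ Λ N w) {l : Λ} (hl : l ≠ 0) :
    w l ∈ maximalIdeal R := by
  rw [h.span]
  exact Ideal.subset_span ⟨l, hl, rfl⟩

theorem coeff_add_ne_zero {S : Set (σ →₀ ℕ)} {f g : MvPowerSeries σ k}
    (hf : ∀ l, coeff l f ≠ 0 → l ∈ S) (hg : ∀ l, coeff l g ≠ 0 → l ∈ S) :
    ∀ l, coeff l (f + g) ≠ 0 → l ∈ S := by
  intro l hl
  by_contra h
  rw [map_add, not_not.1 (mt (hf l) h), not_not.1 (mt (hg l) h), add_zero] at hl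
  exact hl rfl

theorem coeff_sub_ne_zero {S : Set (σ →₀ ℕ)} {f g : MvPowerSeries σ k}
    (hf : ∀ l, coeff l f ≠ 0 → l ∈ S) (hg : ∀ l, coeff l g ≠ 0 → l ∈ S) :
    ∀ l, coeff l (f - g) ≠ 0 → l ∈ S := by
  rw [sub_eq_add_neg]
  exact coeff_add_ne_zero hf fun l hl => hg l (by simpa using hl)

theorem mem_powExponents_of_mem_pow (h : IsToricChart ψ Λ N w) {n : ℕ} {r : R}
    (hr : r ∈ maximalIdeal R ^ n) : ∀ l, coeff l (ψ r) ≠ 0 → l ∈ Λ.powExponents n := by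
  classical
  have h1 : ∀ r ∈ maximalIdeal R, ∀ l, coeff l (ψ r) ≠ 0 → l ∈ Λ.powExponents 1 := by
    intro r hr
    rw [h.span] at hr
    induction hr using Submodule.span_induction with
    | mem x hx =>
      obtain ⟨l, hl, rfl⟩ := hx
      intro m hm
      rw [h.map_w, coeff_monomial] at hm
      split_ifs at hm with e
      · exact AddSubmonoid.mem_powExponents_one.2 ⟨e ▸ l.2, fun e' => hl (Subtype.ext
          (e ▸ e'))⟩
      · exact absurd rfl hm
    | zero => simp
    | add x y _ _ hx hy =>
      rw [map_add]
      exact coeff_add_ne_zero hx hy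
    | smul a x _ hx =>
      rw [smul_eq_mul, map_mul]
      exact support_mul_subset (fun p hp q hq => AddSubmonoid.add_mem_powExponents hp hq)
        (h.map_mem a) hx
  induction n generalizing r with
  | zero => exact h.map_mem r
  | succ n ih =>
    rw [pow_succ'] at hr
    induction hr using Submodule.mul_induction_on' with
    | mem_mul_mem x hx y hy =>
      rw [map_mul]
      exact support_mul_subset (fun p hp q hq => AddSubmonoid.add_mem_powExponents_of_one hp hq)
        (h1 x hx) (ih hy)
    | add x _ y _ hx hy =>
      rw [map_add]
      exact coeff_add_ne_zero hx hy

theorem w_mem_pow (h : IsToricChart ψ Λ N w) {n : ℕ} {l : Λ}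
    (hl : (l : σ →₀ ℕ) ∈ Λ.powExponents n) : w l ∈ maximalIdeal R ^ n := by
  induction n generalizing l with
  | zero => simp
  | succ n ih =>
    obtain ⟨p, hp, hp0, q, hq, e⟩ := hl
    have e' : l = ⟨p, hp⟩ + ⟨q, AddSubmonoid.powExponents_subset n hq⟩ := Subtype.ext e
    rw [e', h.w_add, pow_succ']
    refine Ideal.mul_mem_mul (h.w_mem_maximalIdeal fun e0 => hp0 ?_) (ih hq)
    exact congrArg Subtype.val e0

theorem exists_sum_sub_mem_pow (h : IsToricChart ψ Λ N w) (n : ℕ) (r : R) :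
    ∃ c : Λ →₀ k, r - c.sum (fun l a => a • w l) ∈ maximalIdeal R ^ n := by
  obtain ⟨x, hx, hr⟩ := IsLocalRing.exists_mem_adjoin_sub_mem_pow h.span h.res n r
  have hcl : (Submonoid.closure (w '' {l | l ≠ 0}) : Set R) ⊆ Set.range w := by
    intro y hy
    induction hy using Submonoid.closure_induction with
    | mem y hy => exact Set.image_subset_range _ _ hy
    | one => exact ⟨0, h.w_zero⟩
    | mul y z _ _ hy hz =>
      obtain ⟨p, rfl⟩ := hy
      obtain ⟨q, rfl⟩ := hz
      exact ⟨p + q, h.w_add p q⟩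
  rw [← Subalgebra.mem_toSubmodule, Algebra.adjoin_eq_span] at hx
  obtain ⟨c, hc⟩ := Finsupp.mem_span_range_iff_exists_finsupp.1 (Submodule.span_mono hcl hx)
  exact ⟨c, hc ▸ hr⟩

theorem coeff_map_sum (h : IsToricChart ψ Λ N w) (c : Λ →₀ k) (l : Λ) :
    coeff (l : σ →₀ ℕ) (ψ (c.sum fun l a => a • w l)) = c l := by
  classical
  rw [Finsupp.sum, map_sum, map_sum, Finset.sum_eq_single l]
  · rw [map_smul, h.map_w, coeff_smul, coeff_monomial_same, mul_one]
  · intro m _ hm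
    rw [map_smul, h.map_w, coeff_smul, coeff_monomial_ne, mul_zero]
    exact fun e => hm (Subtype.ext e.symm)
  · intro hl
    rw [Finsupp.notMem_support_iff.1 hl, zero_smul, map_zero, map_zero]

/-- Modulo the `n`-th power, `r` is a finite combination of the monomials `w l` whose coefficients
can be read off from the power series. This matches the adic filtration with the one by exponents.
-/
theorem mem_pow_iff (h : IsToricChart ψ Λ N w) {n : ℕ} {r : R} :
    r ∈ maximalIdeal R ^ n ↔ ∀ l, coeff l (ψ r) ≠ 0 → l ∈ Λ.powExponents n := by
  refine ⟨h.mem_powExponents_of_mem_pow, fun hr => ?_⟩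
  obtain ⟨c, hc⟩ := h.exists_sum_sub_mem_pow n r
  have h1 : ∀ l, coeff l (ψ (c.sum fun l a => a • w l)) ≠ 0 → l ∈ Λ.powExponents n := by
    have := coeff_sub_ne_zero hr (h.mem_powExponents_of_mem_pow hc)
    rwa [← map_sub, sub_sub_cancel] at this
  rw [← sub_add_cancel r (c.sum fun l a => a • w l)]
  refine add_mem hc (sum_mem fun l hl => ?_)
  change c l • w l ∈ _
  rw [Algebra.smul_def]
  refine Ideal.mul_mem_left _ _ (h.w_mem_pow (h1 l ?_))
  rw [h.coeff_map_sum]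
  exact Finsupp.mem_support_iff.1 hl

/-- The completion of `R` is the ring of power series with exponents in `Λ`. -/
theorem exists_completion_equiv [Finite σ] (h : IsToricChart ψ Λ N w) :
    ∃ e : AdicCompletion (maximalIdeal R) R ≃ₐ[k] supportedIn k Λ,
      ∀ r, (e (algebraMap R _ r) : MvPowerSeries σ k) = ψ r := by
  let Φ : ℕ → Ideal (supportedIn k Λ) := fun n =>
    { carrier := {f | ∀ l, coeff l (f : MvPowerSeries σ k) ≠ 0 → l ∈ Λ.powExponents n}
      zero_mem' := fun l hl => by simp at hl
      add_mem' := fun hf hg => coeff_add_ne_zero hf hg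
      smul_mem' := fun a f hf => support_mul_subset
        (fun p hp q hq => AddSubmonoid.add_mem_powExponents hp hq) a.2 hf }
  let φ : R →ₐ[k] supportedIn k Λ := ψ.codRestrict _ h.map_mem
  have hφ : IsFilteredCompletion φ Φ := by
    refine isFilteredCompletion_of_support φ (supportedIn k Λ).val Subtype.val_injective Λ
      (fun f => ?_) Λ.powExponents AddSubmonoid.antitone_powExponents
      h.full.finite_diff_powExponents (fun l _ => IsFullSubmonoid.exists_notMem_powExponents l) Φ
      (fun n q => Iff.rfl) fun l hl => ⟨w ⟨l, hl⟩, h.map_w _⟩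
    rw [Subalgebra.range_val]
    rfl
  obtain ⟨e, he, -⟩ := (AdicCompletion.isFilteredCompletion_algebraMap (k := k)
    (maximalIdeal R)).exists_algEquiv hφ fun n r => by
      have : r ∈ maximalIdeal R ^ n ↔ φ r ∈ Φ n := h.mem_pow_iff
      rw [← this]
      exact AdicCompletion.algebraMap_mem_filtration _
  exact ⟨e, fun r => congrArg Subtype.val (he r)⟩

/-- The extension from `R` to the ring of all power series is pure. -/
theorem mem_of_map_mem_map [IsNoetherianRing R] [Finite σ] (h : IsToricChart ψ Λ N w) (I : Ideal R)
    {f : R} (hf : ψ f ∈ I.map ψ) : f ∈ I := by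
  classical
  -- The factor `q` makes the claim stable under multiplication by arbitrary series, as the
  -- induction over the span requires. For a generator `ψ a`, linearity reduces to approximating the
  -- projection of `q` by finitely many monomials.
  have key : ∀ g ∈ I.map ψ, ∀ (q : MvPowerSeries σ k) (n : ℕ), ∃ a ∈ I,
      ∀ l, coeff l (supportProj Λ (q * g) - ψ a) ≠ 0 → l ∈ Λ.powExponents n := by
    intro g hg
    induction hg using Submodule.span_induction with
    | mem g hg =>
      obtain ⟨a, ha, rfl⟩ := hg
      intro q n
      let D := (h.full.finite_diff_powExponents n).toFinset
      let b : R := ∑ l ∈ D.attach, coeff (l : σ →₀ ℕ) q •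
        w ⟨l, ((h.full.finite_diff_powExponents n).mem_toFinset.1 l.2).1⟩
      have hb : ∀ l, coeff l (supportProj Λ q - ψ b) ≠ 0 → l ∈ Λ.powExponents n := by
        intro l hl
        by_contra hln
        refine hl ?_
        have hψb : coeff l (ψ b) = if l ∈ D then coeff l q else 0 := by
          simp only [b, map_sum, map_smul, h.map_w, coeff_monomial]
          rw [Finset.sum_attach D (fun m => coeff m q • if l = m then (1 : k) else 0)]
          simp
        rw [map_sub, hψb, coeff_supportProj]
        have : l ∈ D ↔ l ∈ Λ := by simp [D, hln]
        simp only [this, sub_self]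
      refine ⟨b * a, I.mul_mem_left _ ha, ?_⟩
      have e : supportProj Λ (q * ψ a) - ψ (b * a) = ψ a * (supportProj Λ q - ψ b) := by
        rw [supportProj_mul h.full _ (h.map_mem a), map_mul]
        ring
      change ∀ l, coeff l (supportProj Λ (q * ψ a) - ψ (b * a)) ≠ 0 → _
      rw [e]
      exact support_mul_subset (fun p hp q hq => AddSubmonoid.add_mem_powExponents hp hq)
        (h.map_mem a) hb
    | zero =>
      intro q n
      refine ⟨0, zero_mem _, fun l hl => ?_⟩
      simp [coeff_supportProj] at hl
    | add g g' _ _ hg hg' =>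
      intro q n
      obtain ⟨a, ha, h1⟩ := hg q n
      obtain ⟨a', ha', h2⟩ := hg' q n
      refine ⟨a + a', add_mem ha ha', ?_⟩
      rw [mul_add, supportProj_add, map_add, add_sub_add_comm]
      exact coeff_add_ne_zero h1 h2
    | smul p g _ hg =>
      intro q n
      rw [smul_eq_mul, ← mul_assoc]
      exact hg _ n
  refine Ideal.mem_of_forall_exists_sub_mem_pow I fun n => ?_
  obtain ⟨a, ha, h1⟩ := key _ hf 1 n
  rw [one_mul, supportProj_eq_self (h.map_mem f), ← map_sub] at h1
  exact ⟨a, ha, h.mem_pow_iff.2 h1⟩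

end IsToricChart

end ToricChart

/-! ### The lattice of exponents of two monomials -/

section LatticeSubmonoid

/-- The natural vectors in the subgroup of `ℤ²` generated by `(a, b)` and `(c, d)`. -/
def latticeSubmonoid (a b c d : ℕ) : AddSubmonoid (Fin 2 →₀ ℕ) where
  carrier := {l | ∃ i j : ℤ, (l 0 : ℤ) = i * a + j * c ∧ (l 1 : ℤ) = i * b + j * d}
  zero_mem' := ⟨0, 0, by simp, by simp⟩
  add_mem' := by
    rintro l l' ⟨i, j, h0, h1⟩ ⟨i', j', h0', h1'⟩
    refine ⟨i + i', j + j', ?_, ?_⟩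
    · rw [Finsupp.add_apply, Nat.cast_add, h0, h0']; ring
    · rw [Finsupp.add_apply, Nat.cast_add, h1, h1']; ring

theorem mem_latticeSubmonoid {a b c d : ℕ} {l : Fin 2 →₀ ℕ} :
    l ∈ latticeSubmonoid a b c d ↔
      ∃ i j : ℤ, (l 0 : ℤ) = i * a + j * c ∧ (l 1 : ℤ) = i * b + j * d := Iff.rfl

/-- By Cramer's rule the determinant times each basis vector is an integral combination of `(a, b)`
and `(c, d)`; the sign `ε` passes to its absolute value. -/
theorem isFullSubmonoid_latticeSubmonoid {a b c d : ℕ} (hD : (a * d - b * c : ℤ) ≠ 0) :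
    IsFullSubmonoid (latticeSubmonoid a b c d) (a * d - b * c : ℤ).natAbs where
  pos := Int.natAbs_pos.2 hD
  mem_of_add_mem := by
    rintro p q ⟨i, j, h0, h1⟩ ⟨i', j', h0', h1'⟩
    refine ⟨i' - i, j' - j, ?_, ?_⟩
    · rw [Finsupp.add_apply, Nat.cast_add, h0] at h0'; linarith
    · rw [Finsupp.add_apply, Nat.cast_add, h1] at h1'; linarith
  single_mem := by
    obtain ⟨ε, hε⟩ : ∃ ε : ℤ, ((a * d - b * c : ℤ).natAbs : ℤ) = ε * (a * d - b * c) := by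
      rcases Int.natAbs_eq (a * d - b * c : ℤ) with h | h
      · exact ⟨1, by omega⟩
      · exact ⟨-1, by omega⟩
    intro i
    fin_cases i
    · refine ⟨ε * d, -(ε * b), ?_, ?_⟩
      · simp only [Fin.zero_eta, Finsupp.single_eq_same, hε]; ring
      · simp; ring
    · refine ⟨-(ε * c), ε * a, ?_, ?_⟩
      · simp; ring
      · simp only [Fin.mk_one, Finsupp.single_eq_same, hε]; ring

end LatticeSubmonoid

/-! ### Toric charts on subrings of the function field -/

section ToricChartOfDensity

open MvPowerSeries

variable {k K Γ₀ : Type*} [Field k] [Field K] [Algebra k K] [LinearOrderedCommGroupWithZero Γ₀]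
  {ν : Valuation K Γ₀} {R : Subalgebra k K} [IsLocalRing R] {s : Fin 2 → R}

/-- A subalgebra of `B` that carries the toric chart and equals `B`. -/
theorem IsToricChart.of_eq {σ : Type*} {B C : Subalgebra k K} [IsLocalRing C] (hCB : C = B)
    {ψ : B →ₐ[k] MvPowerSeries σ k} {ψ' : C →ₐ[k] MvPowerSeries σ k}
    {Λ : AddSubmonoid (σ →₀ ℕ)} {N : ℕ} {w : Λ → B} {w' : Λ → C}
    (h : IsToricChart ψ' Λ N w') (hψ : ψ' = ψ.comp (Subalgebra.inclusion hCB.le))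
    (hw : ∀ l, (w' l : K) = w l) : ∃ _ : IsLocalRing B, IsToricChart ψ Λ N w := by
  subst hCB
  obtain rfl : w' = w := funext fun l => Subtype.ext (hw l)
  obtain rfl : ψ' = ψ := hψ
  exact ⟨inferInstance, h⟩

/-- The images in a power series ring of the elements of a monomial chart whose parameters map to
monomials. -/
theorem IsMonomialChart.map_mem_supportedIn (h : IsMonomialChart ν R s)
    {ψ : R →ₐ[k] MvPowerSeries (Fin 2) k}
    (hconst : ∀ r ∈ maximalIdeal R, constantCoeff (ψ r) = 0)
    {Λ : AddSubmonoid (Fin 2 →₀ ℕ)} (hs : ∀ i, ψ (s i) ∈ supportedIn k Λ) (r : R) :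
    ψ r ∈ supportedIn k Λ := by
  have hord : ∀ n, ∀ r ∈ maximalIdeal R ^ n, ψ r ∈ orderFiltration (Fin 2) k n := by
    intro n
    induction n with
    | zero => exact fun r _ => fun l _ => Nat.zero_le _
    | succ n ih =>
      intro r hr
      rw [pow_succ] at hr
      induction hr using Submodule.mul_induction_on' with
      | mem_mul_mem x hx y hy =>
        rw [map_mul]
        refine support_mul_subset (A := {l | n ≤ Finsupp.degree l})
          (B := {l | 1 ≤ Finsupp.degree l}) (C := {l | n + 1 ≤ Finsupp.degree l})
          (fun p hp q hq => ?_) (ih x hx) fun l hl => ?_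
        · simp only [Set.mem_ofPred_eq, map_add] at hp hq ⊢
          omega
        · change 1 ≤ Finsupp.degree l
          by_contra! h0
          obtain rfl : l = 0 := by rw [← Finsupp.degree_eq_zero_iff]; omega
          exact hl (hconst y hy)
      | add x _ y _ hx hy =>
        rw [map_add]
        exact add_mem hx hy
  intro l hl
  by_contra hΛ
  -- Precision `degree l + 1` guarantees that the error has no coefficient at `l`.
  obtain ⟨x, hx, hr⟩ := IsLocalRing.exists_mem_adjoin_sub_mem_pow h.span h.res
    (Finsupp.degree l + 1) r
  have hx' : ψ x ∈ supportedIn k Λ := by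
    have : Algebra.adjoin k (Set.range s) ≤ (supportedIn k Λ).comap ψ := by
      rw [Algebra.adjoin_le_iff]
      rintro _ ⟨i, rfl⟩
      exact hs i
    exact this hx
  have h1 : coeff l (ψ (r - x)) = 0 := by
    by_contra h0
    have := hord _ _ hr l h0
    omega
  rw [map_sub, map_sub, not_not.1 (mt (hx' l) hΛ), sub_zero] at h1
  exact hl h1

/-- A subring `B` of `K` containing a monomial chart, embedded in a power series ring compatibly
with a toric structure, is a toric chart. -/
theorem IsMonomialChart.exists_isToricChart [Algebra.EssFiniteType k R] [IsFractionRing R K]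
    (h : IsMonomialChart ν R s) {B : Subalgebra k K} (hRB : R ≤ B)
    (hB : ∀ b ∈ B, ν b ≤ 1) (hinv : ∀ b ∈ B, ν b = 1 → b⁻¹ ∈ B)
    {ψ : B →ₐ[k] MvPowerSeries (Fin 2) k} (hψ : Function.Injective ψ)
    (hconst : ∀ b : B, ν (b : K) < 1 → constantCoeff (ψ b) = 0)
    {Λ : AddSubmonoid (Fin 2 →₀ ℕ)} {N : ℕ} (hΛ : IsFullSubmonoid Λ N) {w : Λ → B}
    (hw : ∀ l : Λ, ψ (w l) = monomial (l : Fin 2 →₀ ℕ) 1)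
    {p : Fin 2 → Λ} (hp : ∀ i, Subalgebra.inclusion hRB (s i) = w (p i)) :
    Algebra.EssFiniteType k B ∧ ∃ _ : IsLocalRing B, IsToricChart ψ Λ N w := by
  classical
  have hwadd : ∀ p q, w (p + q) = w p * w q := fun p q =>
    hψ (by rw [map_mul, hw, hw, hw, monomial_mul_monomial, one_mul]; rfl)
  have hw0 : w 0 = 1 := hψ (by rw [hw, map_one ψ]; rfl)
  have hwlt : ∀ l, l ≠ 0 → ν (w l : K) < 1 := by
    intro l hl
    -- An element of value one would be invertible in `B`, but a nontrivial monomial has constant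
    -- term zero.
    refine lt_of_le_of_ne (hB _ (w l).2) fun h1 => hl ?_
    have h2 : w l * ⟨_, hinv _ (w l).2 h1⟩ = 1 := by
      refine Subtype.ext (mul_inv_cancel₀ fun h0 => ?_)
      rw [h0, map_zero] at h1
      exact zero_ne_one h1
    have h3 := congrArg (fun b => constantCoeff (ψ b)) h2
    simp only [map_mul, hw, map_one] at h3
    by_contra hl
    have h4 : constantCoeff (monomial (l : Fin 2 →₀ ℕ) (1 : k)) = 0 := by
      classical
      rw [← coeff_zero_eq_constantCoeff_apply, coeff_monomial_ne]
      exact fun e => hl (Subtype.ext e.symm)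
    rw [h4, zero_mul] at h3
    exact zero_ne_one h3
  have hp0 : ∀ i, p i ≠ 0 := by
    intro i h0
    have h1 := h.dom.map_lt_one (h.mem_maximalIdeal i)
    have h2 := congrArg Subtype.val (hp i)
    rw [h0, hw0] at h2
    change ((s i : R) : K) = 1 at h2
    rw [h2, map_one] at h1
    exact lt_irrefl _ h1
  -- the elements of `B` have support in `Λ`
  have hRmem : ∀ r : R, ψ (Subalgebra.inclusion hRB r) ∈ supportedIn k Λ := by
    refine h.map_mem_supportedIn (ψ := ψ.comp (Subalgebra.inclusion hRB)) (fun r hr =>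
      hconst _ (h.dom.map_lt_one hr)) fun i => ?_
    change ψ (Subalgebra.inclusion hRB (s i)) ∈ _
    rw [hp, hw]
    exact monomial_mem_supportedIn (p i).2 1
  have hBdiv : ∀ b : B, ∃ r t : R, t ≠ 0 ∧
      b * Subalgebra.inclusion hRB t = Subalgebra.inclusion hRB r := by
    intro b
    obtain ⟨r, t, ht, e⟩ := IsFractionRing.div_surjective (A := R) (b : K)
    have ht0 : t ≠ 0 := nonZeroDivisors.ne_zero ht
    refine ⟨r, t, ht0, Subtype.ext ?_⟩
    have ht0' : (t : K) ≠ 0 := fun e => ht0 (Subtype.ext e)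
    change (b : K) * t = r
    rw [← e]
    exact div_mul_cancel₀ _ ht0'
  have hBmem : ∀ b : B, ψ b ∈ supportedIn k Λ := by
    intro b
    obtain ⟨r, t, ht0, e⟩ := hBdiv b
    have h1 := congrArg ψ e
    rw [map_mul] at h1
    -- Since `b t = r` with `r`, `t` supported in `Λ`, linearity of the projection shows that `ψ b`
    -- and its projection agree after multiplication by `ψ t`, which can be cancelled.
    have h2 : supportProj Λ (ψ b) * ψ (Subalgebra.inclusion hRB t) =
        ψ b * ψ (Subalgebra.inclusion hRB t) := by
      rw [← supportProj_mul hΛ _ (hRmem t), h1, supportProj_eq_self (hRmem r)]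
    have ht : ψ (Subalgebra.inclusion hRB t) ≠ 0 := by
      rw [Ne, map_eq_zero_iff ψ hψ]
      exact fun e => ht0 (Subalgebra.inclusion_injective hRB (e.trans (map_zero _).symm))
    rw [← mul_right_cancel₀ ht h2]
    exact supportProj_mem _
  -- the local ring generated by `R` and the monomials
  let A : Subalgebra k K := Algebra.adjoin k ((R : Set K) ∪ Set.range fun l => (w l : K))
  have hAB : A ≤ B := by
    refine Algebra.adjoin_le ?_
    rintro x (hx | ⟨l, rfl⟩)
    · exact hRB hx
    · exact (w l).2
  have hA1 : ∀ a ∈ A, ν a ≤ 1 := fun a ha => hB a (hAB ha)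
  let C : Subalgebra k K := centerLocalization ν A
  have hCB : C ≤ B := by
    rintro _ ⟨a, ha, b, hb, h1, rfl⟩
    rw [div_eq_mul_inv]
    exact mul_mem (hAB ha) (hinv b (hAB hb) h1)
  have hloc : IsLocalRing C := isLocalRing_centerLocalization hA1
  have hwA : ∀ l, (w l : K) ∈ A := fun l => Algebra.subset_adjoin (Or.inr ⟨l, rfl⟩)
  have hRA : R ≤ A := fun r hr => Algebra.subset_adjoin (Or.inl hr)
  let Y : Set A := {y | ∃ l, l ≠ 0 ∧ (y : K) = w l}
  have hspan : ∀ a : A, ∃ c : k, a - algebraMap k A c ∈ Ideal.span Y := by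
    refine exists_sub_algebraMap_mem_span_of_adjoin Y ?_
    rintro ⟨g, hgA⟩ (hg | ⟨l, hl⟩)
    · obtain ⟨c, hc⟩ := h.res ⟨g, hg⟩
      obtain ⟨α, β, hαβ⟩ := h.exists_eq_add_of_mem hc
      refine ⟨c, ?_⟩
      have hs : ∀ i, Subalgebra.inclusion hRA (s i) ∈ Ideal.span Y := fun i =>
        Ideal.subset_span ⟨p i, hp0 i, congrArg Subtype.val (hp i)⟩
      have e : (⟨g, hgA⟩ : A) - algebraMap k A c =
          Subalgebra.inclusion hRA α * Subalgebra.inclusion hRA (s 0) +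
            Subalgebra.inclusion hRA β * Subalgebra.inclusion hRA (s 1) := by
        rw [← map_mul, ← map_mul, ← map_add, ← hαβ, map_sub, AlgHom.commutes]
        rfl
      rw [e]
      exact add_mem (Ideal.mul_mem_left _ _ (hs 0)) (Ideal.mul_mem_left _ _ (hs 1))
    · by_cases hl0 : l = 0
      · refine ⟨1, ?_⟩
        have e : (⟨g, hgA⟩ : A) = 1 := Subtype.ext (by
          rw [hl0] at hl
          exact hl.symm.trans (congrArg Subtype.val hw0))
        rw [e, map_one, sub_self]
        exact zero_mem _
      · refine ⟨0, ?_⟩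
        rw [map_zero, sub_zero]
        exact Ideal.subset_span ⟨l, hl0, hl.symm⟩
  obtain ⟨hmax, hres⟩ := maximalIdeal_centerLocalization (μ := ν) hA1
    (fun c hc => h.dom.map_algebraMap hc) Y (by rintro y ⟨l, hl, e⟩; rw [e]; exact hwlt l hl) hspan
  let w' : Λ → C := fun l => ⟨w l, le_centerLocalization (hwA l)⟩
  have hC : IsToricChart (ψ.comp (Subalgebra.inclusion hCB)) Λ N w' :=
    { full := hΛ
      injective := hψ.comp (Subalgebra.inclusion_injective hCB)
      map_mem := fun r => hBmem _
      map_w := hw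
      span := by
        rw [hmax]
        congr 1
        ext y
        constructor
        · rintro ⟨y, ⟨l, hl, e⟩, rfl⟩
          exact ⟨l, hl, Subtype.ext e.symm⟩
        · rintro ⟨l, hl, rfl⟩
          exact ⟨⟨w l, hwA l⟩, ⟨l, hl, rfl⟩, rfl⟩
      res := hres }
  -- essential finiteness
  have hG : {l | l ∈ Λ ∧ ∀ i, l i ≤ N}.Finite :=
    (IsFullSubmonoid.finite_setOf_le N).subset fun l hl => hl.2
  let G : Set K := (fun l => if hl : l ∈ Λ then (w ⟨l, hl⟩ : K) else 0) ''
    {l | l ∈ Λ ∧ ∀ i, l i ≤ N}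
  -- The vectors in `Λ` with entries at most `N` generate `Λ`, so finitely many monomials suffice.
  have hAG : A = Algebra.adjoin k ((R : Set K) ∪ G) := by
    refine le_antisymm (Algebra.adjoin_le ?_) (Algebra.adjoin_le ?_)
    · rintro x (hx | ⟨l, rfl⟩)
      · exact Algebra.subset_adjoin (Or.inl hx)
      · have : ∀ l (hl : l ∈ AddSubmonoid.closure {l | l ∈ Λ ∧ ∀ i, l i ≤ N}) (hl' : l ∈ Λ),
            (w ⟨l, hl'⟩ : K) ∈ Algebra.adjoin k ((R : Set K) ∪ G) := by
          intro l hl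
          induction hl using AddSubmonoid.closure_induction with
          | mem x hx =>
            intro hl'
            exact Algebra.subset_adjoin (Or.inr ⟨x, hx, dif_pos hl'⟩)
          | zero =>
            intro hl'
            have : w ⟨0, hl'⟩ = 1 := hw0
            rw [this]
            exact one_mem _
          | add x y hx hy h1 h2 =>
            intro hl'
            rw [hΛ.closure_eq] at hx hy
            have : w ⟨x + y, hl'⟩ = w ⟨x, hx⟩ * w ⟨y, hy⟩ := hwadd ⟨x, hx⟩ ⟨y, hy⟩
            rw [this]
            exact mul_mem (h1 hx) (h2 hy)
        exact this l (by rw [hΛ.closure_eq]; exact l.2) l.2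
    · rintro x (hx | ⟨l, hl, rfl⟩)
      · exact hRA hx
      · simp only [dif_pos hl.1]
        exact hwA _
  have hess : Algebra.EssFiniteType k C := by
    have := essFiniteType_centerLocalization_adjoin_union h.dom G (hG.image _)
      (by rw [← hAG]; exact hA1)
    rwa [← hAG] at this
  have hnoeth : IsNoetherianRing C := Algebra.EssFiniteType.isNoetherianRing k C
  -- purity gives `B ≤ C`
  have hBC : C = B := by
    refine le_antisymm hCB fun b hb => ?_
    obtain ⟨r, t, ht0, e⟩ := hBdiv ⟨b, hb⟩
    have hRC : R ≤ C := hRA.trans le_centerLocalization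
    have hmem : Subalgebra.inclusion hRC r ∈ Ideal.span {Subalgebra.inclusion hRC t} := by
      refine hC.mem_of_map_mem_map _ ?_
      have h1 := congrArg ψ e
      rw [map_mul] at h1
      change ψ (Subalgebra.inclusion hRB r) ∈ _
      rw [← h1]
      exact Ideal.mul_mem_left _ _ (Ideal.mem_map_of_mem _ (Ideal.mem_span_singleton_self _))
    obtain ⟨y, hy⟩ := Ideal.mem_span_singleton.1 hmem
    have hy' : (r : K) = t * y := congrArg Subtype.val hy
    have e' : b * t = r := congrArg Subtype.val e
    have ht0' : (t : K) ≠ 0 := fun e => ht0 (Subtype.ext e)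
    have : b = y := mul_right_cancel₀ ht0' (by rw [e', hy', mul_comm])
    rw [this]
    exact y.2
  refine ⟨?_, hC.of_eq hBC rfl fun l => rfl⟩
  rw [← hBC]
  exact hess

end ToricChartOfDensity

/-! ### Diagonal group actions and their invariants -/

section DiagonalAction

open MvPowerSeries

variable (σ k : Type*) [Field k]

/-- The action of a torus on the ring of power series by rescaling the variables. -/
def torusAction : (σ → kˣ) →* (MvPowerSeries σ k ≃ₐ[k] MvPowerSeries σ k) :=
  (AlgEquiv.algHomUnitsEquiv k (MvPowerSeries σ k)).toMonoidHom.comp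
    (MonoidHom.toHomUnits
      { toFun := fun t => rescaleAlgHom fun i => (t i : k)
        map_one' := rescaleAlgHom_one
        map_mul' := fun s t => by
          rw [mul_comm]
          exact rescaleAlgHom_mul _ _ })

variable {σ k}

theorem coeff_torusAction [Fintype σ] (t : σ → kˣ) (f : MvPowerSeries σ k) (l : σ →₀ ℕ) :
    coeff l (torusAction σ k t f) = ((∏ i, t i ^ l i : kˣ) : k) * coeff l f := by
  have h : torusAction σ k t f = rescaleAlgHom (fun i => (t i : k)) f := rfl
  rw [h, rescaleAlgHom_apply, coeff_rescale, Finsupp.prod_fintype _ _ fun i => pow_zero _]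
  push_cast
  rfl

theorem torusAction_X [Fintype σ] (t : σ → kˣ) (i : σ) :
    torusAction σ k t (X i) = algebraMap k (MvPowerSeries σ k) (t i) * X i := by
  classical
  ext l
  rw [coeff_torusAction, ← Algebra.smul_def, coeff_smul, coeff_X]
  split_ifs with h
  · rw [h, Finset.prod_eq_single i]
    · simp
    · intro j _ hj
      rw [Finsupp.single_eq_of_ne hj, pow_zero]
    · simp
  · simp

/-- A finite abelian group of order prime to the characteristic, generated by `deg i`, acts on the
ring of power series with the power series of degree `1` as invariants. -/
theorem exists_diagonal_action [IsAlgClosed k] [Fintype σ] {G : Type*} [CommGroup G] {N : ℕ}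
    (hN : (N : k) ≠ 0) (hG : ∀ g : G, g ^ N = 1) (deg : σ → G)
    (hgen : Subgroup.closure (Set.range deg) = ⊤) (Λ : AddSubmonoid (σ →₀ ℕ))
    (hΛ : ∀ l, l ∈ Λ ↔ ∏ i, deg i ^ l i = 1) :
    ∃ ρ : G →* (MvPowerSeries σ k ≃ₐ[k] MvPowerSeries σ k), Function.Injective ρ ∧
      (∀ g, ∃ ζ : σ → k, (∀ i, IsOfFinOrder (ζ i)) ∧
        ∀ i, ρ g (X i) = algebraMap k (MvPowerSeries σ k) (ζ i) * X i) ∧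
      ∀ f, (∀ g, ρ g f = f) ↔ f ∈ supportedIn k Λ := by
  have hN0 : 0 < N := by
    rcases Nat.eq_zero_or_pos N with rfl | h
    · simp at hN
    · exact h
  have hfg : Group.FG G := by
    rw [Group.fg_iff]
    exact ⟨_, hgen, Set.finite_range deg⟩
  have hfin : Finite G := CommGroup.finite_of_fg_isMulTorsion G fun g =>
    isOfFinOrder_iff_pow_eq_one.2 ⟨N, hN0, hG g⟩
  have hexp : NeZero ((Monoid.exponent G : ℕ) : k) := ⟨fun h0 => hN (by
    obtain ⟨m, hm⟩ := Monoid.exponent_dvd_of_forall_pow_eq_one hG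
    rw [hm, Nat.cast_mul, h0, zero_mul])⟩
  have hroots : HasEnoughRootsOfUnity k (Monoid.exponent G) :=
    IsSepClosed.hasEnoughRootsOfUnity k _
  -- What acts naturally is the character group, with `χ` multiplying the `i`-th variable by `χ (deg
  -- i)`. A noncanonical isomorphism with `G` turns this into an action of `G`.
  obtain ⟨e⟩ := CommGroup.monoidHom_mulEquiv_of_hasEnoughRootsOfUnity G k
  let τ : (G →* kˣ) →* (σ → kˣ) :=
    { toFun := fun χ i => χ (deg i)
      map_one' := rfl
      map_mul' := fun _ _ => rfl }
  have hcoeff : ∀ (χ : G →* kˣ) (f : MvPowerSeries σ k) (l : σ →₀ ℕ),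
      coeff l (torusAction σ k (τ χ) f) = (χ (∏ i, deg i ^ l i) : k) * coeff l f := by
    intro χ f l
    rw [coeff_torusAction, map_prod]
    simp only [map_pow]
    rfl
  refine ⟨(torusAction σ k).comp (τ.comp e.symm.toMonoidHom), ?_, fun g => ?_, fun f => ?_⟩
  · rw [injective_iff_map_eq_one]
    intro g hg
    rw [← map_eq_one_iff e.symm e.symm.injective]
    have h : ∀ i, e.symm g (deg i) = 1 := by
      intro i
      have h1 := congrArg (fun a => coeff (Finsupp.single i 1) (a (X i))) hg
      change coeff _ (torusAction σ k (τ (e.symm g)) (X i)) = coeff _ (X i) at h1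
      classical
      rw [torusAction_X, ← Algebra.smul_def, coeff_smul, coeff_X, if_pos rfl, mul_one] at h1
      exact Units.ext h1
    refine MonoidHom.eq_of_eqOn_dense hgen ?_
    rintro _ ⟨i, rfl⟩
    exact h i
  · refine ⟨fun i => (e.symm g (deg i) : kˣ), fun i => ?_, fun i => torusAction_X _ i⟩
    refine isOfFinOrder_iff_pow_eq_one.2 ⟨N, hN0, ?_⟩
    rw [← Units.val_pow_eq_pow_val, ← map_pow, hG, map_one, Units.val_one]
  · constructor
    · intro hf l hl
      rw [hΛ]
      by_contra hne
      -- Characters separate elements, so a monomial fixed by all of them has degree one.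
      obtain ⟨χ, hχ⟩ := CommGroup.exists_apply_ne_one_of_hasEnoughRootsOfUnity G k hne
      have h1 := congrArg (coeff l) (hf (e χ))
      change coeff l (torusAction σ k (τ (e.symm (e χ))) f) = _ at h1
      rw [e.symm_apply_apply, hcoeff] at h1
      exact hχ (Units.ext (mul_eq_right₀ hl |>.1 h1))
    · intro hf g
      ext l
      change coeff l (torusAction σ k (τ (e.symm g)) f) = _
      rw [hcoeff]
      by_cases h0 : coeff l f = 0
      · rw [h0, mul_zero]
      · rw [(hΛ l).1 (hf l h0), map_one, Units.val_one, one_mul]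

end DiagonalAction

/-! ### The quotient of value groups as the grading group -/

section ValueGroupQuotient

theorem zpow_monomial_mul_zpow_monomial {Γ : Type*} [CommGroupWithZero Γ] {X Y : Γ} (hX : X ≠ 0)
    (hY : Y ≠ 0) (a b c d : ℕ) (m n : ℤ) :
    (X ^ a * Y ^ b) ^ m * (X ^ c * Y ^ d) ^ n = X ^ (m * a + n * c) * Y ^ (m * b + n * d) := by
  rw [mul_zpow, mul_zpow, zpow_add₀ hX, zpow_add₀ hY, mul_mul_mul_comm, mul_comm m, mul_comm m,
    mul_comm n, mul_comm n, zpow_mul, zpow_mul, zpow_mul, zpow_mul, zpow_natCast, zpow_natCast,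
    zpow_natCast, zpow_natCast]

variable {E F Γ₀ : Type*} [Field E] [Field F] [LinearOrderedCommGroupWithZero Γ₀]
  {μ : Valuation E Γ₀} {ν : Valuation F Γ₀}

theorem RatIndep.zpow_mul_zpow_injective {x y : E} (h : RatIndep μ x y) {m n m' n' : ℤ}
    (e : μ x ^ m * μ y ^ n = μ x ^ m' * μ y ^ n') : m = m' ∧ n = n' := by
  obtain ⟨hx, hy, h⟩ := h
  have hx' : μ x ≠ 0 := (Valuation.ne_zero_iff _).2 hx
  have hy' : μ y ≠ 0 := (Valuation.ne_zero_iff _).2 hy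
  have := h (m - m') (n - n') (by
    rw [zpow_sub₀ hx', zpow_sub₀ hy', div_mul_div_comm, e,
      div_self (mul_ne_zero (zpow_ne_zero _ hx') (zpow_ne_zero _ hy'))])
  omega

/-- The quotient of the lattice of values of monomials by the sublattice generated by the values of
two monomials. -/
theorem exists_generators_valGroupQuotient {z : Fin 2 → E} {u v : F}
    (hz : RatIndep μ (z 0) (z 1)) (hμ : ValGroupGeneratedBy μ (z 0) (z 1))
    (hν : ValGroupGeneratedBy ν u v) {a b c d : ℕ}
    (hu : ν u = μ (z 0) ^ a * μ (z 1) ^ b) (hv : ν v = μ (z 0) ^ c * μ (z 1) ^ d) :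
    ∃ deg : Fin 2 → ValGroupQuotient μ ν, Subgroup.closure (Set.range deg) = ⊤ ∧
      ∀ l, l ∈ latticeSubmonoid a b c d ↔ ∏ i, deg i ^ l i = 1 := by
  have h0 : ∀ i, μ (z i) ≠ 0 := by
    intro i
    rw [Valuation.ne_zero_iff]
    fin_cases i
    · exact hz.1
    · exact hz.2.1
  have hmem : ∀ i, Units.mk0 _ (h0 i) ∈ valGroup μ := by
    intro i
    have : Units.mk0 _ (h0 i) ∈ (valGroup μ : Set Γ₀ˣ) := by
      rw [hμ]
      fin_cases i
      · exact ⟨1, 0, by simp⟩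
      · exact ⟨0, 1, by simp⟩
    exact this
  let g : Fin 2 → valGroup μ := fun i => ⟨_, hmem i⟩
  have hg : ∀ i, ((g i : Γ₀ˣ) : Γ₀) = μ (z i) := fun i => rfl
  refine ⟨fun i => QuotientGroup.mk (g i), ?_, fun l => ?_⟩
  · rw [eq_top_iff]
    rintro x -
    obtain ⟨γ, rfl⟩ := QuotientGroup.mk_surjective x
    have h1 : (γ : Γ₀ˣ) ∈ (valGroup μ : Set Γ₀ˣ) := γ.2
    rw [hμ] at h1
    obtain ⟨m, n, e⟩ := h1
    have e' : γ = g 0 ^ m * g 1 ^ n := by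
      refine Subtype.ext (Units.ext ?_)
      rw [e]
      push_cast
      rfl
    rw [e', QuotientGroup.mk_mul, QuotientGroup.mk_zpow, QuotientGroup.mk_zpow]
    have hi : ∀ i, (QuotientGroup.mk (g i) : ValGroupQuotient μ ν) ∈
        Subgroup.closure (Set.range fun i => (QuotientGroup.mk (g i) : ValGroupQuotient μ ν)) :=
      fun i => Subgroup.subset_closure (Set.mem_range_self i)
    exact mul_mem (zpow_mem (hi 0) _) (zpow_mem (hi 1) _)
  · have e1 : ∏ i, (QuotientGroup.mk (g i) : ValGroupQuotient μ ν) ^ l i =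
        QuotientGroup.mk (g 0 ^ l 0 * g 1 ^ l 1) := by
      rw [Fin.prod_univ_two]
      rfl
    have e2 : ((g 0 ^ l 0 * g 1 ^ l 1 : valGroup μ) : Γ₀ˣ) ∈ valGroup ν ↔
        ∃ m n : ℤ, μ (z 0) ^ (l 0 : ℤ) * μ (z 1) ^ (l 1 : ℤ) = ν u ^ m * ν v ^ n := by
      rw [← SetLike.mem_coe, hν]
      simp only [Set.mem_ofPred_eq]
      push_cast
      simp only [hg, zpow_natCast]
    have e3 : ∀ m n : ℤ, ν u ^ m * ν v ^ n =
        μ (z 0) ^ (m * a + n * c) * μ (z 1) ^ (m * b + n * d) := by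
      intro m n
      rw [hu, hv, zpow_monomial_mul_zpow_monomial (h0 0) (h0 1)]
    rw [e1, QuotientGroup.eq_one_iff, Subgroup.mem_subgroupOf, e2, mem_latticeSubmonoid]
    refine exists_congr fun m => exists_congr fun n => ?_
    rw [e3]
    exact ⟨fun h => by rw [h.1, h.2], fun h => hz.zpow_mul_zpow_injective h⟩

/-- Membership of `N eᵢ` in `Λ` says that `deg i ^ N = 1`, and the `deg i` generate. -/
theorem pow_eq_one_of_isFullSubmonoid {σ G : Type*} [Fintype σ] [CommGroup G] {deg : σ → G}
    (hgen : Subgroup.closure (Set.range deg) = ⊤) {Λ : AddSubmonoid (σ →₀ ℕ)} {N : ℕ}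
    (hΛ : IsFullSubmonoid Λ N) (h : ∀ l, l ∈ Λ ↔ ∏ i, deg i ^ l i = 1) (g : G) : g ^ N = 1 := by
  classical
  have hg : g ∈ Subgroup.closure (Set.range deg) := hgen ▸ Subgroup.mem_top g
  induction hg using Subgroup.closure_induction with
  | mem x hx =>
    obtain ⟨i, rfl⟩ := hx
    have h1 := (h _).1 (hΛ.single_mem i)
    rwa [Finset.prod_eq_single i (fun j _ hj => by rw [Finsupp.single_eq_of_ne hj, pow_zero])
      (by simp), Finsupp.single_eq_same] at h1
  | one => exact one_pow _
  | mul x y _ _ hx hy => rw [mul_pow, hx, hy, one_mul]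
  | inv x _ hx => rw [inv_pow, hx, inv_one]

end ValueGroupQuotient

/-! ### The intersection of a monomial chart with the subfield -/

section Comap

open MvPowerSeries

variable {k K L Γ₀ : Type*} [Field k] [Field K] [Field L] [Algebra k K] [Algebra k L]
  [Algebra K L] [IsScalarTower k K L] [LinearOrderedCommGroupWithZero Γ₀]

/-- The intersection of a subring of `L` with the subfield `K`. -/
abbrev fieldComap (K : Type*) [Field K] [Algebra k K] [Algebra K L] [IsScalarTower k K L]
    (T : Subalgebra k L) : Subalgebra k K :=
  T.comap (IsScalarTower.toAlgHom k K L)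

/-- The inclusion of `T ∩ K` in `T`. -/
def fieldComapHom (K : Type*) [Field K] [Algebra k K] [Algebra K L] [IsScalarTower k K L]
    (T : Subalgebra k L) : fieldComap K T →ₐ[k] T :=
  ((IsScalarTower.toAlgHom k K L).comp (fieldComap K T).val).codRestrict T fun b => b.2

theorem fieldComapHom_injective (T : Subalgebra k L) :
    Function.Injective (fieldComapHom K T) := fun _ _ hxy =>
  Subtype.ext ((algebraMap K L).injective (congrArg Subtype.val hxy))

theorem X_pow_mul_X_pow (a b : ℕ) :
    (X 0 ^ a * X 1 ^ b : MvPowerSeries (Fin 2) k) =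
      monomial (Finsupp.single 0 a + Finsupp.single 1 b) 1 := by
  rw [X_pow_eq, X_pow_eq, monomial_mul_monomial, one_mul]

/-- The intersection with `K` of a monomial chart of `L` is a toric chart, if the parameters of a
monomial chart of `K` are monomials in it with a determinant that is prime to the characteristic. -/
theorem IsMonomialChart.exists_isToricChart_fieldComap [IsAlgClosed k] {μ : Valuation L Γ₀}
    {ν : Valuation K Γ₀} (hext : μ.comap (algebraMap K L) = ν) {T : Subalgebra k L}
    [IsLocalRing T] [IsNoetherianRing T] {z : Fin 2 → T} (h : IsMonomialChart μ T z)
    {R : Subalgebra k K} [IsLocalRing R] [Algebra.EssFiniteType k R] [IsFractionRing R K]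
    {s : Fin 2 → R} (hR : IsMonomialChart ν R s) (hRT : R ≤ fieldComap K T)
    {a b c d : ℕ} (hD : ((a * d - b * c : ℤ) : k) ≠ 0) {δ₁ δ₂ : Tˣ}
    (hs0 : algebraMap K L (s 0) = ((z 0 ^ a * z 1 ^ b * δ₁ : T) : L))
    (hs1 : algebraMap K L (s 1) = ((z 0 ^ c * z 1 ^ d * δ₂ : T) : L)) :
    ∃ e : MvPowerSeries (Fin 2) k ≃ₐ[k] Completion T,
      (∀ i, Associated (e (X i)) (algebraMap T (Completion T) (z i))) ∧
      ∃ ψ : fieldComap K T →ₐ[k] MvPowerSeries (Fin 2) k,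
        (∀ r, e (ψ r) = algebraMap T (Completion T) (fieldComapHom K T r)) ∧
        Algebra.EssFiniteType k (fieldComap K T) ∧
        ∃ (_ : IsLocalRing (fieldComap K T)) (w : latticeSubmonoid a b c d → fieldComap K T),
          IsToricChart ψ (latticeSubmonoid a b c d) (a * d - b * c : ℤ).natAbs w ∧
          ∀ l : latticeSubmonoid a b c d,
            Associated (z 0 ^ (l : Fin 2 →₀ ℕ) 0 * z 1 ^ (l : Fin 2 →₀ ℕ) 1)
              (fieldComapHom K T (w l)) := by
  have hD0 : (a * d - b * c : ℤ) ≠ 0 := by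
    intro h0
    rw [h0, Int.cast_zero] at hD
    exact hD rfl
  -- In the adjusted parameters `z'` of the completion, `s 0` and `s 1` are monomials without unit
  -- factors, so `ψ` carries them to monomials of the power series ring.
  obtain ⟨z', hz', hz0, hz1⟩ := h.exists_completion_parameters hD δ₁ δ₂
  obtain ⟨e, heX, hefil⟩ := h.exists_powerSeries_equiv hz'
  let ψ : fieldComap K T →ₐ[k] MvPowerSeries (Fin 2) k :=
    (e.symm : Completion T →ₐ[k] _).comp
      ((IsScalarTower.toAlgHom k T (Completion T)).comp (fieldComapHom K T))
  have heψ : ∀ r, e (ψ r) = algebraMap T (Completion T) (fieldComapHom K T r) := fun r =>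
    e.apply_symm_apply _
  have hTinj : Function.Injective (algebraMap T (Completion T)) := by
    rw [injective_iff_map_eq_zero]
    intro t ht
    refine (IsHausdorff.haus (I := maximalIdeal T) inferInstance t fun n => ?_)
    rw [SModEq.zero, smul_eq_mul, Ideal.mul_top, ← AdicCompletion.algebraMap_mem_filtration, ht]
    exact zero_mem _
  have hψ : Function.Injective ψ :=
    e.symm.injective.comp (hTinj.comp (fieldComapHom_injective T))
  have hνμ : ∀ r : fieldComap K T, ν (r : K) = μ (fieldComapHom K T r : L) := by
    intro r
    rw [← hext]
    rfl
  have hconst : ∀ r : fieldComap K T, ν (r : K) < 1 → constantCoeff (ψ r) = 0 := by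
    intro r hr
    rw [hνμ] at hr
    have h1 : e (ψ r) ∈ AdicCompletion.filtration (maximalIdeal T) 1 := by
      rw [heψ, AdicCompletion.algebraMap_mem_filtration, pow_one]
      exact h.dom.mem_maximalIdeal hr
    rw [hefil] at h1
    by_contra h0
    have := h1 0 h0
    simp at this
  have hB : ∀ b ∈ fieldComap K T, ν b ≤ 1 := by
    intro b hb
    rw [hνμ ⟨b, hb⟩]
    exact (h.dom _).1
  have hinv : ∀ b ∈ fieldComap K T, ν b = 1 → b⁻¹ ∈ fieldComap K T := by
    intro b hb h1
    rw [hνμ ⟨b, hb⟩] at h1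
    have hu : IsUnit (fieldComapHom K T ⟨b, hb⟩) := by
      by_contra hu
      exact absurd (h.dom.map_lt_one ((IsLocalRing.mem_maximalIdeal _).2 hu)) (by rw [h1]; simp)
    obtain ⟨t, ht⟩ := hu.exists_right_inv
    have ht' : algebraMap K L b * t = 1 := congrArg Subtype.val ht
    change algebraMap K L b⁻¹ ∈ T
    rw [map_inv₀, ← eq_inv_of_mul_eq_one_right ht']
    exact t.2
  let x : Fin 2 → fieldComap K T := fun i => Subalgebra.inclusion hRT (s i)
  let p : Fin 2 →₀ ℕ := Finsupp.single 0 a + Finsupp.single 1 b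
  let q : Fin 2 →₀ ℕ := Finsupp.single 0 c + Finsupp.single 1 d
  have hx0 : ψ (x 0) = monomial p 1 := by
    refine e.injective ?_
    have : fieldComapHom K T (x 0) = z 0 ^ a * z 1 ^ b * δ₁ := Subtype.ext hs0
    rw [heψ, this, hz0, ← X_pow_mul_X_pow, map_mul, map_pow, map_pow, heX, heX]
  have hx1 : ψ (x 1) = monomial q 1 := by
    refine e.injective ?_
    have : fieldComapHom K T (x 1) = z 0 ^ c * z 1 ^ d * δ₂ := Subtype.ext hs1
    rw [heψ, this, hz1, ← X_pow_mul_X_pow, map_mul, map_pow, map_pow, heX, heX]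
  -- If `l = i (a, b) + j (c, d)`, then `s₀ ^ i s₁ ^ j` is `z ^ l` times a unit of `T`. It therefore
  -- lies in `T ∩ K` even when `i` or `j` is negative.
  have hw : ∀ l : latticeSubmonoid a b c d, ∃ r : fieldComap K T,
      ψ r = monomial (l : Fin 2 →₀ ℕ) 1 ∧
      Associated (z 0 ^ (l : Fin 2 →₀ ℕ) 0 * z 1 ^ (l : Fin 2 →₀ ℕ) 1) (fieldComapHom K T r) := by
    rintro ⟨l, i, j, hl0, hl1⟩
    have hs00 : algebraMap K L (s 0) ≠ 0 := by simpa using hR.ind.1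
    have hs10 : algebraMap K L (s 1) ≠ 0 := by simpa using hR.ind.2.1
    have hmem : algebraMap K L ((s 0 : K) ^ i * (s 1 : K) ^ j) =
        ((z 0 ^ l 0 * z 1 ^ l 1 * (δ₁ ^ i * δ₂ ^ j : Tˣ) : T) : L) := by
      have hδ : ∀ (δ : Tˣ) (n : ℤ), (((δ ^ n : Tˣ) : T) : L) = ((δ : T) : L) ^ n := by
        intro δ n
        have := congrArg Units.val (map_zpow (Units.map (T.val : T →* L)) δ n)
        rw [Units.val_zpow_eq_zpow_val] at this
        exact this
      rw [map_mul, map_zpow₀, map_zpow₀, hs0, hs1]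
      push_cast
      rw [hδ, hδ, mul_zpow, mul_zpow, mul_zpow, mul_zpow, ← zpow_natCast (z 0 : L) (l 0),
        ← zpow_natCast (z 1 : L) (l 1), hl0, hl1, zpow_add₀ (h.coe_ne_zero 0),
        zpow_add₀ (h.coe_ne_zero 1), ← zpow_natCast (z 0 : L), ← zpow_natCast (z 0 : L),
        ← zpow_natCast (z 1 : L), ← zpow_natCast (z 1 : L), ← zpow_mul, ← zpow_mul, ← zpow_mul,
        ← zpow_mul, mul_comm (a : ℤ), mul_comm (b : ℤ), mul_comm (c : ℤ), mul_comm (d : ℤ)]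
      ring
    let r : fieldComap K T := ⟨(s 0 : K) ^ i * (s 1 : K) ^ j, by
      change algebraMap K L _ ∈ T
      rw [hmem]
      exact SetLike.coe_mem _⟩
    have hass : Associated (z 0 ^ l 0 * z 1 ^ l 1) (fieldComapHom K T r) :=
      ⟨δ₁ ^ i * δ₂ ^ j, Subtype.ext hmem.symm⟩
    -- Variables are not invertible in the power series ring, so negative exponents are moved to the
    -- other side before applying `ψ`.
    obtain ⟨i₁, i₂, rfl⟩ : ∃ i₁ i₂ : ℕ, i = i₁ - i₂ := ⟨i.toNat, (-i).toNat, by omega⟩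
    obtain ⟨j₁, j₂, rfl⟩ : ∃ j₁ j₂ : ℕ, j = j₁ - j₂ := ⟨j.toNat, (-j).toNat, by omega⟩
    have hr : r * (x 0 ^ i₂ * x 1 ^ j₂) = x 0 ^ i₁ * x 1 ^ j₁ := by
      refine Subtype.ext ?_
      change (s 0 : K) ^ (i₁ - i₂ : ℤ) * (s 1 : K) ^ (j₁ - j₂ : ℤ) *
        ((s 0 : K) ^ i₂ * (s 1 : K) ^ j₂) = (s 0 : K) ^ i₁ * (s 1 : K) ^ j₁
      rw [zpow_sub₀ hR.ind.1, zpow_sub₀ hR.ind.2.1, zpow_natCast, zpow_natCast, zpow_natCast,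
        zpow_natCast]
      have h1 : (s 0 : K) ^ i₂ ≠ 0 := pow_ne_zero _ hR.ind.1
      have h2 : (s 1 : K) ^ j₂ ≠ 0 := pow_ne_zero _ hR.ind.2.1
      field_simp
    have hψr := congrArg ψ hr
    have hmon : ∀ m n : ℕ, ψ (x 0 ^ m * x 1 ^ n) = monomial (m • p + n • q) 1 := by
      intro m n
      rw [map_mul, map_pow, map_pow, hx0, hx1, monomial_pow, monomial_pow,
        monomial_mul_monomial, one_pow, one_pow, one_mul]
    rw [map_mul, hmon, hmon] at hψr
    have hl : l + (i₂ • p + j₂ • q) = i₁ • p + j₁ • q := by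
      ext t
      fin_cases t
      · simp [p, q]
        zify
        rw [hl0]
        ring
      · simp [p, q]
        zify
        rw [hl1]
        ring
    have hmul : (monomial l (1 : k)) * monomial (i₂ • p + j₂ • q) 1 =
        monomial (i₁ • p + j₁ • q) 1 := by
      rw [monomial_mul_monomial, hl, one_mul]
    refine ⟨r, mul_right_cancel₀ (b := monomial (i₂ • p + j₂ • q) (1 : k)) ?_
      (hψr.trans hmul.symm), hass⟩
    intro h0
    have := congrArg (coeff (i₂ • p + j₂ • q)) h0
    rw [coeff_monomial_same, map_zero] at this
    exact one_ne_zero this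
  choose w hw hwass using hw
  have hp : p ∈ latticeSubmonoid a b c d := ⟨1, 0, by simp [p], by simp [p]⟩
  have hq : q ∈ latticeSubmonoid a b c d := ⟨0, 1, by simp [q], by simp [q]⟩
  obtain ⟨hess, hloc, hchart⟩ := hR.exists_isToricChart hRT hB hinv hψ hconst
    (isFullSubmonoid_latticeSubmonoid hD0) hw (p := ![⟨p, hp⟩, ⟨q, hq⟩]) (by
      intro i
      refine hψ ?_
      fin_cases i
      · exact hx0.trans (hw ⟨p, hp⟩).symm
      · exact hx1.trans (hw ⟨q, hq⟩).symm)
  exact ⟨e, fun i => by rw [heX]; exact hz' i, ψ, heψ, hess, hloc, w, hchart, hwass⟩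

end Comap

/-! ### Rings lying below a given ring: existence and uniqueness -/

section LiesBelow

theorem isFractionRing_of_le {k K : Type*} [Field k] [Field K] [Algebra k K] {R B : Subalgebra k K} (h : R ≤ B) [IsFractionRing R K] :
    IsFractionRing B K := by
  refine IsFractionRing.of_field B K fun x => ?_
  obtain ⟨a, b, hb, e⟩ := IsFractionRing.div_surjective (A := R) x
  exact ⟨Subalgebra.inclusion h a, Subalgebra.inclusion h b, e.symm⟩

variable {k K L : Type*} [Field k] [Field K] [Field L] [Algebra k K] [Algebra k L] [Algebra K L]

theorem IsLocalizedAt.algebraMap_mem {A : Type*} [CommRing A] [Algebra A L] {M : Ideal A}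
    [M.IsPrime] {T : Subalgebra k L} (h : IsLocalizedAt M T) (a : A) : algebraMap A L a ∈ T :=
  (h _).2 ⟨a, 1, ‹M.IsPrime›.one_notMem, by simp⟩

theorem IsLocalizedAt.mem_maximalIdeal_iff {A : Type*} [CommRing A] [Algebra A L]
    (hA : Function.Injective (algebraMap A L)) {M : Ideal A}
    [M.IsPrime] {T : Subalgebra k L} [IsLocalRing T] (h : IsLocalizedAt M T) (a : A) :
    (⟨algebraMap A L a, h.algebraMap_mem a⟩ : T) ∈ maximalIdeal T ↔ a ∈ M := by
  rw [IsLocalRing.mem_maximalIdeal, mem_nonunits_iff, ← not_iff_not, not_not]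
  have h0 : ∀ b ∉ M, algebraMap A L b ≠ 0 := fun b hb e => hb (by
    rw [(map_eq_zero_iff _ hA).1 e]
    exact zero_mem _)
  constructor
  · intro hu ha
    obtain ⟨⟨t, ht⟩, e⟩ := hu.exists_right_inv
    obtain ⟨x, y, hy, rfl⟩ := (h t).1 ht
    have e' : algebraMap A L a * (algebraMap A L x / algebraMap A L y) = 1 :=
      congrArg Subtype.val e
    have hy0 := h0 y hy
    rw [← mul_div_assoc, div_eq_one_iff_eq hy0, ← map_mul] at e'
    exact hy (hA e' ▸ M.mul_mem_right x ha)
  · intro ha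
    have hinv : (algebraMap A L a)⁻¹ ∈ T := (h _).2 ⟨1, a, ha, by simp⟩
    exact IsUnit.of_mul_eq_one ⟨_, hinv⟩ (Subtype.ext (mul_inv_cancel₀ (h0 a ha)))

variable [IsScalarTower k K L]

theorem LiesBelow.le_fieldComap {R : Subalgebra k K} {T : Subalgebra k L} (h : LiesBelow R T) :
    R ≤ fieldComap K T := by
  obtain ⟨M, hM, hT⟩ := h
  intro r hr
  exact hT.algebraMap_mem (algebraMap R (integralClosure R L) ⟨r, hr⟩)

/-- A local ring lying below `T` is dominated by `T`. -/
theorem LiesBelow.mem_maximalIdeal {R : Subalgebra k K} [IsLocalRing R] {T : Subalgebra k L}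
    [IsLocalRing T] (h : LiesBelow R T) {r : R} (hr : r ∈ maximalIdeal R) :
    fieldComapHom K T (Subalgebra.inclusion h.le_fieldComap r) ∈ maximalIdeal T := by
  obtain ⟨M, hM, hT⟩ := id h
  have hc : (M.comap (algebraMap R (integralClosure R L))).IsMaximal :=
    Ideal.isMaximal_comap_of_isIntegral_of_isMaximal M
  rw [← eq_maximalIdeal hc, Ideal.mem_comap,
    ← hT.mem_maximalIdeal_iff Subtype.val_injective] at hr
  exact hr

/-- The maximal ideal of a local ring `T` is the radical of the extension of the maximal ideal of a
local ring lying below `T`. -/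
theorem LiesBelow.maximalIdeal_le_radical {R : Subalgebra k K} [IsLocalRing R] {T : Subalgebra k L}
    [IsLocalRing T] (h : LiesBelow R T) :
    maximalIdeal T ≤ ((maximalIdeal R).map ((fieldComapHom K T).comp
      (Subalgebra.inclusion h.le_fieldComap))).radical := by
  obtain ⟨M, hM, hT⟩ := id h
  let ι : integralClosure R L →+* T :=
    (algebraMap (integralClosure R L) L).codRestrict T fun a => hT.algebraMap_mem a
  rw [Ideal.radical_eq_sInf]
  -- A prime `Q` containing the extension of the maximal ideal of `R` contracts to a maximal ideal
  -- of the integral closure. Its elements are nonunits of `T`, so it equals `M`; as `T` is the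
  -- localization at `M`, the prime `Q` contains the whole maximal ideal.
  refine le_sInf fun Q hQ => ?_
  obtain ⟨hQle, hQp⟩ := hQ
  have hQι : (Q.comap ι).IsPrime := hQp.comap ι
  have hle : maximalIdeal R ≤ (Q.comap ι).comap (algebraMap R (integralClosure R L)) := fun r hr =>
    hQle (Ideal.mem_map_of_mem _ hr)
  have hmax : ((Q.comap ι).comap (algebraMap R (integralClosure R L))).IsMaximal := by
    rw [← (maximalIdeal.isMaximal R).eq_of_le (Ideal.comap_ne_top _ hQι.ne_top) hle]
    exact maximalIdeal.isMaximal R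
  have hQmax : (Q.comap ι).IsMaximal :=
    Ideal.isMaximal_of_isIntegral_of_isMaximal_comap _ hmax
  have hQM : Q.comap ι = M := by
    refine hQmax.eq_of_le hM.ne_top fun a ha => ?_
    rw [← hT.mem_maximalIdeal_iff Subtype.val_injective]
    exact IsLocalRing.le_maximalIdeal hQp.ne_top ha
  intro t ht
  obtain ⟨x, y, hy, e⟩ := (hT t).1 t.2
  have hy0 : algebraMap (integralClosure R L) L y ≠ 0 := by
    intro h0
    have : y = 0 := Subtype.ext h0
    exact hy (this ▸ zero_mem _)
  have e' : t * ι y = ι x := Subtype.ext (by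
    change (t : L) * algebraMap (integralClosure R L) L y = algebraMap (integralClosure R L) L x
    rw [e, div_mul_cancel₀ _ hy0])
  have hx : ι x ∈ Q := by
    change x ∈ Q.comap ι
    rw [hQM, ← hT.mem_maximalIdeal_iff Subtype.val_injective]
    have : ι x ∈ maximalIdeal T := e' ▸ Ideal.mul_mem_right _ _ ht
    exact this
  have hyu : IsUnit (ι y) := by
    by_contra hyu
    exact hy ((hT.mem_maximalIdeal_iff Subtype.val_injective y).1
      ((IsLocalRing.mem_maximalIdeal _).2 hyu))
  rw [← e'] at hx
  exact (Ideal.mul_unit_mem_iff_mem Q hyu).1 hx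

theorem isIntegrallyClosed_fieldComap {T : Subalgebra k L} (hTint : ∀ f : L, IsIntegral T f → f ∈ T)
    [IsFractionRing (fieldComap K T) K] : IsIntegrallyClosed (fieldComap K T) := by
  let _ : Algebra (fieldComap K T) T := (fieldComapHom K T).toRingHom.toAlgebra
  have : IsScalarTower (fieldComap K T) T L := IsScalarTower.of_algebraMap_eq fun c => rfl
  rw [isIntegrallyClosed_iff K]
  intro x hx
  have hx' : IsIntegral (fieldComap K T) (algebraMap K L x) := hx.algebraMap
  exact ⟨⟨x, hTint _ hx'.tower_top⟩, rfl⟩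

variable {T : Subalgebra k L} [IsLocalRing T]

/-- `T ∩ K` lies below `T` if `T` is quasi-finite over it. -/
theorem liesBelow_fieldComap [Algebra.EssFiniteType k T]
    (hTint : ∀ f : L, IsIntegral T f → f ∈ T)
    (hres : ∀ t : T, ∃ c : k, t - algebraMap k T c ∈ maximalIdeal T)
    (hrad : maximalIdeal T ≤
      (((maximalIdeal T).comap (fieldComapHom K T)).map (fieldComapHom K T)).radical)
    [IsLocalRing (fieldComap K T)] : LiesBelow (fieldComap K T) T := by
  let B := fieldComap K T
  let _ : Algebra B T := (fieldComapHom K T).toRingHom.toAlgebra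
  have : IsScalarTower k B T := IsScalarTower.of_algebraMap_eq fun c =>
    ((fieldComapHom K T).commutes c).symm
  have : IsScalarTower B T L := IsScalarTower.of_algebraMap_eq fun c => rfl
  have : IsNoetherianRing T := Algebra.EssFiniteType.isNoetherianRing k T
  have hmem : ∀ a : integralClosure B L, (a : L) ∈ T := fun a => hTint a (a.2.tower_top)
  let ι : integralClosure B L →+* T := (algebraMap (integralClosure B L) L).codRestrict T hmem
  have hp : ((maximalIdeal T).comap ι).IsPrime := Ideal.IsPrime.comap ι
  have hc : (((maximalIdeal T).comap ι).comap (algebraMap B (integralClosure B L))).IsMaximal := by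
    have : ((maximalIdeal T).comap ι).comap (algebraMap B (integralClosure B L)) =
        maximalIdeal B := by
      have hle : ((maximalIdeal T).comap ι).comap (algebraMap B (integralClosure B L)) ≤
          maximalIdeal B :=
        IsLocalRing.le_maximalIdeal (Ideal.comap_ne_top _ hp.ne_top)
      refine le_antisymm hle fun b hb => ?_
      change fieldComapHom K T b ∈ maximalIdeal T
      rw [IsLocalRing.mem_maximalIdeal, mem_nonunits_iff] at hb ⊢
      refine fun hu => hb ?_
      obtain ⟨t, ht⟩ := hu.exists_right_inv
      have ht' : algebraMap K L b * t = 1 := congrArg Subtype.val ht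
      have hinv : (b : K)⁻¹ ∈ B := by
        change algebraMap K L (b : K)⁻¹ ∈ T
        rw [map_inv₀, ← eq_inv_of_mul_eq_one_right ht']
        exact t.2
      have hb0 : (b : K) ≠ 0 := by
        intro h0
        rw [h0, map_zero, zero_mul] at ht'
        exact zero_ne_one ht'
      exact IsUnit.of_mul_eq_one ⟨_, hinv⟩ (Subtype.ext (mul_inv_cancel₀ hb0))
    rw [this]
    exact maximalIdeal.isMaximal B
  refine ⟨(maximalIdeal T).comap ι, Ideal.isMaximal_of_isIntegral_of_isMaximal_comap _ hc,
    fun t => ⟨fun ht => ?_, ?_⟩⟩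
  -- The radical condition gives the finiteness needed for Zariski's main theorem, which writes `t`
  -- as a quotient of integral elements with denominator a unit of `T`.
  · obtain ⟨N, hN⟩ := Ideal.exists_pow_le_of_le_radical_of_fg hrad
      ((isNoetherianRing_iff_ideal_fg T).1 inferInstance _)
    obtain ⟨x, y, hx, hy, hym, e⟩ := IsLocalRing.exists_isIntegral_mul_eq (k := k) (A := B) hres N
      hN ⟨t, ht⟩
    refine ⟨⟨x, hx.algebraMap⟩, ⟨y, hy.algebraMap⟩, hym, ?_⟩
    have e' : (y : L) * t = x := congrArg Subtype.val e
    change t = (x : L) / y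
    have hy0 : (y : L) ≠ 0 := by
      intro h0
      have : y = 0 := Subtype.ext h0
      exact hym (this ▸ zero_mem _)
    rw [← e', mul_div_cancel_left₀ _ hy0]
  · rintro ⟨x, y, hy, rfl⟩
    have hyu : IsUnit (ι y) := by
      by_contra hyu
      exact hy ((IsLocalRing.mem_maximalIdeal _).2 hyu)
    obtain ⟨s, hs⟩ := hyu.exists_right_inv
    have hs' : algebraMap (integralClosure B L) L y * s = 1 := congrArg Subtype.val hs
    rw [div_eq_mul_inv, ← eq_inv_of_mul_eq_one_right hs']
    exact mul_mem (hmem x) s.2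

/-- A normal local ring lying below `T` is equal to `T ∩ K`, if the latter has residue field `k` and
ideals of it are contracted from `T`, up to radical. -/
theorem LiesBelow.eq_fieldComap [IsLocalRing (fieldComap K T)]
    [Algebra.EssFiniteType k (fieldComap K T)]
    (hres : ∀ t : fieldComap K T, ∃ c : k,
      t - algebraMap k (fieldComap K T) c ∈ maximalIdeal (fieldComap K T))
    (hpure : ∀ (I : Ideal (fieldComap K T)) (f : fieldComap K T),
      fieldComapHom K T f ∈ I.map (fieldComapHom K T) → f ∈ I)
    {R : Subalgebra k K} [IsLocalRing R] [IsFractionRing R K] [IsIntegrallyClosed R]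
    (h : LiesBelow R T) : R = fieldComap K T := by
  let B := fieldComap K T
  have hle : R ≤ B := h.le_fieldComap
  have hdomT : ∀ b : B, fieldComapHom K T b ∈ maximalIdeal T ↔ b ∈ maximalIdeal B := by
    intro b
    rw [IsLocalRing.mem_maximalIdeal, IsLocalRing.mem_maximalIdeal, mem_nonunits_iff,
      mem_nonunits_iff, not_iff_not]
    refine ⟨fun hu => ?_, fun hb => hb.map _⟩
    obtain ⟨t, ht⟩ := hu.exists_right_inv
    have ht' : algebraMap K L b * t = 1 := congrArg Subtype.val ht
    have hinv : (b : K)⁻¹ ∈ B := by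
      change algebraMap K L (b : K)⁻¹ ∈ T
      rw [map_inv₀, ← eq_inv_of_mul_eq_one_right ht']
      exact t.2
    have hb0 : (b : K) ≠ 0 := by
      intro h0
      rw [h0, map_zero, zero_mul] at ht'
      exact zero_ne_one ht'
    exact IsUnit.of_mul_eq_one ⟨_, hinv⟩ (Subtype.ext (mul_inv_cancel₀ hb0))
  let _ : Algebra R B := (Subalgebra.inclusion hle).toRingHom.toAlgebra
  have : IsScalarTower k R B := IsScalarTower.of_algebraMap_eq fun c =>
    ((Subalgebra.inclusion hle).commutes c).symm
  have : IsScalarTower R B K := IsScalarTower.of_algebraMap_eq fun c => rfl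
  have hmR : maximalIdeal R ≤ (maximalIdeal B).comap (algebraMap R B) := fun r hr =>
    (hdomT _).1 (h.mem_maximalIdeal hr)
  -- A power of `b` lies in the extension of the maximal ideal of `R` to `T`; purity brings this
  -- relation down to `B`.
  have hrad : maximalIdeal B ≤
      (((maximalIdeal B).comap (algebraMap R B)).map (algebraMap R B)).radical := by
    intro b hb
    obtain ⟨n, hn⟩ := h.maximalIdeal_le_radical ((hdomT b).2 hb)
    refine ⟨n, Ideal.map_mono hmR (hpure _ _ ?_)⟩
    rw [map_pow]
    exact Ideal.map_le_iff_le_comap.2 (fun r hr => Ideal.mem_map_of_mem _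
      (Ideal.mem_map_of_mem _ hr)) hn
  have : IsNoetherianRing B := Algebra.EssFiniteType.isNoetherianRing k B
  obtain ⟨N, hN⟩ := Ideal.exists_pow_le_of_le_radical_of_fg hrad
    ((isNoetherianRing_iff_ideal_fg B).1 inferInstance _)
  have hint : ∀ x : B, IsIntegral R x → (x : K) ∈ R := by
    intro x hx
    have hx' : IsIntegral R (x : K) := hx.algebraMap
    obtain ⟨y, hy⟩ := IsIntegrallyClosed.isIntegral_iff.1 hx'
    rw [← hy]
    exact y.2
  refine le_antisymm hle fun t ht => ?_
  obtain ⟨x, y, hx, hy, hym, e⟩ := IsLocalRing.exists_isIntegral_mul_eq (k := k) (A := R) hres N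
    hN ⟨t, ht⟩
  have e' : (y : K) * t = x := congrArg Subtype.val e
  -- Normality places the integral denominator in `R`. It is outside the maximal ideal of `B`, hence
  -- a unit of `R`.
  let y' : R := ⟨y, hint y hy⟩
  have hyu : IsUnit y' := by
    by_contra hyu
    exact hym (hmR ((IsLocalRing.mem_maximalIdeal y').2 hyu))
  obtain ⟨s, hs⟩ := hyu.exists_left_inv
  have hs' : (s : K) * y = 1 := congrArg Subtype.val hs
  have : t = s * x := by rw [← e', ← mul_assoc, hs', one_mul]
  rw [this]
  exact mul_mem s.2 (hint x hx)

end LiesBelow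

/-! ### The quotient description of the completed ring below -/

section ToricQuotient

open MvPowerSeries

theorem exists_algEquiv_invariants {k G A : Type*} [Field k] [Group G] [CommRing A] [Algebra k A] {σ : Type*}
    {Λ : AddSubmonoid (σ →₀ ℕ)} {ρ : G →* (MvPowerSeries σ k ≃ₐ[k] MvPowerSeries σ k)}
    (h : ∀ f, (∀ g, ρ g f = f) ↔ f ∈ supportedIn k Λ) (e : MvPowerSeries σ k ≃ₐ[k] A) :
    ∃ e' : supportedIn k Λ ≃ₐ[k] invariants ((AlgEquiv.autCongr e).toMonoidHom.comp ρ),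
      ∀ f, (e' f : A) = e f := by
  have hmap : (supportedIn k Λ).map (e : MvPowerSeries σ k →ₐ[k] A) =
      invariants ((AlgEquiv.autCongr e).toMonoidHom.comp ρ) := by
    ext a
    obtain ⟨f, rfl⟩ := e.surjective a
    have h1 : e f ∈ (supportedIn k Λ).map (e : MvPowerSeries σ k →ₐ[k] A) ↔
        f ∈ supportedIn k Λ := by
      constructor
      · rintro ⟨f', hf', he⟩
        exact e.injective he ▸ hf'
      · exact fun hf => ⟨f, hf, rfl⟩
    rw [h1, ← h]
    refine forall_congr' fun g => ?_
    change _ ↔ e (ρ g (e.symm (e f))) = e f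
    rw [e.symm_apply_apply, e.injective.eq_iff]
  exact ⟨(e.subalgebraMap (supportedIn k Λ)).trans (Subalgebra.equivOfEq _ _ hmap), fun f => rfl⟩

variable {k K L Γ₀ : Type*} [Field k] [IsAlgClosed k] [Field K] [Field L] [Algebra k K]
  [Algebra k L] [Algebra K L] [IsScalarTower k K L] [LinearOrderedCommGroupWithZero Γ₀]

/-- Two coordinate systems on the completion are needed. The action must be diagonal in the given
parameters `z`, while the embedding of `T ∩ K` in series supported in `Λ` uses parameters adjusted
by units. Passing from one to the other is `θ`. -/
theorem IsMonomialChart.exists_toric_quotient {μ : Valuation L Γ₀}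
    {ν : Valuation K Γ₀} (hext : μ.comap (algebraMap K L) = ν) {T : Subalgebra k L}
    [IsLocalRing T] [Algebra.EssFiniteType k T] [IsFractionRing T L] {z : Fin 2 → T}
    (h : IsMonomialChart μ T z)
    {R : Subalgebra k K} [IsLocalRing R] [Algebra.EssFiniteType k R] [IsFractionRing R K]
    {s : Fin 2 → R} (hR : IsMonomialChart ν R s) (hRT : R ≤ fieldComap K T)
    {a b c d : ℕ} (hD : ((a * d - b * c : ℤ) : k) ≠ 0) {δ₁ δ₂ : Tˣ}
    (hs0 : algebraMap K L (s 0) = ((z 0 ^ a * z 1 ^ b * δ₁ : T) : L))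
    (hs1 : algebraMap K L (s 1) = ((z 0 ^ c * z 1 ^ d * δ₂ : T) : L)) :
    ∃ (R₁ : Subalgebra k K) (_ : IsLocalRing R₁),
      IsAlgebraicNormalLocalRing R₁ ∧ LiesBelow R₁ T ∧
      (∀ R' : Subalgebra k K, IsAlgebraicNormalLocalRing R' → LiesBelow R' T → R' = R₁) ∧
      ∃ ρ : ValGroupQuotient μ ν →* (Completion T ≃ₐ[k] Completion T),
        Function.Injective ρ ∧
        (∀ g, ∃ ζ : Fin 2 → k, (∀ i, IsOfFinOrder (ζ i)) ∧
          ∀ i, ρ g (algebraMap T (Completion T) (z i)) =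
            algebraMap k (Completion T) (ζ i) * algebraMap T (Completion T) (z i)) ∧
        ∃ (e : Completion R₁ ≃ₐ[k] invariants ρ) (θ : Completion T ≃ₐ[k] Completion T),
          (∀ i, Associated (θ (algebraMap T (Completion T) (z i)))
            (algebraMap T (Completion T) (z i))) ∧
          ∀ (r : R₁) (s : T), (s : L) = algebraMap K L (r : K) →
            θ (e (algebraMap R₁ (Completion R₁) r) : Completion T) =
              algebraMap T (Completion T) s := by
  have : IsNoetherianRing T := Algebra.EssFiniteType.isNoetherianRing k T
  have hD0 : (a * d - b * c : ℤ) ≠ 0 := by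
    intro h0
    rw [h0, Int.cast_zero] at hD
    exact hD rfl
  have hN : ((a * d - b * c : ℤ).natAbs : k) ≠ 0 := by
    rcases Int.natAbs_eq (a * d - b * c : ℤ) with h | h <;> rw [h] at hD <;> simpa using hD
  have hfull := isFullSubmonoid_latticeSubmonoid hD0
  obtain ⟨e, heX, ψ, heψ, hess, hloc, w, hchart, hass⟩ :=
    h.exists_isToricChart_fieldComap hext hR hRT hD hs0 hs1
  have hTint : ∀ f : L, IsIntegral T f → f ∈ T := fun f hf => h.mem_of_isIntegral hf
  have hfrac : IsFractionRing (fieldComap K T) K := isFractionRing_of_le hRT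
  -- The `N`-th power of each parameter is associated to an element of `T ∩ K`, because `N eᵢ ∈ Λ`.
  have hrad : maximalIdeal T ≤
      (((maximalIdeal T).comap (fieldComapHom K T)).map (fieldComapHom K T)).radical := by
    rw [h.span, Ideal.span_le, ← h.span]
    rintro _ ⟨i, rfl⟩
    have h1 : Associated (z i ^ (a * d - b * c : ℤ).natAbs)
        (fieldComapHom K T (w ⟨_, hfull.single_mem i⟩)) := by
      refine Associated.trans (Associated.of_eq ?_) (hass _)
      fin_cases i <;> simp
    refine ⟨_, (Ideal.mem_iff_of_associated h1).2 (Ideal.mem_map_of_mem _ ?_)⟩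
    rw [Ideal.mem_comap, ← Ideal.mem_iff_of_associated h1]
    exact Ideal.pow_mem_of_mem _ (h.mem_maximalIdeal i) _ hfull.pos
  have hpure : ∀ (I : Ideal (fieldComap K T)) (f : fieldComap K T),
      fieldComapHom K T f ∈ I.map (fieldComapHom K T) → f ∈ I := by
    intro I f hf
    have : IsNoetherianRing (fieldComap K T) := Algebra.EssFiniteType.isNoetherianRing k _
    -- Since `ψ` factors through `T`, contraction from the power series ring implies contraction
    -- from `T`.
    refine hchart.mem_of_map_mem_map I ?_
    let χ : T →+* MvPowerSeries (Fin 2) k :=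
      (e.symm : Completion T →+* _).comp (algebraMap T (Completion T))
    have hχ : ∀ r, χ (fieldComapHom K T r) = ψ r := by
      intro r
      change e.symm (algebraMap T (Completion T) (fieldComapHom K T r)) = ψ r
      rw [← heψ, e.symm_apply_apply]
    have hle : I.map (fieldComapHom K T) ≤ (I.map ψ).comap χ := by
      refine Ideal.map_le_iff_le_comap.2 fun r hr => ?_
      change χ (fieldComapHom K T r) ∈ I.map ψ
      rw [hχ]
      exact Ideal.mem_map_of_mem _ hr
    rw [← hχ]
    exact hle hf
  obtain ⟨deg, hgen, hdeg⟩ := exists_generators_valGroupQuotient (μ := μ) (ν := ν)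
    (z := fun i => (z i : L)) h.ind h.valGroupGeneratedBy hR.valGroupGeneratedBy
    (a := a) (b := b) (c := c) (d := d)
    (by
      rw [← hext, Valuation.comap_apply, hs0, MulMemClass.coe_mul, map_mul,
        (h.dom.map_eq_one fun hm => (IsLocalRing.mem_maximalIdeal _).1 hm δ₁.isUnit), mul_one]
      simp)
    (by
      rw [← hext, Valuation.comap_apply, hs1, MulMemClass.coe_mul, map_mul,
        (h.dom.map_eq_one fun hm => (IsLocalRing.mem_maximalIdeal _).1 hm δ₂.isUnit), mul_one]
      simp)
  obtain ⟨ρ, hρ, hρX, hρinv⟩ := exists_diagonal_action hN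
    (pow_eq_one_of_isFullSubmonoid hgen hfull hdeg) deg hgen _ hdeg
  -- The coordinates `e₀` send the variables to the given parameters, `e` to the adjusted ones; `θ`
  -- is `e ∘ e₀⁻¹`.
  obtain ⟨e₀, he₀, -⟩ := h.exists_powerSeries_equiv fun i => Associated.refl _
  obtain ⟨e₁, he₁⟩ := hchart.exists_completion_equiv
  obtain ⟨e₂, he₂⟩ := exists_algEquiv_invariants hρinv e₀
  have he₀' : ∀ i, e₀.symm (algebraMap T (Completion T) (z i)) = X i := fun i => by
    rw [← he₀, e₀.symm_apply_apply]
  refine ⟨fieldComap K T, hloc, ⟨hloc, hess, hfrac, isIntegrallyClosed_fieldComap hTint⟩,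
    liesBelow_fieldComap hTint h.res hrad, fun R' hR' hlb => ?_,
    (AlgEquiv.autCongr e₀).toMonoidHom.comp ρ, (AlgEquiv.autCongr e₀).injective.comp hρ,
    fun g => ?_, e₁.trans e₂, e₀.symm.trans e, fun i => ?_, fun r t hrt => ?_⟩
  · have := hR'.isLocalRing
    have := hR'.isFractionRing
    have := hR'.isIntegrallyClosed
    exact hlb.eq_fieldComap hchart.res hpure
  · obtain ⟨ζ, hζ, hX⟩ := hρX g
    refine ⟨ζ, hζ, fun i => ?_⟩
    change e₀ (ρ g (e₀.symm (algebraMap T (Completion T) (z i)))) = _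
    rw [he₀', hX, map_mul, he₀, AlgEquiv.commutes]
  · change Associated (e (e₀.symm (algebraMap T (Completion T) (z i)))) _
    rw [he₀']
    exact heX i
  · change e (e₀.symm (e₂ (e₁ (algebraMap _ _ r)) : Completion T)) = _
    rw [he₂, e₀.symm_apply_apply, he₁, heψ]
    congr 1
    exact Subtype.ext hrt.symm

end ToricQuotient

/-! ### Rational rank and transcendence degree in the finite extension -/

section RationalRank

variable {E F Γ₀ : Type*} [Field E] [Field F] [LinearOrderedCommGroupWithZero Γ₀]

/-- If two monomials in `x, y` have rationally independent values, so do `x, y`. -/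
theorem RatIndep.of_monomials {μ : Valuation E Γ₀} {ν : Valuation F Γ₀} {u v : F}
    (h : RatIndep ν u v) {x y : E} {a b c d : ℕ} (hD : (a * d - b * c : ℤ) ≠ 0)
    (hu : ν u = μ x ^ a * μ y ^ b) (hv : ν v = μ x ^ c * μ y ^ d) : RatIndep μ x y := by
  obtain ⟨hu0, hv0, hind⟩ := h
  rw [← Valuation.ne_zero_iff ν, hu] at hu0
  rw [← Valuation.ne_zero_iff ν, hv] at hv0
  have hx : μ x ≠ 0 := by
    intro h0
    rw [h0] at hu0 hv0
    have ha : a = 0 := by by_contra ha; simp [ha] at hu0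
    have hc : c = 0 := by by_contra hc; simp [hc] at hv0
    exact hD (by simp [ha, hc])
  have hy : μ y ≠ 0 := by
    intro h0
    rw [h0] at hu0 hv0
    have hb : b = 0 := by by_contra hb; simp [hb] at hu0
    have hd : d = 0 := by by_contra hd; simp [hd] at hv0
    exact hD (by simp [hb, hd])
  refine ⟨(Valuation.ne_zero_iff μ).1 hx, (Valuation.ne_zero_iff μ).1 hy, fun m n e => ?_⟩
  -- These exponents solve the linear system up to the determinant `D`: the corresponding product of
  -- powers of `ν u` and `ν v` is `(μ x ^ m * μ y ^ n) ^ D = 1`.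
  obtain ⟨h1, h2⟩ := hind (m * d - n * c) (a * n - b * m) (by
    rw [hu, hv, zpow_monomial_mul_zpow_monomial hx hy]
    have e1 : (m * d - n * c) * a + (a * n - b * m) * c = m * (a * d - b * c) := by ring
    have e2 : (m * d - n * c) * b + (a * n - b * m) * d = n * (a * d - b * c) := by ring
    rw [e1, e2, zpow_mul, zpow_mul, ← mul_zpow, e, one_zpow])
  constructor
  · refine (mul_eq_zero.1 (?_ : m * (a * d - b * c : ℤ) = 0)).resolve_right hD
    linear_combination (a : ℤ) * h1 + c * h2
  · refine (mul_eq_zero.1 (?_ : n * (a * d - b * c : ℤ) = 0)).resolve_right hD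
    linear_combination (b : ℤ) * h1 + d * h2

theorem RatIndep.hasRationalRankTwo {μ : Valuation E Γ₀} {x y : E} (h : RatIndep μ x y)
    (hg : ValGroupGeneratedBy μ x y) : HasRationalRankTwo μ := by
  have hx0 : μ x ≠ 0 := (Valuation.ne_zero_iff μ).2 h.1
  have hy0 : μ y ≠ 0 := (Valuation.ne_zero_iff μ).2 h.2.1
  have hx : Units.mk0 _ hx0 ∈ valGroup μ := by
    rw [← SetLike.mem_coe, hg]
    exact ⟨1, 0, by simp⟩
  have hy : Units.mk0 _ hy0 ∈ valGroup μ := by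
    rw [← SetLike.mem_coe, hg]
    exact ⟨0, 1, by simp⟩
  let X : valGroup μ := ⟨_, hx⟩
  let Y : valGroup μ := ⟨_, hy⟩
  let B : Fin 2 → Additive (valGroup μ) := ![Additive.ofMul X, Additive.ofMul Y]
  have hli : LinearIndependent ℤ B := by
    rw [LinearIndependent.pair_iff]
    intro m n e
    have e1 : X ^ m * Y ^ n = 1 := e
    have e2 := congrArg (fun γ : valGroup μ => ((γ : Γ₀ˣ) : Γ₀)) e1
    push_cast at e2
    exact h.2.2 m n e2
  have hsp : ⊤ ≤ Submodule.span ℤ (Set.range B) := by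
    rintro γ -
    have h1 : ((Additive.toMul γ : valGroup μ) : Γ₀ˣ) ∈ (valGroup μ : Set Γ₀ˣ) :=
      (Additive.toMul γ).2
    rw [hg] at h1
    obtain ⟨m, n, e⟩ := h1
    have e1 : Additive.toMul γ = X ^ m * Y ^ n := by
      refine Subtype.ext (Units.ext ?_)
      rw [e]
      push_cast
      rfl
    have e2 : γ = m • B 0 + n • B 1 := e1
    rw [e2]
    exact add_mem (Submodule.smul_mem _ _ (Submodule.subset_span ⟨0, rfl⟩))
      (Submodule.smul_mem _ _ (Submodule.subset_span ⟨1, rfl⟩))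
  have := rank_eq_card_basis (Module.Basis.mk hli hsp)
  rw [HasRationalRankTwo, this]
  simp

end RationalRank

theorem trdeg_eq_of_isAlgebraic (k : Type*) {K L : Type*} [Field k] [Field K] [Field L]
    [Algebra k K] [Algebra k L] [Algebra K L] [IsScalarTower k K L] [Algebra.IsAlgebraic K L]
    {n : ℕ} (h : Algebra.trdeg k K = n) : Algebra.trdeg k L = n := by
  have h1 := lift_trdeg_add_eq k K L
  rw [h, trdeg_eq_zero (R := K)] at h1
  simpa [eq_comm] using h1

end

/-! ### The theorem -/

theorem lemma3p4 {k K L Γ₀ : Type*} [Field k] [IsAlgClosed k]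
    [Field K] [Field L] [Algebra k K] [Algebra k L] [Algebra K L] [IsScalarTower k K L]
    -- `K` is an algebraic function field of dimension 2 over `k`, and `L` is finite over `K`
    [Algebra.EssFiniteType k K] (hdim : Algebra.trdeg k K = 2) [FiniteDimensional K L]
    [LinearOrderedCommGroupWithZero Γ₀]
    (ν : Valuation K Γ₀) (μ : Valuation L Γ₀)
    (hext : μ.comap (algebraMap K L) = ν)
    (hrank : HasRankOne ν) (hratrank : HasRationalRankTwo ν)
    -- the algebraic regular local ring `R₀` of `K` with maximal ideal `(u, v)`
    (R₀ : Subalgebra k K) [IsRegularLocalRing R₀] [Algebra.EssFiniteType k R₀]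
    [IsFractionRing R₀ K] (u v : R₀)
    (hR₀ : IsLocalRing.maximalIdeal R₀ = Ideal.span {u, v})
    -- the algebraic regular local ring `S` of `L` with maximal ideal `(x, y)`
    (S : Subalgebra k L) [IsRegularLocalRing S] [Algebra.EssFiniteType k S]
    [IsFractionRing S L] (x y : S)
    (hS : IsLocalRing.maximalIdeal S = Ideal.span {x, y})
    (hdom : Dominates R₀ S)
    (a b c d : ℕ) (δ₁ δ₂ : Sˣ)
    (hu : algebraMap K L u = (x : L) ^ a * (y : L) ^ b * ((δ₁ : S) : L))
    (hv : algebraMap K L v = (x : L) ^ c * (y : L) ^ d * ((δ₂ : S) : L))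
    (hchar : ¬ ((ringChar k : ℤ) ∣ (a * d - b * c : ℤ)))
    (hμS : ValDominates μ S)
    (hind : RatIndep ν (u : K) (v : K)) :
    ValGroupGeneratedBy ν (u : K) (v : K) ∧
    HasRankOne μ ∧ HasRationalRankTwo μ ∧
    RatIndep μ (x : L) (y : L) ∧ ValGroupGeneratedBy μ (x : L) (y : L) ∧
    ∀ S₁ : Subalgebra k L, IsQuadraticSequenceAlong μ S S₁ →
      ∃ (_ : IsRegularLocalRing S₁) (x₁ y₁ : S₁), AreRegularParameters S₁ x₁ y₁ ∧
        (∃ a₁ b₁ c₁ d₁ : ℕ,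
          (x : L) = (x₁ : L) ^ a₁ * (y₁ : L) ^ b₁ ∧
          (y : L) = (x₁ : L) ^ c₁ * (y₁ : L) ^ d₁ ∧
          ((a₁ * d₁ - b₁ * c₁ : ℤ) = 1 ∨ (a₁ * d₁ - b₁ * c₁ : ℤ) = -1)) ∧
        ∃ (R₁ : Subalgebra k K) (_ : IsLocalRing R₁),
          IsAlgebraicNormalLocalRing R₁ ∧ LiesBelow R₁ S₁ ∧
          (∀ R' : Subalgebra k K,
            IsAlgebraicNormalLocalRing R' → LiesBelow R' S₁ → R' = R₁) ∧
          -- the action of `Γ_μ / Γ_ν` on the completion of `S₁`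
          ∃ ρ : ValGroupQuotient μ ν →* (Completion S₁ ≃ₐ[k] Completion S₁),
            Function.Injective ρ ∧
            (∀ g, ∃ ζ ξ : k, IsOfFinOrder ζ ∧ IsOfFinOrder ξ ∧
              ρ g (algebraMap S₁ (Completion S₁) x₁) =
                algebraMap k (Completion S₁) ζ * algebraMap S₁ (Completion S₁) x₁ ∧
              ρ g (algebraMap S₁ (Completion S₁) y₁) =
                algebraMap k (Completion S₁) ξ * algebraMap S₁ (Completion S₁) y₁) ∧
            -- the completion of `R₁` is isomorphic to the invariant ring, and after an
            -- automorphism `θ` changing `x₁, y₁` by units the isomorphism is the natural map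
            ∃ (e : Completion R₁ ≃ₐ[k] invariants ρ)
              (θ : Completion S₁ ≃ₐ[k] Completion S₁),
              Associated (θ (algebraMap S₁ (Completion S₁) x₁))
                (algebraMap S₁ (Completion S₁) x₁) ∧
              Associated (θ (algebraMap S₁ (Completion S₁) y₁))
                (algebraMap S₁ (Completion S₁) y₁) ∧
              ∀ (r : R₁) (s : S₁), (s : L) = algebraMap K L (r : K) →
                θ (e (algebraMap R₁ (Completion R₁) r) : Completion S₁) =
                  algebraMap S₁ (Completion S₁) s := by
  -- Zero is divisible by every integer, so the hypothesis excludes determinant zero in every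
  -- characteristic.
  have hD0 : (a * d - b * c : ℤ) ≠ 0 := fun h0 => hchar (h0 ▸ dvd_zero _)
  have hD : ((a * d - b * c : ℤ) : k) ≠ 0 := by
    rwa [Ne, CharP.intCast_eq_zero_iff k (ringChar k)]
  have hνμ : ∀ r : K, ν r = μ (algebraMap K L r) := fun r => by rw [← hext]; rfl
  have hδ : ∀ δ : Sˣ, μ ((δ : S) : L) = 1 := fun δ =>
    hμS.map_eq_one fun hm => (IsLocalRing.mem_maximalIdeal _).1 hm δ.isUnit
  have hμind : RatIndep μ (x : L) (y : L) := hind.of_monomials hD0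
    (by rw [hνμ, hu, map_mul, hδ, mul_one, map_mul, map_pow, map_pow])
    (by rw [hνμ, hv, map_mul, hδ, mul_one, map_mul, map_pow, map_pow])
  have hνR : ValDominates ν R₀ := by
    intro r
    obtain ⟨hr, hiff⟩ := hdom r
    have h1 := hμS ⟨_, hr⟩
    rw [hνμ]
    refine ⟨h1.1, h1.2.trans ?_⟩
    rw [← IsLocalRing.mem_maximalIdeal, hiff, IsLocalRing.mem_maximalIdeal]
  have hRS : R₀ ≤ fieldComap K S := fun r hr => (hdom ⟨r, hr⟩).1
  have hRchart : IsMonomialChart ν R₀ ![u, v] :=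
    { arch := hrank.isArchimedeanVal
      dom := hνR
      res := exists_sub_algebraMap_mem_maximalIdeal hdim.le hνR hind
      span := by rw [hR₀, Matrix.range_cons, Matrix.range_cons, Matrix.range_empty,
        Set.union_empty, Set.singleton_union]
      ind := hind }
  have hSchart : IsMonomialChart μ S ![x, y] :=
    { arch := hrank.isArchimedeanVal.of_isAlgebraic μ hext
      dom := hμS
      res := exists_sub_algebraMap_mem_maximalIdeal
        (trdeg_eq_of_isAlgebraic k (n := 2) (K := K) hdim).le hμS hμind
      span := by rw [hS, Matrix.range_cons, Matrix.range_cons, Matrix.range_empty,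
        Set.union_empty, Set.singleton_union]
      ind := hμind }
  have hμgen : ValGroupGeneratedBy μ (x : L) (y : L) := hSchart.valGroupGeneratedBy
  refine ⟨hRchart.valGroupGeneratedBy, hSchart.arch.hasRankOne hμind.1
    (hμS.map_lt_one (hSchart.mem_maximalIdeal 0)).ne, hμind.hasRationalRankTwo hμgen, hμind,
    hμgen, fun S₁ hS₁ => ?_⟩
  obtain ⟨hle, hess, hloc, z, hz, a₁, b₁, c₁, d₁, hx, hy, hdet⟩ :=
    hSchart.exists_chart_of_quadraticSequence hS₁
  change (x : L) = _ at hx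
  change (y : L) = _ at hy
  have hnoeth : IsNoetherianRing S₁ := Algebra.EssFiniteType.isNoetherianRing k S₁
  have hfrac : IsFractionRing S₁ L := isFractionRing_of_le hle
  -- The exponents of `u`, `v` in the new parameters form the product of the two exponent matrices;
  -- the second has determinant `±1`, so the determinant stays nonzero in `k`.
  have hdet' : (((a * a₁ + b * c₁ : ℕ) * (c * b₁ + d * d₁ : ℕ) -
      (a * b₁ + b * d₁ : ℕ) * (c * a₁ + d * c₁ : ℕ) : ℤ) : k) ≠ 0 := by
    have e : ((a * a₁ + b * c₁ : ℕ) * (c * b₁ + d * d₁ : ℕ) -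
        (a * b₁ + b * d₁ : ℕ) * (c * a₁ + d * c₁ : ℕ) : ℤ) =
        (a * d - b * c) * (a₁ * d₁ - b₁ * c₁) := by
      push_cast
      ring
    rw [e, Int.cast_mul]
    refine mul_ne_zero hD ?_
    rcases hdet with h | h <;> rw [h] <;> simp
  have hmon : ∀ (m n : ℕ) (δ : Sˣ), (x : L) ^ m * (y : L) ^ n * ((δ : S) : L) =
      ((z 0 ^ (m * a₁ + n * c₁) * z 1 ^ (m * b₁ + n * d₁) *
        Units.map (Subalgebra.inclusion hle : S →* S₁) δ : S₁) : L) := by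
    intro m n δ
    rw [hx, hy]
    push_cast
    have : ((Units.map (Subalgebra.inclusion hle : S →* S₁) δ : S₁) : L) = ((δ : S) : L) := rfl
    rw [this]
    ring
  obtain ⟨R₁, hR₁, hnormal, hbelow, huniq, ρ, hρ, hρz, e, θ, hθ, heθ⟩ :=
    hz.exists_toric_quotient hext hRchart (hRS.trans fun r hr => hle hr) hdet'
      (hu.trans (hmon a b δ₁)) (hv.trans (hmon c d δ₂))
  refine ⟨hz.isRegularLocalRing, z 0, z 1, ⟨hz.ringKrullDim_eq, ?_⟩,
    ⟨a₁, b₁, c₁, d₁, hx, hy, hdet⟩, R₁, hR₁, hnormal, hbelow, huniq, ρ, hρ, fun g => ?_, e, θ,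
    hθ 0, hθ 1, heθ⟩
  · rw [hz.span]
    congr 1
    ext t
    simp [Fin.exists_fin_two, eq_comm]
  · obtain ⟨ζ, hζ, hζz⟩ := hρz g
    exact ⟨ζ 0, ζ 1, hζ 0, hζ 1, hζz 0, hζz 1⟩
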